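/- **Setting.** Let $d\ge 1$, let $A\in\mathbb R^{d\times d}$ be positive definite, $\sigma>0$, and $\|u\|_M=\sqrt{u^\top M u}$. The action set is the centered ellipsoid $\mathcal X=\{x\in\mathbb R^d:\|x\|_{A^{-1}}\le 1\}$. In each of the rounds $t=0,1,\dots,T-1$ a learner plays an action $x_t\in\mathcal X$ that is a measurable function of the past rewards $y_0,\dots,y_{t-1}$ (and possibly of an independent private random seed), and receives $y_t=x_t^\top\theta+z_t$, where $\theta\in\mathbb R^d$ is unknown and the $z_t$ are independent, centered and $\sigma^2$-subgaussian: $\mathbb E\,e^{\lambda z_t}\le e^{\lambda^2\sigma^2/2}$ for all $\lambda\in\mathbb R$. With $x^\star(\theta)=A\theta/\|\theta\|_A$ (and $x^\star(0)=0$), which maximizes $x^\top\theta$ over $\mathcal X$, the regret is $R_T(\theta)=\mathbb E\big[\sum_{t<T}(x^\star(\theta)^\top\theta-x_t^\top\theta)\big]$. **Algorithm E2TC** (input $A,\sigma,T$; parameter $\alpha=3$). Let $n_i=d2^{i-1}$, $T_i=d(2^i-1)$, $\delta_i=\min(dn_i/T,1)$ and $U(\delta,n)^2=\frac{\sigma^2d^2}{n}\big(1+2\sqrt{\tfrac1d\log\tfrac1\delta}+\tfrac2d\log\tfrac1\delta\big)$,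 with $U\ge 0$. While exploring, play $x_t=A^{1/2}e_{(t\bmod d)+1}$ in round $t$, where $e_1,\dots,e_d$ is the standard basis. (1) Warm-up: explore; for $i=1,2,\dots$ let $\hat\theta_i$ be the least-squares estimate $(X^\top X)^{-1}X^\top Y$ of $\theta$ based on the $n_i$ rounds $T_{i-1},\dots,T_i-1$ only ($X$ having the actions as rows, $Y$ the rewards as entries); stop the warm-up at the first $i$ with $\|\hat\theta_i\|_A>\alpha\,U(\delta_i,n_i)$, and put $\hat B=\|\hat\theta_i\|_A$. (2) Explore during $N_e=d\lceil\sigma\sqrt T/\hat B\rceil$ further rounds $T_i,\dots,T_i+N_e-1$, and let $\hat\theta$ be the least-squares estimate based on these $N_e$ rounds only. (3) Play $x^\star(\hat\theta)$ in all later rounds. The algorithm is interrupted at the end of the $T$ rounds, whichever phase it is in. **Claim.** There are universal constants $C,c>0$ (not depending on any parameter) such that: (a) for all $d\ge1$, $A$, $\sigma$, all noise laws as above, all $\theta\in\mathbb R^d$ and all $T\ge0$, the regret of E2TC satisfies $$R_T(\theta)\le C\,\min\big(\sigma d\sqrt T+d\|\theta\|_A,\;T\|\theta\|_A\big);$$ (b)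 E2TC is locally asymptotically minimax optimal: for all $d\ge2$, $A$, $\sigma$, all $\theta\in\mathbb R^d$ and all algorithms $\mathcal A'$ (which may depend on $T$), there are $\theta'_T\in\mathbb R^d$ with $\lim_{T\to\infty}\theta'_T=\theta$ such that, for every $T$, $$R_T^{\mathcal A'}(\theta'_T)\ge c\,R_T^{\mathrm{E2TC}}(\theta),$$ where the regret on the left is taken under independent $\mathcal N(0,\sigma^2)$ noise, and the inequality holds for every noise law as above on the right. -/

import Mathlib

open MeasureTheory ProbabilityTheory Filter Topology
open scoped NNReal Matrix MatrixOrder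

noncomputable section

namespace EllipsoidBandit

variable {d : ℕ}

/-- The norm `‖u‖_M = √(uᵀ M u)` attached to a positive definite matrix `M`. -/
def matNorm (M : Matrix (Fin d) (Fin d) ℝ) (u : Fin d → ℝ) : ℝ :=
  Real.sqrt (u ⬝ᵥ (M *ᵥ u))

/-- The centered ellipsoid `{x : ‖x‖_{A⁻¹} ≤ 1}`, which is the action set. -/
def ellipsoid (A : Matrix (Fin d) (Fin d) ℝ) : Set (Fin d → ℝ) :=
  {x | matNorm A⁻¹ x ≤ 1}

/-- The optimal action `x⋆(θ) = A θ / ‖θ‖_A` (it is `0` if `θ = 0`, when all actions are optimal). -/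
def optimalAction (A : Matrix (Fin d) (Fin d) ℝ) (θ : Fin d → ℝ) : Fin d → ℝ :=
  (matNorm A θ)⁻¹ • (A *ᵥ θ)

/-- A (possibly randomized) bandit algorithm with actions in `X`. In round `t = 0, 1, 2, …` it plays
`act t u h`, where `u` is the private random seed, drawn from `law` before the first round, and
`h = (y₀, …, y_{t-1})` are the rewards received so far. -/
structure Algorithm (X : Set (Fin d → ℝ)) where
  Seed : Type
  mSeed : MeasurableSpace Seed
  law : Measure Seed
  isProb : IsProbabilityMeasure law
  act : (t : ℕ) → Seed → (Fin t → ℝ) → (Fin d → ℝ)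
  measurable_act : ∀ t, Measurable fun p : Seed × (Fin t → ℝ) => act t p.1 p.2
  act_mem : ∀ t u h, act t u h ∈ X

attribute [instance] Algorithm.mSeed Algorithm.isProb

/-- The reward `y_t = x_tᵀ θ + z_t` of round `t` when the seed is `u` and the noise is `z`. -/
def reward {X : Set (Fin d → ℝ)} (𝒜 : Algorithm X) (θ : Fin d → ℝ) (u : 𝒜.Seed) (z : ℕ → ℝ) :
    ℕ → ℝ
  | t => 𝒜.act t u (fun s : Fin t => reward 𝒜 θ u z s) ⬝ᵥ θ + z t
termination_by t => t
decreasing_by exact s.isLt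

/-- The action `x_t` played in round `t` when the seed is `u` and the noise is `z`. -/
def action {X : Set (Fin d → ℝ)} (𝒜 : Algorithm X) (θ : Fin d → ℝ) (u : 𝒜.Seed) (z : ℕ → ℝ)
    (t : ℕ) : Fin d → ℝ :=
  𝒜.act t u (fun s : Fin t => reward 𝒜 θ u z s)

/-- The expected regret over the rounds `0, …, T - 1` on the ellipsoid of `A`, when the mean-reward
vector is `θ` and the noise variables `z_t` are independent (and independent of the seed) with laws
`ν t`. -/
def regret {A : Matrix (Fin d) (Fin d) ℝ} (𝒜 : Algorithm (ellipsoid A)) (θ : Fin d → ℝ)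
    (ν : ℕ → Measure ℝ) [∀ t, IsProbabilityMeasure (ν t)] (T : ℕ) : ℝ :=
  ∫ p : 𝒜.Seed × (ℕ → ℝ),
    (∑ t ∈ Finset.range T, (optimalAction A θ ⬝ᵥ θ - action 𝒜 θ p.1 p.2 t ⬝ᵥ θ))
    ∂(𝒜.law.prod (Measure.infinitePi ν))

/-- The noise laws `ν t` are centered and subgaussian with variance proxy `σ²`. -/
def IsSubgaussianNoise (σ : ℝ≥0) (ν : ℕ → Measure ℝ) : Prop :=
  ∀ t, ∫ x, x ∂(ν t) = 0 ∧ HasSubgaussianMGF (fun x : ℝ => x) (σ ^ 2) (ν t)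

/-- A family `T ↦ 𝒜 T` of algorithms (`𝒜 T` is tuned for the horizon `T`) is locally asymptotically
minimax optimal, with constant `c`: for every `θ` and every competing family `ℬ` there are `θ'_T → θ`
such that, for every `T`, the regret of `ℬ T` at `θ'_T`, in the instance with Gaussian `N(0, σ²)`
noise, is at least `c` times the regret of `𝒜 T` at `θ`, whatever the `σ²`-subgaussian noise of the
latter. -/
def LocallyAsymptoticallyMinimaxOptimal (c : ℝ) {A : Matrix (Fin d) (Fin d) ℝ} (σ : ℝ≥0)
    (𝒜 : ℕ → Algorithm (ellipsoid A)) : Prop :=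
  ∀ (θ : Fin d → ℝ) (ℬ : ℕ → Algorithm (ellipsoid A)),
    ∃ θ' : ℕ → Fin d → ℝ, Tendsto θ' atTop (𝓝 θ) ∧
      ∀ (T : ℕ) (ν : ℕ → Measure ℝ) [∀ t, IsProbabilityMeasure (ν t)], IsSubgaussianNoise σ ν →
        c * regret (𝒜 T) θ ν T ≤ regret (ℬ T) (θ' T) (fun _ => gaussianReal 0 (σ ^ 2)) T

/-! ### The algorithm E2TC -/

/-- The ordinary least-squares estimate `(Xᵀ X)⁻¹ Xᵀ Y`. -/
def leastSquares {n : ℕ} (X : Matrix (Fin n) (Fin d) ℝ) (Y : Fin n → ℝ) : Fin d → ℝ :=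
  (Xᵀ * X)⁻¹ *ᵥ (Xᵀ *ᵥ Y)

/-- The round-robin action `A^{1/2} e_{t mod d}` of round `t` (coordinates are numbered from `0`). -/
def exploreAction [NeZero d] (A : Matrix (Fin d) (Fin d) ℝ) (t : ℕ) : Fin d → ℝ :=
  CFC.sqrt A *ᵥ Pi.single (Fin.ofNat d t) 1

/-- The least-squares estimate based on the `n` exploration rounds `s, s + 1, …, s + n - 1`, where
`y t` is the reward received in round `t`. -/
def exploreEstimate [NeZero d] (A : Matrix (Fin d) (Fin d) ℝ) (s n : ℕ) (y : ℕ → ℝ) : Fin d → ℝ :=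
  leastSquares (Matrix.of fun k : Fin n => exploreAction A (s + k)) (fun k : Fin n => y (s + k))

/-- The length `n_i = d 2^{i-1}` of the `i`-th batch of the warm-up, `i ≥ 1`. -/
def batchLen (d i : ℕ) : ℕ := d * 2 ^ (i - 1)

/-- The time `T_i = d (2^i - 1)`; the `i`-th batch consists of the rounds `T_{i-1}, …, T_i - 1`. -/
def batchEnd (d i : ℕ) : ℕ := d * (2 ^ i - 1)

/-- `δ_i = min (d n_i / T, 1)`. -/
def batchDelta (d T i : ℕ) : ℝ := min ((d : ℝ) * batchLen d i / T) 1

/-- The threshold `U(δ, n)`, where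
`U(δ, n)² = (σ² d² / n) (1 + 2 √(log(1/δ) / d) + (2/d) log(1/δ))`. -/
def threshold (d : ℕ) (σ δ : ℝ) (n : ℕ) : ℝ :=
  Real.sqrt (σ ^ 2 * (d : ℝ) ^ 2 / n *
    (1 + 2 * Real.sqrt (1 / d * Real.log (1 / δ)) + 2 / d * Real.log (1 / δ)))

/-- The estimate `θ̂_i` computed from the `i`-th batch of the warm-up. -/
def batchEstimate [NeZero d] (A : Matrix (Fin d) (Fin d) ℝ) (i : ℕ) (y : ℕ → ℝ) : Fin d → ℝ :=
  exploreEstimate A (batchEnd d (i - 1)) (batchLen d i) y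

/-- The batches `i ≥ 1` which are complete before round `t` and whose estimate passes the test
`‖θ̂_i‖_A > α U(δ_i, n_i)`. The warm-up stops after the first of them. -/
def exitBatches [NeZero d] (A : Matrix (Fin d) (Fin d) ℝ) (σ α : ℝ) (T t : ℕ) (y : ℕ → ℝ) : Set ℕ :=
  {i | 1 ≤ i ∧ batchEnd d i ≤ t ∧
    α * threshold d σ (batchDelta d T i) (batchLen d i) < matNorm A (batchEstimate A i y)}

/-- The number `N_e = d ⌈σ √T / B̂⌉` of rounds of the second phase, where `B̂ = ‖θ̂_i‖_A` and `i` is the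
last batch of the warm-up. -/
def exploreLen [NeZero d] (A : Matrix (Fin d) (Fin d) ℝ) (σ : ℝ) (T i : ℕ) (y : ℕ → ℝ) : ℕ :=
  d * ⌈σ * Real.sqrt T / matNorm A (batchEstimate A i y)⌉₊

/-- The action of round `t` if the warm-up has stopped after batch `i`: explore round-robin during `N_e`
further rounds (the rounds `T_i, …, T_i + N_e - 1`), then commit to the optimal action of the
least-squares estimate based on these `N_e` rounds. -/
def afterWarmup [NeZero d] (A : Matrix (Fin d) (Fin d) ℝ) (σ : ℝ) (T t i : ℕ) (y : ℕ → ℝ) :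
    Fin d → ℝ :=
  if t < batchEnd d i + exploreLen A σ T i y then exploreAction A t
  else optimalAction A (exploreEstimate A (batchEnd d i) (exploreLen A σ T i y) y)

open Classical in
/-- The action of E2TC in round `t`, given the rewards `y 0, …, y (t - 1)`: explore round-robin as long
as no complete batch has passed the test, and follow `afterWarmup` from the first such batch on. -/
def e2tcAction [NeZero d] (A : Matrix (Fin d) (Fin d) ℝ) (σ α : ℝ) (T t : ℕ) (y : ℕ → ℝ) :
    Fin d → ℝ :=
  if (exitBatches A σ α T t y).Nonempty then
    afterWarmup A σ T t (sInf (exitBatches A σ α T t y)) y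
  else exploreAction A t

/-- The finite history `h = (y₀, …, y_{t-1})`, extended by `0`. -/
def padHistory {t : ℕ} (h : Fin t → ℝ) (s : ℕ) : ℝ := if hs : s < t then h ⟨s, hs⟩ else 0

/-! ### The actions are admissible -/

lemma matNorm_sq {M : Matrix (Fin d) (Fin d) ℝ} (hM : M.PosDef) (u : Fin d → ℝ) :
    matNorm M u ^ 2 = u ⬝ᵥ (M *ᵥ u) := by
  refine Real.sq_sqrt ?_
  simpa using hM.posSemidef.dotProduct_mulVec_nonneg u

lemma optimalAction_mem {A : Matrix (Fin d) (Fin d) ℝ} (hA : A.PosDef) (θ : Fin d → ℝ) :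
    optimalAction A θ ∈ ellipsoid A := by
  have hdet : IsUnit A.det := (Matrix.isUnit_iff_isUnit_det A).1 hA.isUnit
  have key : matNorm A⁻¹ (optimalAction A θ) ^ 2 = ((matNorm A θ)⁻¹ * matNorm A θ) ^ 2 := by
    rw [matNorm_sq hA.inv, mul_pow, matNorm_sq hA, optimalAction, Matrix.mulVec_smul,
      Matrix.mulVec_mulVec, Matrix.nonsing_inv_mul A hdet, Matrix.one_mulVec, smul_dotProduct,
      dotProduct_smul, dotProduct_comm, smul_eq_mul, smul_eq_mul]
    ring
  have h1 : (matNorm A θ)⁻¹ * matNorm A θ ≤ 1 := inv_mul_le_one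
  have h0 : 0 ≤ (matNorm A θ)⁻¹ * matNorm A θ :=
    mul_nonneg (inv_nonneg.2 (Real.sqrt_nonneg _)) (Real.sqrt_nonneg _)
  have hn : 0 ≤ matNorm A⁻¹ (optimalAction A θ) := Real.sqrt_nonneg _
  show matNorm A⁻¹ (optimalAction A θ) ≤ 1
  nlinarith

/-- `x⋆(θ)` attains the maximum of `xᵀ θ` over the action set. -/
lemma isMaxOn_optimalAction {A : Matrix (Fin d) (Fin d) ℝ} (hA : A.PosDef) (θ : Fin d → ℝ) :
    IsMaxOn (fun x : Fin d → ℝ => x ⬝ᵥ θ) (ellipsoid A) (optimalAction A θ) := by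
  intro x hx
  have hdet : IsUnit A.det := (Matrix.isUnit_iff_isUnit_det A).1 hA.isUnit
  have hsymm : (A⁻¹)ᵀ = A⁻¹ := by simpa using hA.inv.isHermitian.eq
  rcases eq_or_ne θ 0 with rfl | hθ
  · simp
  set b := matNorm A θ with hb
  have hb2 : b ^ 2 = θ ⬝ᵥ (A *ᵥ θ) := matNorm_sq hA θ
  have hbpos : 0 < b := by
    refine Real.sqrt_pos.2 ?_
    simpa using hA.dotProduct_mulVec_pos hθ
  have hx1 : matNorm A⁻¹ x ≤ 1 := hx
  have hx2 : x ⬝ᵥ (A⁻¹ *ᵥ x) ≤ 1 := by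
    rw [← matNorm_sq hA.inv]
    have : 0 ≤ matNorm A⁻¹ x := Real.sqrt_nonneg _
    nlinarith
  have hval : optimalAction A θ ⬝ᵥ θ = b := by
    rw [optimalAction, smul_dotProduct, dotProduct_comm, ← hb2, smul_eq_mul, ← hb]
    field_simp
  have hpos : 0 ≤ (b • x - A *ᵥ θ) ⬝ᵥ (A⁻¹ *ᵥ (b • x - A *ᵥ θ)) := by
    simpa using hA.inv.posSemidef.dotProduct_mulVec_nonneg (b • x - A *ᵥ θ)
  have hcross : (A *ᵥ θ) ⬝ᵥ (A⁻¹ *ᵥ x) = x ⬝ᵥ θ := by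
    rw [Matrix.dotProduct_mulVec, ← Matrix.mulVec_transpose, hsymm, Matrix.mulVec_mulVec,
      Matrix.nonsing_inv_mul A hdet, Matrix.one_mulVec, dotProduct_comm]
  have hexp : (b • x - A *ᵥ θ) ⬝ᵥ (A⁻¹ *ᵥ (b • x - A *ᵥ θ))
      = b ^ 2 * (x ⬝ᵥ (A⁻¹ *ᵥ x)) - 2 * b * (x ⬝ᵥ θ) + b ^ 2 := by
    rw [Matrix.mulVec_sub, Matrix.mulVec_smul, Matrix.mulVec_mulVec, Matrix.nonsing_inv_mul A hdet,
      Matrix.one_mulVec, sub_dotProduct, dotProduct_sub, dotProduct_sub, smul_dotProduct,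
      smul_dotProduct, dotProduct_smul, dotProduct_smul, hcross, dotProduct_comm (A *ᵥ θ) θ, ← hb2]
    simp only [smul_eq_mul]
    ring
  show x ⬝ᵥ θ ≤ optimalAction A θ ⬝ᵥ θ
  rw [hval]
  rw [hexp] at hpos
  by_contra! hlt
  nlinarith [mul_pos hbpos (sub_pos.2 hlt), mul_nonneg (sq_nonneg b) (sub_nonneg.2 hx2)]

lemma exploreAction_mem [NeZero d] {A : Matrix (Fin d) (Fin d) ℝ} (hA : A.PosDef) (t : ℕ) :
    exploreAction A t ∈ ellipsoid A := by
  set S := CFC.sqrt A with hS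
  have hSS : S * S = A := CFC.sqrt_mul_sqrt_self A hA.posSemidef.nonneg
  have hsymm : Sᵀ = S := by
    simpa using (Matrix.nonneg_iff_posSemidef.1 (CFC.sqrt_nonneg A)).isHermitian.eq
  have hdet : IsUnit S.det := by
    have h : IsUnit A.det := (Matrix.isUnit_iff_isUnit_det A).1 hA.isUnit
    rw [← hSS, Matrix.det_mul] at h
    exact isUnit_of_mul_isUnit_left h
  set e : Fin d → ℝ := Pi.single (Fin.ofNat d t) 1 with he
  have h1 : (S *ᵥ e) ⬝ᵥ (A⁻¹ *ᵥ (S *ᵥ e)) = 1 := by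
    rw [← hSS, Matrix.mul_inv_rev, Matrix.mulVec_mulVec, Matrix.mul_assoc,
      Matrix.nonsing_inv_mul S hdet, Matrix.mul_one, Matrix.dotProduct_mulVec,
      ← Matrix.mulVec_transpose, Matrix.transpose_nonsing_inv, hsymm, Matrix.mulVec_mulVec,
      Matrix.nonsing_inv_mul S hdet, Matrix.one_mulVec, he]
    simp
  show matNorm A⁻¹ (S *ᵥ e) ≤ 1
  rw [matNorm, h1, Real.sqrt_one]

lemma e2tcAction_mem [NeZero d] {A : Matrix (Fin d) (Fin d) ℝ} (hA : A.PosDef) (σ α : ℝ) (T t : ℕ)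
    (y : ℕ → ℝ) : e2tcAction A σ α T t y ∈ ellipsoid A := by
  unfold e2tcAction afterWarmup
  split_ifs
  · exact exploreAction_mem hA t
  · exact optimalAction_mem hA _
  · exact exploreAction_mem hA t

lemma measurable_mulVec {m n : ℕ} (M : Matrix (Fin m) (Fin n) ℝ) :
    Measurable fun v : Fin n → ℝ => M *ᵥ v := by
  refine measurable_pi_iff.2 fun i => ?_
  simp only [Matrix.mulVec, dotProduct]
  fun_prop

lemma measurable_matNorm (M : Matrix (Fin d) (Fin d) ℝ) : Measurable (matNorm M) := by
  unfold matNorm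
  simp only [Matrix.mulVec, dotProduct]
  fun_prop

lemma measurable_optimalAction (A : Matrix (Fin d) (Fin d) ℝ) : Measurable (optimalAction A) :=
  (measurable_matNorm A).inv.smul (measurable_mulVec A)

lemma measurable_exploreEstimate [NeZero d] (A : Matrix (Fin d) (Fin d) ℝ) (s n : ℕ) :
    Measurable (exploreEstimate A s n) := by
  unfold exploreEstimate leastSquares
  refine (measurable_mulVec _).comp ((measurable_mulVec _).comp ?_)
  exact measurable_pi_iff.2 fun k => measurable_pi_apply _

lemma measurable_e2tcAction [NeZero d] (A : Matrix (Fin d) (Fin d) ℝ) (σ α : ℝ) (T t : ℕ) :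
    Measurable (e2tcAction A σ α T t) := by
  classical
  have hB : ∀ i, Measurable fun y => matNorm A (batchEstimate A i y) := fun i =>
    (measurable_matNorm A).comp (measurable_exploreEstimate A _ _)
  have hset : ∀ i, MeasurableSet {y | i ∈ exitBatches A σ α T t y} := fun i => by
    have : {y | i ∈ exitBatches A σ α T t y} =
        {y | 1 ≤ i ∧ batchEnd d i ≤ t} ∩ {y | α * threshold d σ (batchDelta d T i) (batchLen d i)
          < matNorm A (batchEstimate A i y)} := by
      ext y; simp [exitBatches, and_assoc]
    rw [this]
    exact (MeasurableSet.const _).inter (measurableSet_lt measurable_const (hB i))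
  have hne : MeasurableSet {y | (exitBatches A σ α T t y).Nonempty} := by
    have : {y | (exitBatches A σ α T t y).Nonempty} =
        ⋃ i, {y | i ∈ exitBatches A σ α T t y} := by
      ext y; simp [Set.Nonempty]
    rw [this]
    exact MeasurableSet.iUnion hset
  have hex : ∀ y, ∃ i, i ∈ exitBatches A σ α T t y ∨ ¬ (exitBatches A σ α T t y).Nonempty := by
    intro y
    by_cases h : (exitBatches A σ α T t y).Nonempty
    · exact ⟨h.some, Or.inl h.some_mem⟩
    · exact ⟨0, Or.inr h⟩
  have hfind : ∀ y, sInf (exitBatches A σ α T t y) = Nat.find (hex y) := by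
    intro y
    by_cases h : (exitBatches A σ α T t y).Nonempty
    · refine le_antisymm ?_ ?_
      · rcases Nat.find_spec (hex y) with h' | h'
        · exact Nat.sInf_le h'
        · exact absurd h h'
      · exact Nat.find_min' _ (Or.inl (Nat.sInf_mem h))
    · have h0 : Nat.find (hex y) = 0 := (Nat.find_eq_zero _).2 (Or.inr h)
      rw [h0, Set.not_nonempty_iff_eq_empty.1 h, Nat.sInf_empty]
  have hinf : Measurable fun y => sInf (exitBatches A σ α T t y) := by
    simp only [hfind]
    exact measurable_find hex fun i => (hset i).union hne.compl
  have hlen : ∀ i, Measurable (exploreLen A σ T i) := fun i => by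
    unfold exploreLen
    exact (measurable_from_top (f := fun n : ℕ => d * n)).comp
      (Nat.measurable_ceil.comp (measurable_const.div (hB i)))
  have hcommit : ∀ s, Measurable fun p : ℕ × (ℕ → ℝ) => exploreEstimate A s p.1 p.2 := fun s =>
    measurable_from_prod_countable_right fun n => measurable_exploreEstimate A s n
  have hest : ∀ i, Measurable fun y =>
      exploreEstimate A (batchEnd d i) (exploreLen A σ T i y) y := fun i => by
    have hp : Measurable fun y : ℕ → ℝ => (exploreLen A σ T i y, y) :=
      (hlen i).prodMk measurable_id
    have := (hcommit (batchEnd d i)).comp hp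
    simpa only [Function.comp_def] using this
  have hbody : ∀ i, Measurable (afterWarmup A σ T t i) := fun i => by
    have hs : MeasurableSet {y | t < batchEnd d i + exploreLen A σ T i y} :=
      measurableSet_lt measurable_const (measurable_const.add (hlen i))
    have hopt := (measurable_optimalAction A).comp (hest i)
    simp only [Function.comp_def] at hopt
    unfold afterWarmup
    exact Measurable.ite (p := fun y => t < batchEnd d i + exploreLen A σ T i y) hs
      measurable_const hopt
  have hpair : Measurable fun p : ℕ × (ℕ → ℝ) => afterWarmup A σ T t p.1 p.2 :=
    measurable_from_prod_countable_right hbody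
  have hmain : Measurable fun y => afterWarmup A σ T t (sInf (exitBatches A σ α T t y)) y :=
    hpair.comp (hinf.prodMk measurable_id)
  unfold e2tcAction
  exact Measurable.ite (p := fun y => (exitBatches A σ α T t y).Nonempty) hne hmain measurable_const

lemma measurable_padHistory (t : ℕ) : Measurable (padHistory : (Fin t → ℝ) → ℕ → ℝ) := by
  refine measurable_pi_iff.2 fun s => ?_
  unfold padHistory
  by_cases hs : s < t
  · simpa [hs] using measurable_pi_apply (⟨s, hs⟩ : Fin t)
  · simp [hs]

/-- The algorithm E2TC for the ellipsoid of `A`, with noise level `σ`, parameter `α` and horizon `T`.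
It does not use its seed. -/
def e2tc [NeZero d] {A : Matrix (Fin d) (Fin d) ℝ} (hA : A.PosDef) (σ α : ℝ) (T : ℕ) :
    Algorithm (ellipsoid A) where
  Seed := Unit
  mSeed := inferInstance
  law := Measure.dirac ()
  isProb := inferInstance
  act t _ h := e2tcAction A σ α T t (padHistory h)
  measurable_act t :=
    (measurable_e2tcAction A σ α T t).comp ((measurable_padHistory t).comp measurable_snd)
  act_mem t _ _ := e2tcAction_mem hA σ α T t _

end EllipsoidBandit

end

/-! Multiplication by A^{1/2} turns the ellipsoid into the unit ball. The least-squares estimate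
from m round-robin cycles then becomes φ + w, where φ = A^{1/2}θ and w is the coordinatewise mean of
the noise (`sqrt_mulVec_exploreEstimate`). Write b = |φ| = ‖θ‖_A. The coordinates of w are
independent and σ²/m-subgaussian, so exp of a small multiple of |w|² has a controlled mean; this
gives all the moment and tail bounds. E2TC looks only at rewards of exploration rounds, so it may be
run on the rewards of a learner who always explores (`action_e2tc`), and its trajectory becomes an
explicit function of the noise.

Upper bound. If b ≤ σd/√T, the trivial bound 2Tb is enough. Otherwise each phase costs O(σd√T + db).
The warm-up goes on past a batch only if b is below 6 times its threshold U, which the size of U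
rules out for batches longer than about σd√T/b, or if the noise exceeds b/2, which a fourth moment
makes rare. The second phase costs about db + bσd√T/B̂; this is harmless if B̂ ≥ b/2, and otherwise
the noise is again large. Committing costs 2|w|²/b per round, by the curvature of the ball. The
noise w of the second phase is independent of its length, so the total is about Tσ²d/(mb) with m ≥
σ√T/B̂, and it remains to see that B̂ is O(b) in expectation. This last point is where the
confidence levels δ_i enter.

Lower bound. Around θ ≠ 0, take a hypercube of vertices θ + Δ∑±v_j, the whitened v_j being an
orthonormal basis of the complement of φ, with Δ² of order σb/√T. At each vertex the regret
dominates b/2 times the squared distance to the optimal action, direction by direction. Along an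
edge, a learner either moves far along v_j and pays for it, or gathers too little information to
find the sign of the shift (`le_integral_add_integral_of_sub_eq_smul`). Averaging over the cube
gives regret at least σd√T/256 at some vertex, and Δ → 0 as T → ∞. At the finitely many T too small
for this, θ'_T may be taken far from θ: the first action is blind, so the regret is unbounded in θ'.
-/

noncomputable section

namespace EllipsoidBandit

/-! ### Functions of disjoint sets of coordinates -/

section Independence

variable {ν : ℕ → Measure ℝ} [∀ t, IsProbabilityMeasure (ν t)]

/-- Extension by zero of a family indexed by a finite set of coordinates. -/
def extendZero (S : Finset ℕ) (v : S → ℝ) (i : ℕ) : ℝ := if h : i ∈ S then v ⟨i, h⟩ else 0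

lemma measurable_extendZero (S : Finset ℕ) : Measurable (extendZero S) := by
  refine measurable_pi_iff.2 fun i => ?_
  unfold extendZero
  by_cases h : i ∈ S
  · simpa [h] using measurable_pi_apply (⟨i, h⟩ : S)
  · simp [h]

lemma dependsOn_comp_extendZero {β : Type*} {S : Finset ℕ} {f : (ℕ → ℝ) → β}
    (hf : DependsOn f (S : Set ℕ)) :
    f = (fun v => f (extendZero S v)) ∘ fun (z : ℕ → ℝ) (i : S) => z i := by
  funext z
  refine hf fun i hi => ?_
  have : i ∈ S := hi
  simp [extendZero, this]

/-- Both functions factor measurably through the restriction to their own finite set of coordinates,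
extended by zero, and the coordinates of a product measure are independent. -/
lemma indepFun_of_dependsOn {β γ : Type*} [MeasurableSpace β] [MeasurableSpace γ]
    {S R : Finset ℕ} (hSR : Disjoint S R) {f : (ℕ → ℝ) → β} {g : (ℕ → ℝ) → γ}
    (hf : DependsOn f (S : Set ℕ)) (hg : DependsOn g (R : Set ℕ))
    (hfm : Measurable f) (hgm : Measurable g) :
    IndepFun f g (Measure.infinitePi ν) := by
  have h0 : iIndepFun (fun (i : ℕ) (z : ℕ → ℝ) => z i) (Measure.infinitePi ν) :=
    iIndepFun_infinitePi (X := fun _ x => x) (fun _ => measurable_id)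
  have h := h0.indepFun_finset S R hSR (fun i => measurable_pi_apply i)
  rw [dependsOn_comp_extendZero hf, dependsOn_comp_extendZero hg]
  exact h.comp (hfm.comp (measurable_extendZero S)) (hgm.comp (measurable_extendZero R))

lemma lintegral_prod_of_dependsOn {ι : Type*} (s : Finset ι) (F : ι → (ℕ → ℝ) → ENNReal)
    (S : ι → Finset ℕ) (hS : Pairwise fun i j => Disjoint (S i) (S j))
    (hF : ∀ i, DependsOn (F i) (S i : Set ℕ)) (hm : ∀ i, Measurable (F i)) :
    ∫⁻ z, ∏ i ∈ s, F i z ∂(Measure.infinitePi ν) = ∏ i ∈ s, ∫⁻ z, F i z ∂(Measure.infinitePi ν) := by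
  classical
  induction s using Finset.induction_on with
  | empty => simp
  | insert i s hi ih =>
    simp only [Finset.prod_insert hi]
    rw [← ih]
    have hdis : Disjoint (S i) (s.biUnion S) := by
      rw [Finset.disjoint_biUnion_right]
      intro j hj
      exact hS fun h => hi (h ▸ hj)
    have hdep : DependsOn (fun z => ∏ j ∈ s, F j z) (s.biUnion S : Set ℕ) := by
      intro x y hxy
      refine Finset.prod_congr rfl fun j hj => hF j fun k hk => hxy k ?_
      simp only [Set.mem_iUnion, Finset.coe_biUnion]
      exact ⟨j, hj, hk⟩
    have hmp : Measurable (fun z => ∏ j ∈ s, F j z) := Finset.measurable_fun_prod s fun j _ => hm j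
    have := indepFun_of_dependsOn (ν := ν) hdis (hF i) (by simpa using hdep) (hm i) hmp
    exact lintegral_mul_eq_lintegral_mul_lintegral_of_indepFun (hm i) hmp this

end Independence

/-! ### Exponential moments of squares of subgaussian variables -/

section Moments

open Real

lemma lintegral_exp_mul_gaussianReal (a : ℝ) :
    ∫⁻ g, ENNReal.ofReal (exp (a * g)) ∂(gaussianReal 0 1) = ENNReal.ofReal (exp (a ^ 2 / 2)) := by
  rw [← ofReal_integral_eq_lintegral_ofReal (integrable_exp_mul_gaussianReal a)
    (ae_of_all _ fun _ => (exp_pos _).le)]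
  have := congrFun (mgf_fun_id_gaussianReal (μ := 0) (v := 1)) a
  simp only [mgf] at this
  rw [this]
  simp

lemma lintegral_exp_sq_gaussianReal {a : ℝ} (ha : 2 * a < 1) :
    ∫⁻ g, ENNReal.ofReal (exp (a * g ^ 2)) ∂(gaussianReal 0 1)
      = ENNReal.ofReal ((√(1 - 2 * a))⁻¹) := by
  rw [gaussianReal_of_var_ne_zero 0 one_ne_zero,
    lintegral_withDensity_eq_lintegral_mul _ (measurable_gaussianPDF 0 1) (by fun_prop)]
  have h1 : ∀ g : ℝ, (gaussianPDF 0 1 * fun g => ENNReal.ofReal (exp (a * g ^ 2))) g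
      = ENNReal.ofReal ((√(2 * π))⁻¹ * exp (-(1 / 2 - a) * g ^ 2)) := by
    intro g
    rw [Pi.mul_apply, gaussianPDF, ← ENNReal.ofReal_mul (gaussianPDFReal_nonneg _ _ _),
      gaussianPDFReal, mul_assoc, ← exp_add]
    congr 2
    · simp
    · congr 1
      simp
      ring
  simp only [h1]
  have hb : 0 < 1 / 2 - a := by linarith
  rw [← ofReal_integral_eq_lintegral_ofReal ((integrable_exp_neg_mul_sq hb).const_mul _)
    (ae_of_all _ fun _ => by positivity), integral_const_mul, integral_gaussian]
  congr 1
  rw [← sqrt_inv, ← sqrt_mul (by positivity), ← sqrt_inv]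
  congr 1
  have h2 : 1 - 2 * a ≠ 0 := by linarith
  have h3 : 1 / 2 - a ≠ 0 := hb.ne'
  field_simp

/-- Linearization of the square: exp(κX²) is the mean of exp(√(2κ) X g) over a standard Gaussian g.
After Tonelli the subgaussian bound applies for each fixed g, and an explicit Gaussian integral of
exp(κc g²) is left. -/
lemma lintegral_exp_sq_le_of_hasSubgaussianMGF {Ω : Type*} [MeasurableSpace Ω] {μ : Measure Ω}
    [SFinite μ] {X : Ω → ℝ} {c : ℝ≥0} (hX : HasSubgaussianMGF X c μ) (hXm : Measurable X)
    {κ : ℝ} (hκ : 0 ≤ κ) (hc : 2 * (κ * c) < 1) :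
    ∫⁻ ω, ENNReal.ofReal (exp (κ * X ω ^ 2)) ∂μ ≤ ENNReal.ofReal ((√(1 - 2 * (κ * c)))⁻¹) := by
  have h1 : ∀ ω, ENNReal.ofReal (exp (κ * X ω ^ 2))
      = ∫⁻ g, ENNReal.ofReal (exp (√(2 * κ) * X ω * g)) ∂(gaussianReal 0 1) := by
    intro ω
    rw [lintegral_exp_mul_gaussianReal]
    congr 2
    rw [mul_pow, sq_sqrt (by positivity)]
    ring
  simp only [h1]
  rw [lintegral_lintegral_swap (by
    refine Measurable.aemeasurable ?_
    unfold Function.uncurry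
    fun_prop), ← lintegral_exp_sq_gaussianReal hc]
  refine lintegral_mono fun g => ?_
  have h2 : ∀ ω, √(2 * κ) * X ω * g = (√(2 * κ) * g) * X ω := fun ω => by ring
  simp only [h2]
  rw [← ofReal_integral_eq_lintegral_ofReal (hX.integrable_exp_mul _)
    (ae_of_all _ fun _ => (exp_pos _).le)]
  refine ENNReal.ofReal_le_ofReal ((hX.mgf_le _).trans_eq ?_)
  congr 1
  rw [mul_pow, sq_sqrt (by positivity)]
  ring

end Moments

/-! ### Coordinatewise means over blocks of rounds -/

section BlockMean

open Real

/-- The Euclidean norm on `Fin d → ℝ`. -/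
def euclNorm {d : ℕ} (v : Fin d → ℝ) : ℝ := √(v ⬝ᵥ v)

lemma dotProduct_self_nonneg' {d : ℕ} (v : Fin d → ℝ) : 0 ≤ v ⬝ᵥ v :=
  Finset.sum_nonneg fun i _ => mul_self_nonneg (v i)

lemma euclNorm_nonneg {d : ℕ} (v : Fin d → ℝ) : 0 ≤ euclNorm v := sqrt_nonneg _

lemma euclNorm_sq {d : ℕ} (v : Fin d → ℝ) : euclNorm v ^ 2 = v ⬝ᵥ v :=
  sq_sqrt (dotProduct_self_nonneg' v)

lemma measurable_euclNorm {d : ℕ} : Measurable (euclNorm : (Fin d → ℝ) → ℝ) := by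
  unfold euclNorm
  simp only [dotProduct]
  fun_prop

/-- Coordinate `j` of `blockMean d q m z` is the mean of the `m` values `z (d (q + l) + j)`,
`l < m`. -/
def blockMean (d q m : ℕ) (z : ℕ → ℝ) : Fin d → ℝ :=
  fun j => (∑ l ∈ Finset.range m, z (d * (q + l) + j)) / m

lemma measurable_blockMean (d q m : ℕ) : Measurable (blockMean d q m) := by
  refine measurable_pi_iff.2 fun j => ?_
  unfold blockMean
  fun_prop

lemma blockMean_add (d q m : ℕ) (y z : ℕ → ℝ) :
    blockMean d q m (fun t => y t + z t) = blockMean d q m y + blockMean d q m z := by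
  funext j
  simp [blockMean, Finset.sum_add_distrib, add_div]

/-- The rounds that enter coordinate `j` of `blockMean d q m`. -/
def blockRounds (d q m j : ℕ) : Finset ℕ := (Finset.range m).image fun l => d * (q + l) + j

lemma dependsOn_blockMean_apply (d q m : ℕ) (j : Fin d) :
    DependsOn (fun z => blockMean d q m z j) (blockRounds d q m j : Set ℕ) := by
  intro x y hxy
  simp only [blockMean]
  congr 1
  refine Finset.sum_congr rfl fun l hl => hxy _ ?_
  simp only [blockRounds, Finset.coe_image, Set.mem_image]
  exact ⟨l, by simpa using hl, rfl⟩

lemma disjoint_blockRounds {d q m : ℕ} {i j : Fin d} (hij : i ≠ j) :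
    Disjoint (blockRounds d q m i) (blockRounds d q m j) := by
  rw [Finset.disjoint_left]
  intro t hi hj
  simp only [blockRounds, Finset.mem_image] at hi hj
  obtain ⟨a, -, ha⟩ := hi
  obtain ⟨b, -, hb⟩ := hj
  have h1 : t % d = i := by rw [← ha, Nat.mul_add_mod, Nat.mod_eq_of_lt i.2]
  have h2 : t % d = j := by rw [← hb, Nat.mul_add_mod, Nat.mod_eq_of_lt j.2]
  exact hij (Fin.ext (h1.symm.trans h2))

lemma blockMean_congr {d q m : ℕ} {y z : ℕ → ℝ}
    (h : ∀ t, d * q ≤ t → t < d * (q + m) → y t = z t) : blockMean d q m y = blockMean d q m z := by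
  funext j
  refine congrArg (· / (m : ℝ)) (Finset.sum_congr rfl fun l hl => h _ ?_ ?_)
  · nlinarith
  · have hl : l + 1 ≤ m := Finset.mem_range.1 hl
    have := j.2
    nlinarith [Nat.mul_le_mul_left d hl]

variable {ν : ℕ → Measure ℝ} [∀ t, IsProbabilityMeasure (ν t)] {σ : ℝ≥0}

lemma IsSubgaussianNoise.hasSubgaussianMGF_eval (hν : IsSubgaussianNoise σ ν) (t : ℕ) :
    HasSubgaussianMGF (fun z : ℕ → ℝ => z t) (σ ^ 2) (Measure.infinitePi ν) := by
  have h := (hν t).2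
  rw [← Measure.infinitePi_map_eval ν t] at h
  exact HasSubgaussianMGF.of_map (Y := fun z : ℕ → ℝ => z t) (X := fun x : ℝ => x)
    (measurable_pi_apply t).aemeasurable h

lemma hasSubgaussianMGF_blockMean_apply (hν : IsSubgaussianNoise σ ν) {d : ℕ} (q : ℕ) {m : ℕ}
    (hm : 0 < m) (j : Fin d) :
    HasSubgaussianMGF (fun z => blockMean d q m z j) (σ ^ 2 / m) (Measure.infinitePi ν) := by
  have h0 : iIndepFun (fun (i : ℕ) (z : ℕ → ℝ) => z i) (Measure.infinitePi ν) :=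
    iIndepFun_infinitePi (X := fun _ x => x) (fun _ => measurable_id)
  have hinj : Function.Injective fun l : ℕ => d * (q + l) + (j : ℕ) := by
    intro a b hab
    have hd : 0 < d := j.pos
    have : d * (q + a) = d * (q + b) := by simpa using hab
    have := Nat.eq_of_mul_eq_mul_left hd this
    omega
  have h1 := HasSubgaussianMGF.sum_of_iIndepFun (h0.precomp hinj) (c := fun _ => σ ^ 2)
    (s := Finset.range m) (fun l _ => hν.hasSubgaussianMGF_eval _)
  have h2 := h1.const_mul ((m : ℝ)⁻¹)
  have hc : (NNReal.mk (((m : ℝ)⁻¹) ^ 2) (sq_nonneg _)) * ∑ _l ∈ Finset.range m, σ ^ 2 = σ ^ 2 / m := by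
    ext
    have : (m : ℝ) ≠ 0 := by positivity
    simp only [Finset.sum_const, Finset.card_range, nsmul_eq_mul, NNReal.coe_mul, NNReal.coe_mk,
      NNReal.coe_natCast, NNReal.coe_pow, NNReal.coe_div]
    field_simp
  have h3 : HasSubgaussianMGF _ (NNReal.mk (((m : ℝ)⁻¹) ^ 2) (sq_nonneg _) *
    ∑ _l ∈ Finset.range m, σ ^ 2) _ := h2
  rw [hc] at h3
  refine h3.congr (ae_of_all _ fun z => ?_)
  simp only [blockMean]
  rw [div_eq_inv_mul]

/-- The squared norm is a sum over coordinates that depend on disjoint sets of rounds (residue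
classes mod d), so its exponential moment is a product of d one-dimensional ones. -/
lemma lintegral_exp_blockMean_le (hν : IsSubgaussianNoise σ ν) {d : ℕ} (q : ℕ) {m : ℕ}
    (hm : 0 < m) {κ : ℝ} (hκ : 0 ≤ κ) (hc : 2 * (κ * (σ ^ 2 / m)) < 1) :
    ∫⁻ z, ENNReal.ofReal (exp (κ * euclNorm (blockMean d q m z) ^ 2)) ∂(Measure.infinitePi ν)
      ≤ ENNReal.ofReal ((√(1 - 2 * (κ * (σ ^ 2 / m))))⁻¹ ^ d) := by
  have h1 : ∀ z, ENNReal.ofReal (exp (κ * euclNorm (blockMean d q m z) ^ 2))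
      = ∏ j : Fin d, ENNReal.ofReal (exp (κ * blockMean d q m z j ^ 2)) := by
    intro z
    rw [← ENNReal.ofReal_prod_of_nonneg fun _ _ => (exp_pos _).le, ← exp_sum, euclNorm_sq,
      dotProduct, Finset.mul_sum]
    congr 2
    exact Finset.sum_congr rfl fun j _ => by ring
  simp only [h1]
  have hmj : ∀ j : Fin d, Measurable fun z => blockMean d q m z j := fun j =>
    (measurable_pi_apply j).comp (measurable_blockMean d q m)
  rw [lintegral_prod_of_dependsOn Finset.univ
    (fun j z => ENNReal.ofReal (exp (κ * blockMean d q m z j ^ 2)))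
    (fun j => blockRounds d q m j) (fun i j hij => disjoint_blockRounds hij)
    (fun j x y hxy => by
      have := dependsOn_blockMean_apply d q m j hxy
      simp only at this
      simp only [this])
    (fun j => by have := hmj j; fun_prop)]
  rw [ENNReal.ofReal_pow (by positivity)]
  have hcard := Finset.prod_le_pow_card (Finset.univ : Finset (Fin d))
    (fun j => ∫⁻ z, ENNReal.ofReal (exp (κ * blockMean d q m z j ^ 2)) ∂(Measure.infinitePi ν))
    (ENNReal.ofReal (√(1 - 2 * (κ * (σ ^ 2 / m))))⁻¹) fun j _ => ?_
  · simpa using hcard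
  have := lintegral_exp_sq_le_of_hasSubgaussianMGF (hasSubgaussianMGF_blockMean_apply hν q hm j)
    (hmj j) hκ (by simpa using hc)
  simpa using this

/-- A nonnegative function dominated by a multiple of a function with controlled `lintegral` is
integrable, with controlled integral. -/
lemma integrable_and_integral_le_of_lintegral_le {Ω : Type*} [MeasurableSpace Ω] {μ : Measure Ω}
    {f g : Ω → ℝ} (hf : Measurable f) (hf0 : ∀ ω, 0 ≤ f ω) {c K : ℝ} (hc : 0 ≤ c) (hK : 0 ≤ K)
    (hfg : ∀ ω, f ω ≤ c * g ω) (hg : ∫⁻ ω, ENNReal.ofReal (g ω) ∂μ ≤ ENNReal.ofReal K) :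
    Integrable f μ ∧ ∫ ω, f ω ∂μ ≤ c * K := by
  have h1 : ∫⁻ ω, ENNReal.ofReal (f ω) ∂μ ≤ ENNReal.ofReal (c * K) := by
    calc ∫⁻ ω, ENNReal.ofReal (f ω) ∂μ
        ≤ ∫⁻ ω, ENNReal.ofReal c * ENNReal.ofReal (g ω) ∂μ := by
          refine lintegral_mono fun ω => ?_
          rw [← ENNReal.ofReal_mul hc]
          exact ENNReal.ofReal_le_ofReal (hfg ω)
      _ = ENNReal.ofReal c * ∫⁻ ω, ENNReal.ofReal (g ω) ∂μ :=
          lintegral_const_mul' _ _ ENNReal.ofReal_ne_top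
      _ ≤ ENNReal.ofReal c * ENNReal.ofReal K := by gcongr
      _ = _ := (ENNReal.ofReal_mul hc).symm
  refine ⟨⟨hf.aestronglyMeasurable, ?_⟩, ?_⟩
  · rw [hasFiniteIntegral_iff_ofReal (ae_of_all _ hf0)]
    exact h1.trans_lt ENNReal.ofReal_lt_top
  · rw [integral_eq_lintegral_of_nonneg_ae (ae_of_all _ hf0) hf.aestronglyMeasurable]
    exact ENNReal.toReal_le_of_le_ofReal (by positivity) h1

/-- Bernoulli: (1 - 1/(2d))^d ≥ 1/2. -/
lemma inv_sqrt_pow_le_two {d : ℕ} (hd : 0 < d) :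
    (√(1 - 2 * (1 / (4 * (d : ℝ)))))⁻¹ ^ d ≤ 2 := by
  have hd' : (1 : ℝ) ≤ d := by exact_mod_cast hd
  have hx : 1 / (2 * (d : ℝ)) ≤ 1 / 2 := by
    rw [div_le_div_iff₀ (by positivity) (by positivity)]
    linarith
  have h1 : 1 - 2 * (1 / (4 * (d : ℝ))) = 1 + -(1 / (2 * d)) := by
    field_simp
    ring
  have hB := one_add_mul_le_pow (a := -(1 / (2 * (d : ℝ)))) (by linarith) d
  have h2 : 1 + (d : ℝ) * -(1 / (2 * d)) = 1 / 2 := by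
    field_simp
    norm_num
  rw [h2] at hB
  rw [h1, inv_pow, inv_le_comm₀ (pow_pos (sqrt_pos.2 (by linarith)) d) (by norm_num)]
  set s := √(1 + -(1 / (2 * (d : ℝ)))) ^ d with hs
  have hs2 : s ^ 2 = (1 + -(1 / (2 * (d : ℝ)))) ^ d := by
    rw [hs, ← pow_mul, mul_comm d 2, pow_mul, sq_sqrt (by linarith)]
  have hs0 : 0 ≤ s := by positivity
  nlinarith

/-- The exponent is normalized by the total variance proxy σ²d/m of the d coordinates, so that the
bound does not grow with d. Polynomial moments follow by comparison with exp. -/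
lemma lintegral_exp_blockMean_le_two (hσ : 0 < σ) (hν : IsSubgaussianNoise σ ν) {d : ℕ}
    (hd : 0 < d) (q : ℕ) {m : ℕ} (hm : 0 < m) :
    ∫⁻ z, ENNReal.ofReal (exp (euclNorm (blockMean d q m z) ^ 2 / (4 * (σ ^ 2 * d / m))))
      ∂(Measure.infinitePi ν) ≤ ENNReal.ofReal 2 := by
  have hσ' : (0 : ℝ) < σ := hσ
  have hd' : (1 : ℝ) ≤ d := by exact_mod_cast hd
  have hm' : (0 : ℝ) < m := by exact_mod_cast hm
  have h4 : (m / (4 * σ ^ 2 * d) : ℝ) * (σ ^ 2 / m) = 1 / (4 * d) := by field_simp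
  have h := lintegral_exp_blockMean_le hν (d := d) q hm (κ := m / (4 * σ ^ 2 * d)) (by positivity)
    (by
      rw [h4]
      have : 1 / (4 * (d : ℝ)) ≤ 1 / 4 := by
        rw [div_le_div_iff₀ (by positivity) (by positivity)]
        linarith
      linarith)
  rw [h4] at h
  refine le_trans (le_of_eq ?_) (h.trans (ENNReal.ofReal_le_ofReal (inv_sqrt_pow_le_two hd)))
  refine lintegral_congr fun z => ?_
  congr 2
  field_simp

lemma blockMean_second_moment (hσ : 0 < σ) (hν : IsSubgaussianNoise σ ν) {d : ℕ}
    (hd : 0 < d) (q : ℕ) {m : ℕ} (hm : 0 < m) :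
    Integrable (fun z => euclNorm (blockMean d q m z) ^ 2) (Measure.infinitePi ν) ∧
      ∫ z, euclNorm (blockMean d q m z) ^ 2 ∂(Measure.infinitePi ν) ≤ 8 * (σ ^ 2 * d / m) := by
  have hv : (0 : ℝ) < σ ^ 2 * d / m := by positivity
  set v : ℝ := σ ^ 2 * d / m with hv'
  have := integrable_and_integral_le_of_lintegral_le
    ((measurable_euclNorm.comp (measurable_blockMean d q m)).pow_const 2)
    (fun z => sq_nonneg _) (by positivity : 0 ≤ 4 * v) (by norm_num : (0 : ℝ) ≤ 2) (fun z => ?_)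
    (lintegral_exp_blockMean_le_two hσ hν hd q hm)
  · refine ⟨this.1, this.2.trans_eq (by ring)⟩
  · simp only [Function.comp_apply]
    rw [← div_le_iff₀' (by positivity)]
    exact le_trans (by linarith) (add_one_le_exp _)

lemma blockMean_fourth_moment (hσ : 0 < σ) (hν : IsSubgaussianNoise σ ν) {d : ℕ}
    (hd : 0 < d) (q : ℕ) {m : ℕ} (hm : 0 < m) :
    Integrable (fun z => euclNorm (blockMean d q m z) ^ 4) (Measure.infinitePi ν) ∧
      ∫ z, euclNorm (blockMean d q m z) ^ 4 ∂(Measure.infinitePi ν)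
        ≤ 64 * (σ ^ 2 * d / m) ^ 2 := by
  have hv : (0 : ℝ) < σ ^ 2 * d / m := by positivity
  set v : ℝ := σ ^ 2 * d / m with hv'
  have := integrable_and_integral_le_of_lintegral_le
    ((measurable_euclNorm.comp (measurable_blockMean d q m)).pow_const 4)
    (fun z => by simp only [Function.comp_apply]; positivity)
    (by positivity : 0 ≤ 32 * v ^ 2) (by norm_num : (0 : ℝ) ≤ 2) (fun z => ?_)
    (lintegral_exp_blockMean_le_two hσ hν hd q hm)
  · refine ⟨this.1, this.2.trans_eq (by ring)⟩
  · simp only [Function.comp_apply]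
    set r := euclNorm (blockMean d q m z)
    have h := quadratic_le_exp_of_nonneg (x := r ^ 2 / (4 * v)) (by positivity)
    have h0 : 0 ≤ r ^ 2 / (4 * v) := by positivity
    have h1 : r ^ 4 = 32 * v ^ 2 * ((r ^ 2 / (4 * v)) ^ 2 / 2) := by
      field_simp
      ring
    rw [h1]
    gcongr
    linarith

/-- Chernoff bound with a larger exponent, m/(4σ²) instead of m/(4σ²d): the moment now grows like
exp(d/2), and the term d in the lower bound for u² absorbs it. What remains is the factor exp(-t)
with no power of d in front. -/
lemma blockMean_tail_moment (hσ : 0 < σ) (hν : IsSubgaussianNoise σ ν) {d : ℕ}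
    (q : ℕ) {m : ℕ} (hm : 0 < m) {u t : ℝ}
    (hu : (σ ^ 2 / m) * (d + 2 * t) ≤ u ^ 2) (hu0 : 0 ≤ u) :
    Integrable (fun z => if 2 * u ≤ euclNorm (blockMean d q m z)
      then euclNorm (blockMean d q m z) else 0) (Measure.infinitePi ν) ∧
    ∫ z, (if 2 * u ≤ euclNorm (blockMean d q m z) then euclNorm (blockMean d q m z) else 0)
      ∂(Measure.infinitePi ν) ≤ 2 * (σ / √m) * exp (-t) := by
  have hσ' : (0 : ℝ) < σ := hσ
  have hm' : (0 : ℝ) < m := by exact_mod_cast hm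
  have h4 : (m / (4 * σ ^ 2) : ℝ) * (σ ^ 2 / m) = 1 / 4 := by field_simp
  have h := lintegral_exp_blockMean_le hν (d := d) q hm (κ := m / (4 * σ ^ 2)) (by positivity)
    (by rw [h4]; norm_num)
  rw [h4] at h
  have hK : (√(1 - 2 * (1 / 4) : ℝ))⁻¹ ^ d ≤ exp (d / 2) := by
    have h1 : (√(1 - 2 * (1 / 4) : ℝ))⁻¹ ≤ exp (1 / 2) := by
      rw [inv_le_comm₀ (sqrt_pos.2 (by norm_num)) (exp_pos _), ← exp_neg]
      refine le_sqrt_of_sq_le ?_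
      rw [← exp_nat_mul]
      have : ((2 : ℕ) : ℝ) * -(1 / 2) = -1 := by norm_num
      rw [this, exp_neg]
      have := add_one_le_exp (1 : ℝ)
      rw [inv_le_comm₀ (exp_pos _) (by norm_num)]
      norm_num at this ⊢
      linarith
    refine (pow_le_pow_left₀ (by positivity) h1 d).trans_eq ?_
    rw [← exp_nat_mul]
    congr 1
    ring
  have hs : 0 < (σ : ℝ) / √m := by positivity
  have hs2 : ((σ : ℝ) / √m) ^ 2 = σ ^ 2 / m := by rw [div_pow, sq_sqrt hm'.le]
  have hr : Measurable fun z => euclNorm (blockMean d q m z) :=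
    measurable_euclNorm.comp (measurable_blockMean d q m)
  have hmeas : Measurable (fun z => if 2 * u ≤ euclNorm (blockMean d q m z)
      then euclNorm (blockMean d q m z) else 0) :=
    Measurable.ite (measurableSet_le measurable_const hr) hr measurable_const
  have := integrable_and_integral_le_of_lintegral_le hmeas
    (fun z => by split_ifs; exacts [euclNorm_nonneg _, le_rfl])
    (by positivity : 0 ≤ 2 * ((σ : ℝ) / √m) * exp (-(d / 2) - t)) (exp_pos _).le (fun z => ?_)
    (h.trans (ENNReal.ofReal_le_ofReal hK))
  · refine ⟨this.1, this.2.trans_eq ?_⟩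
    rw [mul_assoc, ← exp_add]
    congr 2
    ring
  · set r := euclNorm (blockMean d q m z)
    have hr0 : 0 ≤ r := euclNorm_nonneg _
    split_ifs with hur
    -- On the event, (r/s)²/4 ≥ (u/s)² ≥ d + 2t. Half of the exponent (r/s)²/4 therefore pays for
    -- d/2 + t, and the other half dominates the factor r/s.
    · set s := (σ : ℝ) / √m with hsdef
      have e1 : (m / (4 * σ ^ 2) : ℝ) * r ^ 2 = (r / s) ^ 2 / 4 := by
        rw [div_pow, hs2]
        field_simp
      rw [e1, mul_assoc, ← exp_add]
      have h5 : (d + 2 * t) ≤ (u / s) ^ 2 := by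
        rw [div_pow, hs2, le_div_iff₀ (by positivity)]
        linarith
      have h6 : (u / s) ^ 2 ≤ (r / s) ^ 2 / 4 := by
        have : (2 * u / s) ^ 2 ≤ (r / s) ^ 2 := by gcongr
        have e : (2 * u / s) ^ 2 = 4 * (u / s) ^ 2 := by ring
        linarith
      have h7 : (r / s) ^ 2 / 8 ≤ -(d / 2 : ℝ) - t + (r / s) ^ 2 / 4 := by linarith
      have h8 : r / s ≤ 2 * exp ((r / s) ^ 2 / 8) := by
        have := add_one_le_exp ((r / s) ^ 2 / 8)
        nlinarith [sq_nonneg (r / s - 2)]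
      have h9 : exp ((r / s) ^ 2 / 8) ≤ exp (-(d / 2 : ℝ) - t + (r / s) ^ 2 / 4) :=
        exp_le_exp.2 h7
      calc r = s * (r / s) := by field_simp
        _ ≤ s * (2 * exp (-(d / 2 : ℝ) - t + (r / s) ^ 2 / 4)) := by
          gcongr
          linarith
        _ = _ := by ring
    · positivity

end BlockMean

/-! ### Reduction to the Euclidean ball -/

section Whitening

variable {d : ℕ} {A : Matrix (Fin d) (Fin d) ℝ}

lemma sqrt_mul_sqrt (hA : A.PosDef) : CFC.sqrt A * CFC.sqrt A = A :=
  CFC.sqrt_mul_sqrt_self A hA.posSemidef.nonneg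

lemma sqrt_transpose (A : Matrix (Fin d) (Fin d) ℝ) : (CFC.sqrt A)ᵀ = CFC.sqrt A := by
  simpa using (Matrix.nonneg_iff_posSemidef.1 (CFC.sqrt_nonneg A)).isHermitian.eq

lemma isUnit_det_sqrt (hA : A.PosDef) : IsUnit (CFC.sqrt A).det := by
  have h : IsUnit A.det := (Matrix.isUnit_iff_isUnit_det A).1 hA.isUnit
  rw [← sqrt_mul_sqrt hA, Matrix.det_mul] at h
  exact isUnit_of_mul_isUnit_left h

lemma sqrt_mulVec_dotProduct (A : Matrix (Fin d) (Fin d) ℝ) (u v : Fin d → ℝ) :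
    (CFC.sqrt A *ᵥ u) ⬝ᵥ v = u ⬝ᵥ (CFC.sqrt A *ᵥ v) := by
  rw [Matrix.dotProduct_mulVec, ← Matrix.mulVec_transpose, sqrt_transpose]

lemma sqrt_mulVec_inv_mulVec (hA : A.PosDef) (x : Fin d → ℝ) :
    CFC.sqrt A *ᵥ ((CFC.sqrt A)⁻¹ *ᵥ x) = x := by
  rw [Matrix.mulVec_mulVec, Matrix.mul_nonsing_inv _ (isUnit_det_sqrt hA), Matrix.one_mulVec]

/-- With `matNorm_inv_sqrt_mulVec`, this reduces the problem to the Euclidean unit ball with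
parameter A^{1/2}θ. -/
lemma matNorm_eq_euclNorm (hA : A.PosDef) (θ : Fin d → ℝ) :
    matNorm A θ = euclNorm (CFC.sqrt A *ᵥ θ) := by
  rw [matNorm, euclNorm, sqrt_mulVec_dotProduct, Matrix.mulVec_mulVec, sqrt_mul_sqrt hA]

lemma matNorm_nonneg (A : Matrix (Fin d) (Fin d) ℝ) (θ : Fin d → ℝ) : 0 ≤ matNorm A θ :=
  Real.sqrt_nonneg _

lemma matNorm_inv_sqrt_mulVec (hA : A.PosDef) (u : Fin d → ℝ) :
    matNorm A⁻¹ (CFC.sqrt A *ᵥ u) = euclNorm u := by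
  have hdet := isUnit_det_sqrt hA
  rw [matNorm, euclNorm]
  congr 1
  conv_lhs => rw [← sqrt_mul_sqrt hA]
  rw [Matrix.mul_inv_rev]
  have h := sqrt_mul_sqrt hA
  rw [h, sqrt_mulVec_dotProduct, Matrix.mulVec_mulVec, Matrix.mulVec_mulVec, ← Matrix.mul_assoc,
    Matrix.mul_nonsing_inv _ hdet, Matrix.one_mul, Matrix.nonsing_inv_mul _ hdet, Matrix.one_mulVec]

lemma euclNorm_inv_mulVec_le (hA : A.PosDef) {x : Fin d → ℝ} (hx : x ∈ ellipsoid A) :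
    euclNorm ((CFC.sqrt A)⁻¹ *ᵥ x) ≤ 1 := by
  rw [← matNorm_inv_sqrt_mulVec hA, sqrt_mulVec_inv_mulVec hA]
  exact hx

lemma optimalAction_dotProduct_self (hA : A.PosDef) (θ : Fin d → ℝ) :
    optimalAction A θ ⬝ᵥ θ = matNorm A θ := by
  rw [optimalAction, smul_dotProduct, dotProduct_comm, ← matNorm_sq hA, smul_eq_mul]
  rcases eq_or_ne (matNorm A θ) 0 with h | h
  · simp [h]
  · field_simp

lemma dotProduct_le_matNorm (hA : A.PosDef) {x : Fin d → ℝ} (hx : x ∈ ellipsoid A)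
    (θ : Fin d → ℝ) : x ⬝ᵥ θ ≤ matNorm A θ := by
  rw [← optimalAction_dotProduct_self hA θ]
  exact isMaxOn_optimalAction hA θ hx

lemma neg_matNorm_le_dotProduct (hA : A.PosDef) {x : Fin d → ℝ} (hx : x ∈ ellipsoid A)
    (θ : Fin d → ℝ) : -matNorm A θ ≤ x ⬝ᵥ θ := by
  have hx' : -x ∈ ellipsoid A := by
    have hx : matNorm A⁻¹ x ≤ 1 := hx
    show matNorm A⁻¹ (-x) ≤ 1
    simpa [matNorm, Matrix.mulVec_neg] using hx
  have := dotProduct_le_matNorm hA hx' θ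
  rw [neg_dotProduct] at this
  linarith

lemma optimalAction_dotProduct (hA : A.PosDef) (η θ : Fin d → ℝ) :
    optimalAction A η ⬝ᵥ θ
      = (CFC.sqrt A *ᵥ η) ⬝ᵥ (CFC.sqrt A *ᵥ θ) / euclNorm (CFC.sqrt A *ᵥ η) := by
  rw [optimalAction, smul_dotProduct, matNorm_eq_euclNorm hA, ← sqrt_mulVec_dotProduct,
    Matrix.mulVec_mulVec, sqrt_mul_sqrt hA, smul_eq_mul, div_eq_inv_mul]

lemma dotProduct_sq_le {u v : Fin d → ℝ} : (u ⬝ᵥ v) ^ 2 ≤ (u ⬝ᵥ u) * (v ⬝ᵥ v) := by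
  simp only [dotProduct, ← pow_two]
  exact Finset.sum_mul_sq_le_sq_mul_sq _ _ _

/-- Playing the normalized estimate `u` instead of the normalized `v` costs at most
`2 |u - v|² / |v|`. -/
lemma euclNorm_sub_dotProduct_div_le {u v w : Fin d → ℝ} (hu : u = v + w) (hv : 0 < euclNorm v) :
    euclNorm v - u ⬝ᵥ v / euclNorm u ≤ 2 * euclNorm w ^ 2 / euclNorm v := by
  set b := euclNorm v with hb
  have hb2 : b ^ 2 = v ⬝ᵥ v := euclNorm_sq v
  have hw2 : euclNorm w ^ 2 = w ⬝ᵥ w := euclNorm_sq w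
  have hu2 : euclNorm u ^ 2 = u ⬝ᵥ u := euclNorm_sq u
  have huv : w = u - v := by rw [hu]; simp
  have hww : w ⬝ᵥ w = u ⬝ᵥ u - 2 * (u ⬝ᵥ v) + v ⬝ᵥ v := by
    rw [huv, sub_dotProduct, dotProduct_sub, dotProduct_sub, dotProduct_comm v u]
    ring
  set a := euclNorm u with ha
  have ha0 : 0 ≤ a := euclNorm_nonneg u
  set p := u ⬝ᵥ v with hp
  rw [le_div_iff₀ hv, hw2, hww, ← hu2, ← hb2]
  rcases ha0.eq_or_lt with h0 | hpos
  -- For a zero estimate, division by zero makes the normalized vector 0, so the left side is b, and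
  -- |w| = b.
  · have : p ^ 2 ≤ 0 := by
      have := dotProduct_sq_le (u := u) (v := v)
      rw [← hu2, ← h0] at this
      simpa using this
    have hp0 : p = 0 := by nlinarith
    rw [← h0, hp0]
    nlinarith
  · have hcs : p ≤ a * b := by
      have := dotProduct_sq_le (u := u) (v := v)
      rw [← hu2, ← hb2] at this
      have h := abs_le_of_sq_le_sq' (a := p) (b := a * b) (by nlinarith) (by positivity)
      exact h.2
    set c := p / a with hc
    have hpc : p = c * a := by rw [hc]; field_simp
    have hcb : c ≤ b := by rw [hc, div_le_iff₀ hpos]; linarith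
    rw [hpc]
    -- Here |w|² = (a - c)² + b² - c². For c ≥ 0 this is at least (b - c)(b + c) ≥ b(b - c); for c <
    -- 0 it is at least b², while b - c ≤ 2b.
    by_cases hc0 : 0 ≤ c
    · nlinarith [sq_nonneg (a - c), mul_nonneg (sub_nonneg.2 hcb) hc0,
        mul_nonneg (sub_nonneg.2 hcb) hv.le]
    · push Not at hc0
      have hc1 : -b ≤ c := by
        have := dotProduct_sq_le (u := u) (v := v)
        rw [← hu2, ← hb2] at this
        have h := abs_le_of_sq_le_sq' (a := p) (b := a * b) (by nlinarith) (by positivity)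
        rw [hc, le_div_iff₀ hpos]
        linarith [h.1]
      nlinarith [sq_nonneg a, mul_nonneg (neg_nonneg.2 hc0.le) ha0]

lemma matNorm_sub_optimalAction_dotProduct_le (hA : A.PosDef) {η θ w : Fin d → ℝ}
    (h : CFC.sqrt A *ᵥ η = CFC.sqrt A *ᵥ θ + w) (hθ : 0 < matNorm A θ) :
    matNorm A θ - optimalAction A η ⬝ᵥ θ ≤ 2 * euclNorm w ^ 2 / matNorm A θ := by
  rw [optimalAction_dotProduct hA, matNorm_eq_euclNorm hA] at *
  exact euclNorm_sub_dotProduct_div_le h hθ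

/-! ### Round-robin least squares is coordinatewise averaging. -/

section Explore

lemma sum_fin_mul (m : ℕ) (f : ℕ → ℝ) :
    ∑ k : Fin (d * m), f k = ∑ l ∈ Finset.range m, ∑ j : Fin d, f (d * l + j) := by
  rw [Fin.sum_univ_eq_sum_range]
  induction m with
  | zero => simp
  | succ m ih =>
    rw [Nat.mul_succ, Finset.sum_range_add, ih, Finset.sum_range_succ,
      Fin.sum_univ_eq_sum_range (fun j => f (d * m + j))]

variable [NeZero d]

lemma exploreAction_dotProduct (A : Matrix (Fin d) (Fin d) ℝ) (t : ℕ) (θ : Fin d → ℝ) :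
    exploreAction A t ⬝ᵥ θ = (CFC.sqrt A *ᵥ θ) (Fin.ofNat d t) := by
  rw [exploreAction, sqrt_mulVec_dotProduct, single_one_dotProduct]

lemma ofNat_mul_add (q : ℕ) (j : Fin d) : Fin.ofNat d (d * q + j) = j := by
  ext
  simp [Fin.ofNat, Nat.mod_eq_of_lt j.2]

lemma blockMean_explore (A : Matrix (Fin d) (Fin d) ℝ) (q : ℕ) {m : ℕ} (hm : 0 < m)
    (θ : Fin d → ℝ) :
    blockMean d q m (fun t => exploreAction A t ⬝ᵥ θ) = CFC.sqrt A *ᵥ θ := by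
  funext j
  have : (m : ℝ) ≠ 0 := by positivity
  simp only [blockMean, exploreAction_dotProduct, ofNat_mul_add]
  simp
  field_simp

/-- The round-robin design matrix in whitened coordinates. -/
def roundRobin (d : ℕ) [NeZero d] (s n : ℕ) : Matrix (Fin n) (Fin d) ℝ :=
  Matrix.of fun k : Fin n => Pi.single (Fin.ofNat d (s + k)) 1

lemma exploreMatrix_eq (A : Matrix (Fin d) (Fin d) ℝ) (s n : ℕ) :
    (Matrix.of fun k : Fin n => exploreAction A (s + k)) = roundRobin d s n * CFC.sqrt A := by
  ext k i
  simp only [Matrix.of_apply, exploreAction, Matrix.mul_apply, roundRobin, Matrix.mulVec]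
  conv_lhs => rw [← sqrt_transpose A]
  simp [Matrix.transpose_apply, Pi.single_apply]

lemma roundRobin_transpose_mulVec (q m : ℕ) (y : ℕ → ℝ) :
    (roundRobin d (d * q) (d * m))ᵀ *ᵥ (fun k : Fin (d * m) => y (d * q + k))
      = fun j : Fin d => ∑ l ∈ Finset.range m, y (d * (q + l) + j) := by
  funext j
  simp only [Matrix.mulVec, dotProduct, Matrix.transpose_apply, roundRobin, Matrix.of_apply]
  rw [sum_fin_mul m (fun k => (Pi.single (Fin.ofNat d (d * q + k)) (1 : ℝ) : Fin d → ℝ) j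
    * y (d * q + k))]
  refine Finset.sum_congr rfl fun l _ => ?_
  have h : ∀ i : Fin d, Fin.ofNat d (d * q + (d * l + i)) = i := fun i => by
    rw [← Nat.add_assoc, ← Nat.mul_add, ofNat_mul_add]
  simp only [h, Pi.single_apply]
  simp [mul_add, add_assoc]

lemma roundRobin_transpose_mul_self (q m : ℕ) :
    (roundRobin d (d * q) (d * m))ᵀ * roundRobin d (d * q) (d * m) = (m : ℝ) • 1 := by
  ext i j
  rw [Matrix.mul_apply']
  have h := congrFun (roundRobin_transpose_mulVec (d := d) q m
    (fun t => (Pi.single (Fin.ofNat d t) (1 : ℝ) : Fin d → ℝ) j)) i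
  simp only [Matrix.mulVec, ofNat_mul_add] at h
  refine Eq.trans ?_ (h.trans ?_)
  · rfl
  · simp [Pi.single_apply, Matrix.one_apply, eq_comm]

/-- The design matrix is P·A^{1/2} with PᵀP = m·1, because m full cycles visit every basis vector m
times. In (XᵀX)⁻¹Xᵀ the roots cancel, up to one A^{-1/2} that the left factor removes. -/
lemma sqrt_mulVec_exploreEstimate (hA : A.PosDef) (q : ℕ) {m : ℕ} (hm : 0 < m) (y : ℕ → ℝ) :
    CFC.sqrt A *ᵥ exploreEstimate A (d * q) (d * m) y = blockMean d q m y := by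
  have hdet := isUnit_det_sqrt hA
  have hm' : (m : ℝ) ≠ 0 := by positivity
  rw [exploreEstimate, leastSquares, exploreMatrix_eq, Matrix.transpose_mul, sqrt_transpose]
  set S := CFC.sqrt A
  set P := roundRobin d (d * q) (d * m) with hP
  have h1 : S * Pᵀ * (P * S) = (m : ℝ) • (S * S) := by
    rw [Matrix.mul_assoc, ← Matrix.mul_assoc Pᵀ, hP, roundRobin_transpose_mul_self]
    simp
  have h2 : ((m : ℝ) • (S * S))⁻¹ = (m : ℝ)⁻¹ • (S⁻¹ * S⁻¹) := by
    refine Matrix.inv_eq_left_inv ?_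
    rw [Matrix.smul_mul, Matrix.mul_smul, smul_smul, inv_mul_cancel₀ hm', one_smul,
      Matrix.mul_assoc, ← Matrix.mul_assoc S⁻¹ S S, Matrix.nonsing_inv_mul _ hdet, Matrix.one_mul,
      Matrix.nonsing_inv_mul _ hdet]
  rw [h1, h2, ← Matrix.mulVec_mulVec, Matrix.smul_mulVec, Matrix.mulVec_smul, Matrix.mulVec_mulVec,
    Matrix.mulVec_mulVec, ← Matrix.mul_assoc, Matrix.mul_nonsing_inv _ hdet, Matrix.one_mul,
    Matrix.nonsing_inv_mul _ hdet, Matrix.one_mulVec, hP, roundRobin_transpose_mulVec]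
  funext j
  simp [blockMean, div_eq_inv_mul]

lemma exploreEstimate_congr {s n : ℕ} {y y' : ℕ → ℝ} (h : ∀ t, s ≤ t → t < s + n → y t = y' t) :
    exploreEstimate A s n y = exploreEstimate A s n y' := by
  have : (fun k : Fin n => y (s + k)) = fun k : Fin n => y' (s + k) :=
    funext fun k => h _ (by omega) (by omega)
  simp only [exploreEstimate, this]

end Explore

end Whitening

/-! ### The trajectory of E2TC -/

section Trajectory

variable {d : ℕ}

lemma batchEnd_mono {i j : ℕ} (h : i ≤ j) : batchEnd d i ≤ batchEnd d j := by
  unfold batchEnd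
  gcongr
  norm_num

lemma batchEnd_pred_add_batchLen {i : ℕ} (hi : 1 ≤ i) :
    batchEnd d (i - 1) + batchLen d i = batchEnd d i := by
  obtain ⟨k, rfl⟩ : ∃ k, i = k + 1 := ⟨i - 1, by omega⟩
  simp only [batchEnd, batchLen, Nat.add_sub_cancel]
  rw [← Nat.mul_add]
  congr 1
  have : 1 ≤ 2 ^ k := Nat.one_le_two_pow
  rw [pow_succ]
  omega

lemma reward_eq {X : Set (Fin d → ℝ)} (𝒜 : Algorithm X) (θ : Fin d → ℝ) (u : 𝒜.Seed)
    (z : ℕ → ℝ) (t : ℕ) : reward 𝒜 θ u z t = action 𝒜 θ u z t ⬝ᵥ θ + z t := by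
  rw [reward, action]

variable [NeZero d] {A : Matrix (Fin d) (Fin d) ℝ} {σ α : ℝ} {T : ℕ}

lemma batchEstimate_congr {i : ℕ} (hi : 1 ≤ i) {y y' : ℕ → ℝ}
    (h : ∀ s < batchEnd d i, y s = y' s) : batchEstimate A i y = batchEstimate A i y' :=
  exploreEstimate_congr fun t _ ht => h t (by rwa [batchEnd_pred_add_batchLen hi] at ht)

lemma mem_exitBatches_congr {t i : ℕ} {y y' : ℕ → ℝ} (h : ∀ s < batchEnd d i, y s = y' s) :
    i ∈ exitBatches A σ α T t y ↔ i ∈ exitBatches A σ α T t y' := by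
  simp only [exitBatches, Set.mem_ofPred_eq]
  refine and_congr_right fun hi => ?_
  rw [batchEstimate_congr hi h]

lemma afterWarmup_congr {t i : ℕ} (hi : 1 ≤ i) {y y' : ℕ → ℝ} {τ : ℕ} (hτ : batchEnd d i ≤ τ)
    (h : ∀ s < τ, y s = y' s)
    (hcase : t ≤ τ ∨ batchEnd d i + exploreLen A σ T i y ≤ τ) :
    afterWarmup A σ T t i y = afterWarmup A σ T t i y' := by
  have hlen : exploreLen A σ T i y = exploreLen A σ T i y' := by
    unfold exploreLen
    rw [batchEstimate_congr hi fun s hs => h s (hs.trans_le hτ)]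
  unfold afterWarmup
  rw [← hlen]
  split_ifs with hlt
  · rfl
  · rw [exploreEstimate_congr fun s _ hs => h s (by omega)]

/-- The action of round `t` is determined by the rewards of the exploration rounds before `t`. -/
lemma e2tcAction_congr {t τ : ℕ} {y y' : ℕ → ℝ} (h : ∀ s < τ, y s = y' s)
    (hcase : t ≤ τ ∨ (exitBatches A σ α T t y).Nonempty ∧
      batchEnd d (sInf (exitBatches A σ α T t y))
        + exploreLen A σ T (sInf (exitBatches A σ α T t y)) y ≤ τ) :
    e2tcAction A σ α T t y = e2tcAction A σ α T t y' := by
  have hend : ∀ i, i ∈ exitBatches A σ α T t y → batchEnd d i ≤ t := fun i hi => hi.2.1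
  unfold e2tcAction
  rcases hcase with hle | ⟨hne, hle⟩
  · have hset : exitBatches A σ α T t y = exitBatches A σ α T t y' := by
      ext i
      by_cases hi : batchEnd d i ≤ t
      · exact mem_exitBatches_congr fun s hs => h s (by omega)
      · simp [exitBatches, hi]
    rw [← hset]
    split_ifs with hne
    · have hmem := Nat.sInf_mem hne
      exact afterWarmup_congr hmem.1 (τ := τ) ((hend _ hmem).trans hle) h (Or.inl hle)
    · rfl
  · set i := sInf (exitBatches A σ α T t y) with hi
    have hmem : i ∈ exitBatches A σ α T t y := Nat.sInf_mem hne
    have hiτ : batchEnd d i ≤ τ := by omega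
    have hmem' : i ∈ exitBatches A σ α T t y' :=
      (mem_exitBatches_congr fun s hs => h s (by omega)).1 hmem
    have hinf : sInf (exitBatches A σ α T t y') = i := by
      refine le_antisymm (Nat.sInf_le hmem') ?_
      by_contra! hlt
      have hj := Nat.sInf_mem (⟨i, hmem'⟩ : (exitBatches A σ α T t y').Nonempty)
      have hje := batchEnd_mono (d := d) hlt.le
      have := Nat.sInf_le ((mem_exitBatches_congr (y := y) fun s hs => h s (by omega)).2 hj)
      omega
    rw [if_pos hne, if_pos ⟨i, hmem'⟩, hinf]
    exact afterWarmup_congr hmem.1 (τ := τ) hiτ h (Or.inr hle)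

/-- An exit batch that is complete by round s is also complete by round t, and the first one is the
same at both times. So what is known about the end of exploration at time t also describes the
earlier round s. -/
lemma e2tcAction_eq_exploreAction_of_lt {s t : ℕ} {y : ℕ → ℝ}
    (hst : s ≤ t) (h : (exitBatches A σ α T t y).Nonempty →
      s < batchEnd d (sInf (exitBatches A σ α T t y))
        + exploreLen A σ T (sInf (exitBatches A σ α T t y)) y) :
    e2tcAction A σ α T s y = exploreAction A s := by
  have hsub : exitBatches A σ α T s y ⊆ exitBatches A σ α T t y := fun i hi =>
    ⟨hi.1, hi.2.1.trans hst, hi.2.2⟩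
  unfold e2tcAction
  split_ifs with hne
  · have hmem := Nat.sInf_mem hne
    have hne' := hne.mono hsub
    have hmem' := Nat.sInf_mem hne'
    have hle := Nat.sInf_le (hsub hmem)
    have heq : sInf (exitBatches A σ α T s y) = sInf (exitBatches A σ α T t y) := by
      refine le_antisymm (Nat.sInf_le ⟨hmem'.1, ?_, hmem'.2.2⟩) hle
      exact (batchEnd_mono hle).trans hmem.2.1
    rw [heq]
    unfold afterWarmup
    rw [if_pos (h hne')]
  · rfl

/-- The rewards that would be received if all rounds were exploration rounds. -/
def exploreReward (A : Matrix (Fin d) (Fin d) ℝ) (θ : Fin d → ℝ) (z : ℕ → ℝ) (t : ℕ) : ℝ :=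
  exploreAction A t ⬝ᵥ θ + z t

/-- E2TC acts on its true rewards as it would on those of a learner who always explores. -/
lemma action_e2tc (hA : A.PosDef) (θ : Fin d → ℝ) (u : (e2tc hA σ α T).Seed) (z : ℕ → ℝ) (t : ℕ) :
    action (e2tc hA σ α T) θ u z t = e2tcAction A σ α T t (exploreReward A θ z) := by
  induction t using Nat.strong_induction_on with
  | _ t ih =>
    set y := exploreReward A θ z with hy
    set h : Fin t → ℝ := fun s => reward (e2tc hA σ α T) θ u z s with hh
    have hact : action (e2tc hA σ α T) θ u z t = e2tcAction A σ α T t (padHistory h) := rfl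
    have hpad : ∀ s < t, e2tcAction A σ α T s y = exploreAction A s → y s = padHistory h s := by
      intro s hs hs'
      have : padHistory h s = reward (e2tc hA σ α T) θ u z s := by simp [padHistory, hs, hh]
      rw [this, reward_eq, ih s hs, hs', hy, exploreReward]
    rw [hact]
    symm
    by_cases hne : (exitBatches A σ α T t y).Nonempty
    -- τ is the end of the exploration seen so far. All rounds before τ are exploration rounds, so
    -- by induction the true and the hypothetical rewards agree there, and the action of round t
    -- depends on nothing else.
    · set τ := min t (batchEnd d (sInf (exitBatches A σ α T t y))
        + exploreLen A σ T (sInf (exitBatches A σ α T t y)) y) with hτ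
      refine e2tcAction_congr (τ := τ) (fun s hs => hpad s (by omega) ?_) ?_
      · exact e2tcAction_eq_exploreAction_of_lt (t := t) (by omega) fun _ => by omega
      · rcases le_total t (batchEnd d (sInf (exitBatches A σ α T t y))
          + exploreLen A σ T (sInf (exitBatches A σ α T t y)) y) with hle | hle
        · left; omega
        · right; exact ⟨hne, by omega⟩
    · refine e2tcAction_congr (τ := t) (fun s hs => hpad s hs ?_) (Or.inl le_rfl)
      exact e2tcAction_eq_exploreAction_of_lt (t := t) hs.le fun h => absurd h hne

end Trajectory

/-! ### A pathwise bound for the regret of E2TC -/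

section Pathwise

lemma sum_range_ite_le {T lo hi : ℕ} {c : ℝ} (hc : 0 ≤ c) {p : Prop} [Decidable p] :
    ∑ t ∈ Finset.range T, (if (lo ≤ t ∧ t < hi) ∧ p then c else 0)
      ≤ ((hi - lo : ℕ) : ℝ) * (if p then c else 0) := by
  by_cases hp : p
  · simp only [hp, and_true, if_true]
    rw [← Finset.sum_filter, Finset.sum_const, nsmul_eq_mul]
    gcongr
    rw [← Nat.card_Ico]
    refine Finset.card_le_card fun t ht => ?_
    simp only [Finset.mem_filter] at ht
    simpa using ht.2
  · simp [hp]

variable {d : ℕ} [NeZero d] (A : Matrix (Fin d) (Fin d) ℝ) (σ : ℝ) (T : ℕ) (θ : Fin d → ℝ)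

/-- The norm of the estimate of the batch of index `k + 1`. -/
def batchNorm (k : ℕ) (z : ℕ → ℝ) : ℝ :=
  euclNorm (CFC.sqrt A *ᵥ θ + blockMean d (2 ^ k - 1) (2 ^ k) z)

/-- The threshold of the batch of index `k + 1`. -/
def batchThreshold (d : ℕ) (σ : ℝ) (T k : ℕ) : ℝ :=
  threshold d σ (batchDelta d T (k + 1)) (batchLen d (k + 1))

/-- No batch before that of index `k + 1` passes the test. -/
def StillWarm (k : ℕ) (z : ℕ → ℝ) : Prop :=
  ∀ j < k, batchNorm A θ j z ≤ 3 * batchThreshold d σ T j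

/-- The batch of index `k + 1` is the first that passes the test. -/
def ExitsAt (k : ℕ) (z : ℕ → ℝ) : Prop :=
  StillWarm A σ T θ k z ∧ 3 * batchThreshold d σ T k < batchNorm A θ k z

/-- The number of repetitions of each exploration action in the second phase. -/
def repetitions (k : ℕ) (z : ℕ → ℝ) : ℕ := ⌈σ * √T / batchNorm A θ k z⌉₊

variable {A σ T θ}

lemma blockMean_exploreReward (q : ℕ) {m : ℕ} (hm : 0 < m) (z : ℕ → ℝ) :
    blockMean d q m (exploreReward A θ z) = CFC.sqrt A *ᵥ θ + blockMean d q m z := by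
  unfold exploreReward
  rw [blockMean_add, blockMean_explore A q hm]

lemma matNorm_batchEstimate (hA : A.PosDef) (k : ℕ) (z : ℕ → ℝ) :
    matNorm A (batchEstimate A (k + 1) (exploreReward A θ z)) = batchNorm A θ k z := by
  have hk : 0 < 2 ^ k := Nat.two_pow_pos k
  rw [matNorm_eq_euclNorm hA, batchEstimate, batchNorm, ← blockMean_exploreReward _ hk,
    ← sqrt_mulVec_exploreEstimate hA _ hk]
  rfl

lemma mem_exitBatches_exploreReward (hA : A.PosDef) {t k : ℕ} {z : ℕ → ℝ} :
    k + 1 ∈ exitBatches A σ 3 T t (exploreReward A θ z) ↔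
      batchEnd d (k + 1) ≤ t ∧ 3 * batchThreshold d σ T k < batchNorm A θ k z := by
  rw [exitBatches, Set.mem_ofPred_eq, matNorm_batchEstimate hA]
  simp [batchThreshold]

lemma exists_batch (t : ℕ) :
    ∃ k, d * (2 ^ k - 1) ≤ t ∧ t < d * (2 ^ k - 1) + d * 2 ^ k := by
  have hd : 0 < d := NeZero.pos d
  -- Round t lies in cycle t / d, and the batch with 2^k cycles starts at cycle 2^k - 1.
  refine ⟨Nat.log 2 (t / d + 1), ?_, ?_⟩
  · have h : 2 ^ Nat.log 2 (t / d + 1) ≤ t / d + 1 := Nat.pow_log_le_self 2 (Nat.succ_ne_zero _)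
    calc d * (2 ^ Nat.log 2 (t / d + 1) - 1) ≤ d * (t / d) :=
        Nat.mul_le_mul_left d (Nat.sub_le_iff_le_add.2 h)
      _ ≤ t := Nat.mul_div_le t d
  · have h := Nat.lt_pow_succ_log_self (b := 2) (by norm_num) (t / d + 1)
    rw [← Nat.mul_add]
    have h1 : t / d + 1 ≤ 2 ^ Nat.log 2 (t / d + 1) - 1 + 2 ^ Nat.log 2 (t / d + 1) := by
      rw [pow_succ] at h
      have := Nat.one_le_two_pow (n := Nat.log 2 (t / d + 1))
      omega
    calc t < d * (t / d + 1) := Nat.lt_mul_div_succ t hd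
      _ ≤ _ := Nat.mul_le_mul_left d h1

/-- In each round E2TC is in one of its three phases. -/
lemma round_cases (hA : A.PosDef) (z : ℕ → ℝ) (t : ℕ) :
    (∃ k, (d * (2 ^ k - 1) ≤ t ∧ t < d * (2 ^ k - 1) + d * 2 ^ k) ∧ StillWarm A σ T θ k z) ∨
    ∃ k, ExitsAt A σ T θ k z ∧ d * (2 ^ (k + 1) - 1) ≤ t ∧
      (t < d * (2 ^ (k + 1) - 1) + d * repetitions A σ T θ k z ∨
        (d * (2 ^ (k + 1) - 1) + d * repetitions A σ T θ k z ≤ t ∧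
          e2tcAction A σ 3 T t (exploreReward A θ z) = optimalAction A
            (exploreEstimate A (d * (2 ^ (k + 1) - 1)) (d * repetitions A σ T θ k z)
              (exploreReward A θ z)))) := by
  by_cases hne : (exitBatches A σ 3 T t (exploreReward A θ z)).Nonempty
  · right
    have hmem := Nat.sInf_mem hne
    obtain ⟨k, hk⟩ : ∃ k, sInf (exitBatches A σ 3 T t (exploreReward A θ z)) = k + 1 :=
      ⟨_, (Nat.sub_add_cancel hmem.1).symm⟩
    rw [hk, mem_exitBatches_exploreReward hA] at hmem
    have hlen : exploreLen A σ T (k + 1) (exploreReward A θ z) = d * repetitions A σ T θ k z := by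
      rw [exploreLen, matNorm_batchEstimate hA, repetitions]
    refine ⟨k, ⟨fun j hj => ?_, hmem.2⟩, hmem.1, ?_⟩
    · by_contra! hlt
      have hj' : j + 1 ∈ exitBatches A σ 3 T t (exploreReward A θ z) :=
        (mem_exitBatches_exploreReward hA).2
          ⟨(batchEnd_mono (by omega : j + 1 ≤ k + 1)).trans hmem.1, hlt⟩
      have := Nat.sInf_le hj'
      omega
    · rcases lt_or_ge t (d * (2 ^ (k + 1) - 1) + d * repetitions A σ T θ k z) with hlt | hge
      · exact Or.inl hlt
      · refine Or.inr ⟨hge, ?_⟩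
        unfold e2tcAction afterWarmup
        rw [if_pos hne, hk, hlen, if_neg (by unfold batchEnd; omega)]
        rfl
  · left
    obtain ⟨k, hk⟩ := exists_batch (d := d) t
    refine ⟨k, hk, fun j hj => ?_⟩
    by_contra! hlt
    exact hne ⟨j + 1, (mem_exitBatches_exploreReward hA).2
      ⟨(batchEnd_mono (by omega : j + 1 ≤ k)).trans hk.1, hlt⟩⟩

end Pathwise

section Pathwise

variable {d : ℕ} {A : Matrix (Fin d) (Fin d) ℝ} {σ : ℝ} {T : ℕ} {θ : Fin d → ℝ}

lemma batchThreshold_nonneg (d : ℕ) (σ : ℝ) (T k : ℕ) : 0 ≤ batchThreshold d σ T k :=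
  Real.sqrt_nonneg _

lemma repetitions_pos (hσ : 0 < σ) (hT : 0 < T) {k : ℕ} {z : ℕ → ℝ} (h : ExitsAt A σ T θ k z) :
    0 < repetitions A σ T θ k z := by
  have hB : 0 < batchNorm A θ k z :=
    lt_of_le_of_lt (mul_nonneg (by norm_num) (batchThreshold_nonneg d σ T k)) h.2
  have hT' : (0 : ℝ) < T := by exact_mod_cast hT
  exact Nat.ceil_pos.2 (by positivity)

variable [NeZero d]

lemma lt_of_mul_two_pow_le {k : ℕ} (h : d * 2 ^ k ≤ T) : k < T :=
  k.lt_two_pow_self.trans_le ((Nat.le_mul_of_pos_left _ (NeZero.pos d)).trans h)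

open Classical in
-- A round of the first two phases is charged the maximal regret 2b, and a round of the last phase
-- is charged 2|w|²/b. The last sum is split by the number m of repetitions because, for fixed m,
-- the estimate is an average over a deterministic block, independent of the event that selects m.
lemma sum_regret_le (hA : A.PosDef) (hσ : 0 < σ) (hθ : 0 < matNorm A θ) (z : ℕ → ℝ) :
    ∑ t ∈ Finset.range T,
        (matNorm A θ - e2tcAction A σ 3 T t (exploreReward A θ z) ⬝ᵥ θ) ≤
      (∑ k ∈ Finset.range T, (d * 2 ^ k : ℝ) *
        (if d * (2 ^ k - 1) < T ∧ StillWarm A σ T θ k z then 2 * matNorm A θ else 0)) +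
      (∑ k ∈ Finset.range T, (d * repetitions A σ T θ k z : ℝ) *
        (if d * 2 ^ k ≤ T ∧ ExitsAt A σ T θ k z then 2 * matNorm A θ else 0)) +
      T * ∑ k ∈ Finset.range T, ∑ m ∈ Finset.Icc 1 T,
        if d * 2 ^ k ≤ T ∧ ExitsAt A σ T θ k z ∧ repetitions A σ T θ k z = m then
          2 * euclNorm (blockMean d (2 ^ (k + 1) - 1) m z) ^ 2 / matNorm A θ else 0 := by
  set b := matNorm A θ with hb
  set F1 : ℕ → ℕ → ℝ := fun t k =>
    if (d * (2 ^ k - 1) ≤ t ∧ t < d * (2 ^ k - 1) + d * 2 ^ k) ∧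
      (d * (2 ^ k - 1) < T ∧ StillWarm A σ T θ k z) then 2 * b else 0 with hF1
  set F2 : ℕ → ℕ → ℝ := fun t k =>
    if (d * (2 ^ (k + 1) - 1) ≤ t ∧
      t < d * (2 ^ (k + 1) - 1) + d * repetitions A σ T θ k z) ∧
      (d * 2 ^ k ≤ T ∧ ExitsAt A σ T θ k z) then 2 * b else 0 with hF2
  set F3 : ℕ → ℕ → ℝ := fun k m =>
    if d * 2 ^ k ≤ T ∧ ExitsAt A σ T θ k z ∧ repetitions A σ T θ k z = m then
      2 * euclNorm (blockMean d (2 ^ (k + 1) - 1) m z) ^ 2 / b else 0 with hF3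
  have hF1' : ∀ t k, 0 ≤ F1 t k := fun t k => by simp only [hF1]; split_ifs <;> positivity
  have hF2' : ∀ t k, 0 ≤ F2 t k := fun t k => by simp only [hF2]; split_ifs <;> positivity
  have hF3' : ∀ k m, 0 ≤ F3 k m := fun k m => by simp only [hF3]; split_ifs <;> positivity
  have hround : ∀ t ∈ Finset.range T,
      b - e2tcAction A σ 3 T t (exploreReward A θ z) ⬝ᵥ θ ≤
        (∑ k ∈ Finset.range T, F1 t k) + (∑ k ∈ Finset.range T, F2 t k) +
          ∑ k ∈ Finset.range T, ∑ m ∈ Finset.Icc 1 T, F3 k m := by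
    intro t ht
    have ht : t < T := Finset.mem_range.1 ht
    have h1 : 0 ≤ ∑ k ∈ Finset.range T, F1 t k := Finset.sum_nonneg fun k _ => hF1' t k
    have h2 : 0 ≤ ∑ k ∈ Finset.range T, F2 t k := Finset.sum_nonneg fun k _ => hF2' t k
    have h3 : ∀ k ∈ Finset.range T, 0 ≤ ∑ m ∈ Finset.Icc 1 T, F3 k m := fun k _ =>
      Finset.sum_nonneg fun m _ => hF3' k m
    have h3' := Finset.sum_nonneg h3
    have htriv : b - e2tcAction A σ 3 T t (exploreReward A θ z) ⬝ᵥ θ ≤ 2 * b := by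
      linarith [neg_matNorm_le_dotProduct hA
        (e2tcAction_mem hA σ 3 T t (exploreReward A θ z)) θ]
    have hpow : ∀ k, d * 2 ^ k ≤ d * (2 ^ (k + 1) - 1) := fun k => by
      refine Nat.mul_le_mul_left d ?_
      have := Nat.one_le_two_pow (n := k)
      rw [pow_succ]
      omega
    rcases round_cases (σ := σ) (T := T) (θ := θ) hA z t with
      ⟨k, hk, hw⟩ | ⟨k, hE, hk, hlt | ⟨hge, hact⟩⟩
    · have hkT : k < T := by
        have h4 : 2 ^ k - 1 < T :=
          (Nat.le_mul_of_pos_left _ (NeZero.pos d)).trans_lt (hk.1.trans_lt ht)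
        have := k.lt_two_pow_self
        omega
      have : F1 t k = 2 * b := if_pos ⟨hk, hk.1.trans_lt ht, hw⟩
      have := Finset.single_le_sum (f := F1 t) (fun k _ => hF1' t k) (Finset.mem_range.2 hkT)
      linarith
    · have hkT' : d * 2 ^ k ≤ T := (hpow k).trans (hk.trans ht.le)
      have hkT := lt_of_mul_two_pow_le hkT'
      have : F2 t k = 2 * b := if_pos ⟨⟨hk, hlt⟩, hkT', hE⟩
      have := Finset.single_le_sum (f := F2 t) (fun k _ => hF2' t k) (Finset.mem_range.2 hkT)
      linarith
    · have hkT' : d * 2 ^ k ≤ T := (hpow k).trans (hk.trans ht.le)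
      have hkT := lt_of_mul_two_pow_le hkT'
      -- The commit phase is reached before the horizon, so d·m ≤ t < T and the index m does lie in
      -- the range of summation.
      set m := repetitions A σ T θ k z with hm
      have hm0 : 0 < m := repetitions_pos hσ (by omega) hE
      have hmT : m ≤ T := by
        have := Nat.le_mul_of_pos_left m (NeZero.pos d)
        omega
      have hF : F3 k m = 2 * euclNorm (blockMean d (2 ^ (k + 1) - 1) m z) ^ 2 / b :=
        if_pos ⟨hkT', hE, rfl⟩
      have hle : b - e2tcAction A σ 3 T t (exploreReward A θ z) ⬝ᵥ θ ≤ F3 k m := by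
        rw [hF, hact]
        refine matNorm_sub_optimalAction_dotProduct_le hA ?_ hθ
        rw [sqrt_mulVec_exploreEstimate hA _ hm0, blockMean_exploreReward _ hm0]
      have h4 := Finset.single_le_sum (f := F3 k) (fun m _ => hF3' k m)
        (Finset.mem_Icc.2 ⟨hm0, hmT⟩)
      have h5 := Finset.single_le_sum h3 (Finset.mem_range.2 hkT)
      linarith
  refine (Finset.sum_le_sum hround).trans ?_
  rw [Finset.sum_add_distrib, Finset.sum_add_distrib, Finset.sum_const, Finset.card_range,
    nsmul_eq_mul]
  refine add_le_add (add_le_add ?_ ?_) le_rfl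
  · rw [Finset.sum_comm]
    refine Finset.sum_le_sum fun k _ => ?_
    refine (sum_range_ite_le (by positivity : 0 ≤ 2 * b)).trans_eq ?_
    rw [Nat.add_sub_cancel_left]
    push_cast
    rfl
  · rw [Finset.sum_comm]
    refine Finset.sum_le_sum fun k _ => ?_
    refine (sum_range_ite_le (by positivity : 0 ≤ 2 * b)).trans_eq ?_
    rw [Nat.add_sub_cancel_left]
    push_cast
    rfl

end Pathwise

/-! ### Geometric sums -/

section Geometric

open Classical in
-- A truncated geometric sum is governed by its largest term, whatever the number of terms. This is
-- what keeps logarithms of T out of the regret bound.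
lemma sum_geometric_le {ρ : ℝ} (hρ : 1 < ρ) {a M : ℝ} (ha : 0 ≤ a) (hM : 0 ≤ M) (N : ℕ) :
    ∑ k ∈ Finset.range N, (if a * ρ ^ k ≤ M then a * ρ ^ k else 0) ≤ ρ / (ρ - 1) * M := by
  have hρ' : 0 < ρ - 1 := by linarith
  induction N with
  | zero => simp; positivity
  | succ N ih =>
    rw [Finset.sum_range_succ]
    by_cases h : a * ρ ^ N ≤ M
    · rw [if_pos h]
      have h1 : ∑ k ∈ Finset.range N, (if a * ρ ^ k ≤ M then a * ρ ^ k else 0)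
          ≤ ∑ k ∈ Finset.range N, a * ρ ^ k := Finset.sum_le_sum fun k _ => by
        split_ifs
        · exact le_rfl
        · positivity
      have h2 : ∑ k ∈ Finset.range N, a * ρ ^ k = a * ((ρ ^ N - 1) / (ρ - 1)) := by
        rw [← Finset.mul_sum, geom_sum_eq hρ.ne']
      have h3 : a * ((ρ ^ N - 1) / (ρ - 1)) + a * ρ ^ N ≤ ρ / (ρ - 1) * (a * ρ ^ N) := by
        have : ρ / (ρ - 1) * (a * ρ ^ N) - (a * ((ρ ^ N - 1) / (ρ - 1)) + a * ρ ^ N)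
            = a / (ρ - 1) := by
          field_simp
          ring
        have h4 : 0 ≤ a / (ρ - 1) := by positivity
        linarith
      have h5 : ρ / (ρ - 1) * (a * ρ ^ N) ≤ ρ / (ρ - 1) * M := by gcongr
      linarith
    · rw [if_neg h, add_zero]
      exact ih

open Classical in
lemma sum_geometric_inv_le {ρ : ℝ} (hρ : 1 < ρ) {a M : ℝ} (ha : 0 ≤ a) (hM : 0 ≤ M) (N : ℕ) :
    ∑ k ∈ Finset.range N, (if a / ρ ^ k ≤ M then a / ρ ^ k else 0) ≤ ρ / (ρ - 1) * M := by
  have hρ' : 0 < ρ - 1 := by linarith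
  induction N generalizing a with
  | zero => simp; positivity
  | succ N ih =>
    by_cases h : a ≤ M
    · have h1 : ∑ k ∈ Finset.range (N + 1), (if a / ρ ^ k ≤ M then a / ρ ^ k else 0)
          ≤ ∑ k ∈ Finset.range (N + 1), a * (ρ⁻¹) ^ k := Finset.sum_le_sum fun k _ => by
        rw [inv_pow, ← div_eq_mul_inv]
        split_ifs
        · exact le_rfl
        · positivity
      have h2 : ∑ k ∈ Finset.range (N + 1), (ρ⁻¹) ^ k ≤ ρ / (ρ - 1) := by
        have h3 : ρ⁻¹ < 1 := inv_lt_one_of_one_lt₀ hρ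
        have := (summable_geometric_of_lt_one (by positivity) h3).sum_le_tsum
          (Finset.range (N + 1)) (fun k _ => by positivity)
        rw [tsum_geometric_of_lt_one (by positivity) h3] at this
        refine this.trans_eq ?_
        field_simp
      rw [← Finset.mul_sum] at h1
      calc _ ≤ _ := h1
        _ ≤ M * (ρ / (ρ - 1)) := by gcongr
        _ = _ := mul_comm _ _
    -- The first term exceeds M and is dropped; what remains is the same sum with a/ρ in place of a.
    · rw [Finset.sum_range_succ']
      simp only [pow_zero, div_one, if_neg h, add_zero]
      have := ih (a := a / ρ) (by positivity)
      simp only [div_div, ← pow_succ'] at this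
      exact this

lemma sqrt_two_div_le : √2 / (√2 - 1) ≤ (7 / 2 : ℝ) := by
  have h1 : (7 / 5 : ℝ) ≤ √2 := Real.le_sqrt_of_sq_le (by norm_num)
  rw [div_le_iff₀ (by linarith)]
  linarith

end Geometric

/-! ### The thresholds of the warm-up -/

section Threshold

variable {d T k : ℕ} {σ : ℝ}

lemma batchDelta_pos (hd : 0 < d) (hT : 0 < T) (i : ℕ) : 0 < batchDelta d T i := by
  unfold batchDelta batchLen
  refine lt_min ?_ one_pos
  positivity

lemma batchDelta_le_one (d T i : ℕ) : batchDelta d T i ≤ 1 := min_le_right _ _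

lemma log_inv_batchDelta_nonneg (hd : 0 < d) (hT : 0 < T) (i : ℕ) :
    0 ≤ Real.log (1 / batchDelta d T i) := by
  refine Real.log_nonneg ?_
  rw [one_le_div (batchDelta_pos hd hT i)]
  exact batchDelta_le_one d T i

lemma exp_neg_log_inv_batchDelta (hd : 0 < d) (hT : 0 < T) (i : ℕ) :
    Real.exp (-Real.log (1 / batchDelta d T i)) = batchDelta d T i := by
  have := batchDelta_pos hd hT i
  rw [one_div, Real.log_inv, neg_neg, Real.exp_log this]

/-- The prefactor σ²d/2^k is the total variance proxy of the estimate from the batch, which consists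
of 2^k cycles. -/
lemma batchThreshold_sq (hd : 0 < d) (hT : 0 < T) (σ : ℝ) (k : ℕ) :
    batchThreshold d σ T k ^ 2 = σ ^ 2 * d / 2 ^ k *
      (1 + 2 * √(1 / d * Real.log (1 / batchDelta d T (k + 1))) +
        2 / d * Real.log (1 / batchDelta d T (k + 1))) := by
  have hl := log_inv_batchDelta_nonneg hd hT (k + 1)
  have hd' : (0 : ℝ) < d := by exact_mod_cast hd
  rw [batchThreshold, threshold, Real.sq_sqrt (by positivity)]
  congr 1
  simp only [batchLen, Nat.add_sub_cancel]
  push_cast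
  field_simp

lemma le_batchThreshold_sq (hd : 0 < d) (hT : 0 < T) (σ : ℝ) (k : ℕ) :
    σ ^ 2 / 2 ^ k * (d + 2 * Real.log (1 / batchDelta d T (k + 1)))
      ≤ batchThreshold d σ T k ^ 2 := by
  rw [batchThreshold_sq hd hT]
  set t := Real.log (1 / batchDelta d T (k + 1))
  have hd' : (0 : ℝ) < d := by exact_mod_cast hd
  have e : σ ^ 2 / 2 ^ k * (d + 2 * t) = σ ^ 2 * d / 2 ^ k * (1 + 2 / d * t) := by
    field_simp
  rw [e]
  gcongr
  have := Real.sqrt_nonneg (1 / d * t)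
  linarith

lemma variance_le_batchThreshold_sq (hd : 0 < d) (hT : 0 < T) (σ : ℝ) (k : ℕ) :
    σ ^ 2 * d / 2 ^ k ≤ batchThreshold d σ T k ^ 2 := by
  refine le_trans ?_ (le_batchThreshold_sq hd hT σ k)
  have hl := log_inv_batchDelta_nonneg hd hT (k + 1)
  rw [mul_div_right_comm]
  gcongr
  linarith

/-- With n = d·2^k and log(1/δ) ≤ 1/δ = T/(dn), the product of n and log(1/δ)/d is at most T/d². So
the logarithm costs only a constant, and n times the threshold is O(σd√T). -/
lemma batchThreshold_sq_le (hd : 0 < d) (hT : 0 < T) (hk : d * 2 ^ k ≤ T) :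
    (d * 2 ^ k : ℝ) ^ 2 * batchThreshold d σ T k ^ 2 ≤ 5 * σ ^ 2 * d ^ 2 * T := by
  rw [batchThreshold_sq hd hT]
  have hl := log_inv_batchDelta_nonneg hd hT (k + 1)
  set t := Real.log (1 / batchDelta d T (k + 1)) with ht
  have hd' : (1 : ℝ) ≤ d := by exact_mod_cast hd
  have hT' : (0 : ℝ) < T := by exact_mod_cast hT
  have hn : (d * 2 ^ k : ℝ) ≤ T := by exact_mod_cast hk
  have h1 : (d * 2 ^ k : ℝ) * (1 / d * t) ≤ T := by
    have hdelta : batchDelta d T (k + 1) = min ((d : ℝ) * (d * 2 ^ k) / T) 1 := by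
      simp [batchDelta, batchLen]
    rcases le_total ((d : ℝ) * (d * 2 ^ k) / T) 1 with h | h
    · rw [min_eq_left h] at hdelta
      have h2 : t ≤ 1 / batchDelta d T (k + 1) := by
        have := Real.log_le_sub_one_of_pos (x := 1 / batchDelta d T (k + 1))
          (one_div_pos.2 (batchDelta_pos hd hT _))
        linarith
      rw [hdelta] at h2
      calc (d * 2 ^ k : ℝ) * (1 / d * t)
          ≤ (d * 2 ^ k : ℝ) * (1 / d * (1 / ((d : ℝ) * (d * 2 ^ k) / T))) := by gcongr
        _ = T / d ^ 2 := by field_simp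
        _ ≤ T := div_le_self hT'.le (one_le_pow₀ hd')
    · rw [min_eq_right h] at hdelta
      rw [ht, hdelta]
      simp
  -- Together with the other terms this gives n(2 + 3·log(1/δ)/d) ≤ 5T.
  have h3 : 2 * √(1 / d * t) ≤ 1 + 1 / d * t := by
    have h0 : 0 ≤ 1 / d * t := by positivity
    nlinarith [Real.sq_sqrt h0, sq_nonneg (√(1 / d * t) - 1)]
  have e : (d * 2 ^ k : ℝ) ^ 2 * (σ ^ 2 * d / 2 ^ k * (1 + 2 * √(1 / d * t) + 2 / d * t))
      = σ ^ 2 * d ^ 2 * ((d * 2 ^ k : ℝ) * (1 + 2 * √(1 / d * t) + 2 / d * t)) := by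
    field_simp
  rw [e]
  have h4 : (d * 2 ^ k : ℝ) * (1 + 2 * √(1 / d * t) + 2 / d * t) ≤ 5 * T := by
    calc (d * 2 ^ k : ℝ) * (1 + 2 * √(1 / d * t) + 2 / d * t)
        ≤ (d * 2 ^ k : ℝ) * (1 + (1 + 1 / d * t) + 2 / d * t) := by gcongr
      _ = 2 * (d * 2 ^ k : ℝ) + 3 * ((d * 2 ^ k : ℝ) * (1 / d * t)) := by ring
      _ ≤ 5 * T := by linarith
  calc σ ^ 2 * d ^ 2 * ((d * 2 ^ k : ℝ) * (1 + 2 * √(1 / d * t) + 2 / d * t))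
      ≤ σ ^ 2 * d ^ 2 * (5 * T) := by gcongr
    _ = _ := by ring

/-- Since δ = min(d²2^k/T, 1), the terms grow like √2^k until d√2^k reaches √T, and decay like
1/√2^k afterwards. Both geometric series are governed by the crossing value, of order σd/√T; this is
the purpose of the choice of δ_i. -/
lemma sum_scale_mul_batchDelta_le (hd : 0 < d) (hT : 0 < T) (hσ : 0 ≤ σ) (N : ℕ) :
    ∑ k ∈ Finset.range N, 2 * (σ / √(2 ^ k)) * batchDelta d T (k + 1) ≤ 14 * (σ * d / √T) := by
  classical
  have hd' : (0 : ℝ) < d := by exact_mod_cast hd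
  have hT' : (0 : ℝ) < T := by exact_mod_cast hT
  have hρ : (1 : ℝ) < √2 := by
    rw [Real.lt_sqrt (by norm_num)]
    norm_num
  have hpow : ∀ k : ℕ, √((2 : ℝ) ^ k) = √2 ^ k := fun k => by
    rw [Real.sqrt_eq_iff_mul_self_eq (by positivity) (by positivity), ← mul_pow,
      Real.mul_self_sqrt (by norm_num)]
  have hterm : ∀ k ∈ Finset.range N, 2 * (σ / √(2 ^ k)) * batchDelta d T (k + 1) ≤
      2 * σ * (d / √T) * (if d / √T * √2 ^ k ≤ 1 then d / √T * √2 ^ k else 0) +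
      2 * σ * (if √T / d / √2 ^ k ≤ 1 then √T / d / √2 ^ k else 0) * (d / √T) := by
    intro k _
    have hs : (0 : ℝ) < √2 ^ k := by positivity
    have hdelta : batchDelta d T (k + 1) = min ((d / √T * √2 ^ k) ^ 2) 1 := by
      simp only [batchDelta, batchLen, Nat.add_sub_cancel]
      congr 1
      rw [mul_pow, div_pow, Real.sq_sqrt hT'.le, ← pow_mul, mul_comm k 2, pow_mul,
        Real.sq_sqrt (by norm_num)]
      push_cast
      ring
    rw [hpow, hdelta]
    by_cases h : d / √T * √2 ^ k ≤ 1
    · rw [if_pos h]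
      have h1 : 2 * (σ / √2 ^ k) * min ((d / √T * √2 ^ k) ^ 2) 1
          ≤ 2 * σ * (d / √T) * (d / √T * √2 ^ k) := by
        calc 2 * (σ / √2 ^ k) * min ((d / √T * √2 ^ k) ^ 2) 1
            ≤ 2 * (σ / √2 ^ k) * (d / √T * √2 ^ k) ^ 2 := by
              gcongr
              exact min_le_left _ _
          _ = _ := by field_simp
      have h2 : 0 ≤ 2 * σ * (if √T / d / √2 ^ k ≤ 1 then √T / d / √2 ^ k else 0) * (d / √T) := by
        split_ifs <;> positivity
      linarith
    · have h' : √T / d / √2 ^ k ≤ 1 := by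
        push Not at h
        have e : √T / d / √2 ^ k = (d / √T * √2 ^ k)⁻¹ := by field_simp
        rw [e]
        exact inv_le_one_of_one_le₀ h.le
      rw [if_neg h, if_pos h', mul_zero, zero_add]
      calc 2 * (σ / √2 ^ k) * min ((d / √T * √2 ^ k) ^ 2) 1
          ≤ 2 * (σ / √2 ^ k) * 1 := by
            gcongr
            exact min_le_right _ _
        _ = _ := by field_simp
  refine (Finset.sum_le_sum hterm).trans ?_
  rw [Finset.sum_add_distrib, ← Finset.mul_sum, ← Finset.sum_mul, ← Finset.mul_sum]
  have h1 := sum_geometric_le hρ (a := d / √T) (M := 1) (by positivity) zero_le_one N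
  have h2 := sum_geometric_inv_le hρ (a := √T / d) (M := 1) (by positivity) zero_le_one N
  have h3 := sqrt_two_div_le
  calc _ ≤ 2 * σ * (d / √T) * (7 / 2) + 2 * σ * (7 / 2) * (d / √T) := by
        gcongr
        · exact h1.trans (by linarith)
        · exact h2.trans (by linarith)
    _ = _ := by ring

end Threshold

/-! ### Measurability and locality of the exit from the warm-up -/

section Exit

variable {d : ℕ} {A : Matrix (Fin d) (Fin d) ℝ} {σ : ℝ} {T : ℕ} {θ : Fin d → ℝ}

lemma batchNorm_congr {j k : ℕ} (hjk : j ≤ k) {y z : ℕ → ℝ}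
    (h : ∀ t < d * (2 ^ (k + 1) - 1), y t = z t) : batchNorm A θ j y = batchNorm A θ j z := by
  unfold batchNorm
  rw [blockMean_congr fun t _ ht => h t (ht.trans_le (Nat.mul_le_mul_left d ?_))]
  have h1 : 2 ^ j ≤ 2 ^ k := Nat.pow_le_pow_right (by norm_num) hjk
  have := Nat.one_le_two_pow (n := j)
  rw [pow_succ]
  omega

lemma measurable_batchNorm (k : ℕ) : Measurable (batchNorm A θ k) :=
  measurable_euclNorm.comp ((measurable_blockMean d _ _).const_add _)

lemma measurableSet_stillWarm (k : ℕ) : MeasurableSet {z | StillWarm A σ T θ k z} := by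
  have : {z | StillWarm A σ T θ k z}
      = ⋂ j, ⋂ (_ : j < k), {z | batchNorm A θ j z ≤ 3 * batchThreshold d σ T j} := by
    ext z
    simp [StillWarm]
  rw [this]
  exact MeasurableSet.iInter fun j => MeasurableSet.iInter fun _ =>
    measurableSet_le (measurable_batchNorm j) measurable_const

lemma measurableSet_exitsAt (k : ℕ) : MeasurableSet {z | ExitsAt A σ T θ k z} :=
  (measurableSet_stillWarm k).inter (measurableSet_lt measurable_const (measurable_batchNorm k))

lemma measurable_repetitions (k : ℕ) : Measurable (repetitions A σ T θ k) :=
  Nat.measurable_ceil.comp (measurable_const.div (measurable_batchNorm k))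

/-- The warm-up decides when to stop, and how long to explore afterwards, from its own rounds only.
This is the source of the independence used in the commit phase. -/
lemma exitsAt_and_repetitions_congr {k m : ℕ} {y z : ℕ → ℝ}
    (h : ∀ t < d * (2 ^ (k + 1) - 1), y t = z t) :
    (ExitsAt A σ T θ k y ∧ repetitions A σ T θ k y = m) ↔
      (ExitsAt A σ T θ k z ∧ repetitions A σ T θ k z = m) := by
  unfold ExitsAt StillWarm repetitions
  rw [batchNorm_congr le_rfl h]
  have : ∀ j < k, batchNorm A θ j y = batchNorm A θ j z := fun j hj => batchNorm_congr hj.le h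
  simp +contextual only [this]

open Classical in
/-- The warm-up is left at most once. -/
lemma sum_exitsAt_le (s : Finset ℕ) {c : ℝ} (hc : 0 ≤ c) (z : ℕ → ℝ) :
    ∑ k ∈ s, (if ExitsAt A σ T θ k z then c else 0) ≤ c := by
  rw [← Finset.sum_filter, Finset.sum_const, nsmul_eq_mul]
  have h : (s.filter fun k => ExitsAt A σ T θ k z).card ≤ 1 := by
    refine Finset.card_le_one.2 fun i hi j hj => ?_
    have hi := (Finset.mem_filter.1 hi).2
    have hj := (Finset.mem_filter.1 hj).2
    by_contra hij
    rcases lt_or_gt_of_ne hij with hlt | hlt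
    · exact absurd (hj.1 i hlt) (not_le.2 hi.2)
    · exact absurd (hi.1 j hlt) (not_le.2 hj.2)
  have : ((s.filter fun k => ExitsAt A σ T θ k z).card : ℝ) ≤ 1 := by exact_mod_cast h
  nlinarith

end Exit

/-! ### The expected cost of the three phases -/

section Expectation

lemma two_div_two_sub_one : (2 : ℝ) / (2 - 1) = 2 := by norm_num

/-- A sum of nonnegative multiples of integrable functions, restricted to the indices that satisfy
`p`, is integrable, and its integral is bounded termwise. -/
lemma integral_sum_ite_le {Ω : Type*} [MeasurableSpace Ω] {μ : Measure Ω} (s : Finset ℕ)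
    (p : ℕ → Prop) [DecidablePred p] (c : ℕ → ℝ) (hc : ∀ k, 0 ≤ c k) (f : ℕ → Ω → ℝ) (B : ℕ → ℝ)
    (hf : ∀ k, Integrable (f k) μ ∧ ∫ ω, f k ω ∂μ ≤ B k) :
    Integrable (fun ω => ∑ k ∈ s, if p k then c k * f k ω else 0) μ ∧
      ∫ ω, ∑ k ∈ s, (if p k then c k * f k ω else 0) ∂μ ≤ ∑ k ∈ s, if p k then c k * B k else 0 := by
  have hi : ∀ k ∈ s, Integrable (fun ω => if p k then c k * f k ω else 0) μ := fun k _ => by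
    by_cases h : p k
    · simpa [h] using (hf k).1.const_mul (c k)
    · simp [h]
  refine ⟨integrable_finsetSum s hi, ?_⟩
  rw [integral_finsetSum s hi]
  refine Finset.sum_le_sum fun k _ => ?_
  by_cases h : p k
  · simp only [h, if_true]
    rw [integral_const_mul]
    exact mul_le_mul_of_nonneg_left (hf k).2 (hc k)
  · simp [h]

variable {d : ℕ} {A : Matrix (Fin d) (Fin d) ℝ} {θ : Fin d → ℝ}

/-- The noise in the estimate of the batch of index `k + 1`. -/
def batchNoise (d k : ℕ) (z : ℕ → ℝ) : ℝ := euclNorm (blockMean d (2 ^ k - 1) (2 ^ k) z)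

lemma batchNoise_nonneg (k : ℕ) (z : ℕ → ℝ) : 0 ≤ batchNoise d k z := euclNorm_nonneg _

lemma euclNorm_add_le (u v : Fin d → ℝ) : euclNorm (u + v) ≤ euclNorm u + euclNorm v := by
  refine Real.sqrt_le_iff.2 ⟨add_nonneg (euclNorm_nonneg u) (euclNorm_nonneg v), ?_⟩
  have h1 : u ⬝ᵥ v ≤ euclNorm u * euclNorm v := by
    refine (abs_le_of_sq_le_sq' ?_ (mul_nonneg (euclNorm_nonneg u) (euclNorm_nonneg v))).2
    rw [mul_pow, euclNorm_sq, euclNorm_sq]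
    exact dotProduct_sq_le
  rw [add_dotProduct, dotProduct_add, dotProduct_add, ← euclNorm_sq, ← euclNorm_sq,
    dotProduct_comm v u]
  nlinarith

lemma batchNorm_le (hA : A.PosDef) (k : ℕ) (z : ℕ → ℝ) :
    batchNorm A θ k z ≤ matNorm A θ + batchNoise d k z := by
  rw [matNorm_eq_euclNorm hA]
  exact euclNorm_add_le _ _

lemma le_batchNorm (hA : A.PosDef) (k : ℕ) (z : ℕ → ℝ) :
    matNorm A θ ≤ batchNorm A θ k z + batchNoise d k z := by
  rw [matNorm_eq_euclNorm hA]
  have h := euclNorm_add_le (CFC.sqrt A *ᵥ θ + blockMean d (2 ^ k - 1) (2 ^ k) z)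
    (-blockMean d (2 ^ k - 1) (2 ^ k) z)
  have h2 : euclNorm (-blockMean d (2 ^ k - 1) (2 ^ k) z) = batchNoise d k z := by
    simp [euclNorm, batchNoise]
  rw [add_neg_cancel_right, h2] at h
  exact h

variable [NeZero d] {σ : ℝ≥0} {T : ℕ} {ν : ℕ → Measure ℝ} [∀ t, IsProbabilityMeasure (ν t)]

lemma batchNoise_second_moment (hσ : 0 < σ) (hν : IsSubgaussianNoise σ ν) (k : ℕ) :
    Integrable (fun z => batchNoise d k z ^ 2) (Measure.infinitePi ν) ∧
      ∫ z, batchNoise d k z ^ 2 ∂(Measure.infinitePi ν) ≤ 8 * (σ ^ 2 * d / 2 ^ k) := by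
  have h := blockMean_second_moment hσ hν (NeZero.pos d) (2 ^ k - 1) (m := 2 ^ k)
    (Nat.two_pow_pos k)
  push_cast at h
  exact h

lemma batchNoise_fourth_moment (hσ : 0 < σ) (hν : IsSubgaussianNoise σ ν) (k : ℕ) :
    Integrable (fun z => batchNoise d k z ^ 4) (Measure.infinitePi ν) ∧
      ∫ z, batchNoise d k z ^ 4 ∂(Measure.infinitePi ν) ≤ 64 * (σ ^ 2 * d / 2 ^ k) ^ 2 := by
  have h := blockMean_fourth_moment hσ hν (NeZero.pos d) (2 ^ k - 1) (m := 2 ^ k)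
    (Nat.two_pow_pos k)
  push_cast at h
  exact h

lemma batchNoise_tail_moment (hσ : 0 < σ) (hν : IsSubgaussianNoise σ ν) (hT : 0 < T) (k : ℕ) :
    Integrable (fun z => if 2 * batchThreshold d σ T k ≤ batchNoise d k z
      then batchNoise d k z else 0) (Measure.infinitePi ν) ∧
    ∫ z, (if 2 * batchThreshold d σ T k ≤ batchNoise d k z then batchNoise d k z else 0)
      ∂(Measure.infinitePi ν) ≤ 2 * (σ / √(2 ^ k)) * batchDelta d T (k + 1) := by
  have h := blockMean_tail_moment hσ hν (d := d) (2 ^ k - 1) (m := 2 ^ k) (Nat.two_pow_pos k)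
    (u := batchThreshold d σ T k) (t := Real.log (1 / batchDelta d T (k + 1)))
    (by
      push_cast
      exact le_batchThreshold_sq (NeZero.pos d) hT σ k)
    (batchThreshold_nonneg d σ T k)
  rw [exp_neg_log_inv_batchDelta (NeZero.pos d) hT] at h
  push_cast at h
  exact h

open Classical in
lemma warmup_cost_le (hA : A.PosDef) (hσ : 0 < σ) (hT : 0 < T)
    (hb : σ * d / √T < matNorm A θ) (z : ℕ → ℝ) :
    ∑ k ∈ Finset.range T, (d * 2 ^ k : ℝ) *
        (if d * (2 ^ k - 1) < T ∧ StillWarm A σ T θ k z then 2 * matNorm A θ else 0) ≤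
      2 * d * matNorm A θ +
      4 * matNorm A θ * ∑ k ∈ Finset.range T,
        (if (d : ℝ) * 2 ^ k ≤ 14 * σ * d * √T / matNorm A θ then (d : ℝ) * 2 ^ k else 0) +
      ∑ k ∈ Finset.range T, if (σ : ℝ) ^ 2 * d / 2 ^ k ≤ matNorm A θ ^ 2 then
        64 * (d * 2 ^ k) / matNorm A θ ^ 3 * batchNoise d k z ^ 4 else 0 := by
  set b := matNorm A θ with hbdef
  have hb0 : 0 < b := lt_of_le_of_lt (by positivity) hb
  have hd : (1 : ℝ) ≤ d := by exact_mod_cast NeZero.pos d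
  have hσ' : (0 : ℝ) < σ := hσ
  have hterm : ∀ k, (d * 2 ^ (k + 1) : ℝ) *
        (if d * (2 ^ (k + 1) - 1) < T ∧ StillWarm A σ T θ (k + 1) z then 2 * b else 0) ≤
      4 * b * (if (d : ℝ) * 2 ^ k ≤ 14 * σ * d * √T / b then (d : ℝ) * 2 ^ k else 0) +
      if (σ : ℝ) ^ 2 * d / 2 ^ k ≤ b ^ 2 then
        64 * (d * 2 ^ k) / b ^ 3 * batchNoise d k z ^ 4 else 0 := by
    intro k
    have hr := batchNoise_nonneg (d := d) k z
    have h1 : 0 ≤ 4 * b * (if (d : ℝ) * 2 ^ k ≤ 14 * σ * d * √T / b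
        then (d : ℝ) * 2 ^ k else 0) := by
      split_ifs <;> positivity
    have h2 : 0 ≤ if (σ : ℝ) ^ 2 * d / 2 ^ k ≤ b ^ 2 then
        64 * (d * 2 ^ k) / b ^ 3 * batchNoise d k z ^ 4 else 0 := by
      split_ifs <;> positivity
    by_cases hw : d * (2 ^ (k + 1) - 1) < T ∧ StillWarm A σ T θ (k + 1) z
    swap
    · rw [if_neg hw, mul_zero]
      exact add_nonneg h1 h2
    rw [if_pos hw]
    obtain ⟨hkT, hw⟩ := hw
    have hkT' : d * 2 ^ k ≤ T := by
      refine le_trans (Nat.mul_le_mul_left d ?_) hkT.le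
      have := Nat.one_le_two_pow (n := k)
      rw [pow_succ]
      omega
    have hU := batchThreshold_nonneg d σ T k
    have hpass := hw k (Nat.lt_succ_self k)
    by_cases h6 : b < 6 * batchThreshold d σ T k
    · have hle : (d : ℝ) * 2 ^ k ≤ 14 * σ * d * √T / b := by
        rw [le_div_iff₀ hb0]
        have h3 := batchThreshold_sq_le (σ := σ) (NeZero.pos d) hT hkT'
        refine abs_le_of_sq_le_sq' (b := 14 * σ * d * √T) ?_ (by positivity) |>.2
        -- 36 · 5 = 180 ≤ 14², which explains the 14.
        have h4 : b ^ 2 ≤ 36 * batchThreshold d σ T k ^ 2 := by nlinarith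
        calc ((d : ℝ) * 2 ^ k * b) ^ 2 = ((d : ℝ) * 2 ^ k) ^ 2 * b ^ 2 := by ring
          _ ≤ ((d : ℝ) * 2 ^ k) ^ 2 * (36 * batchThreshold d σ T k ^ 2) := by gcongr
          _ = 36 * (((d : ℝ) * 2 ^ k) ^ 2 * batchThreshold d σ T k ^ 2) := by ring
          _ ≤ 36 * (5 * σ ^ 2 * d ^ 2 * T) := by gcongr
          _ ≤ 196 * (σ ^ 2 * d ^ 2 * T) := by
            have : (0 : ℝ) ≤ σ ^ 2 * d ^ 2 * T := by positivity
            linarith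
          _ = (14 * σ * d * √T) ^ 2 := by
            rw [mul_pow _ (√(T : ℝ)), Real.sq_sqrt (by positivity)]
            ring
      rw [if_pos hle]
      have : (d * 2 ^ (k + 1) : ℝ) * (2 * b) = 4 * b * (d * 2 ^ k) := by ring
      linarith
    · push Not at h6
      have hv : (σ : ℝ) ^ 2 * d / 2 ^ k ≤ b ^ 2 := by
        have := variance_le_batchThreshold_sq (NeZero.pos d) hT σ k
        nlinarith
      rw [if_pos hv]
      have hr2 : b / 2 ≤ batchNoise d k z := by
        have := le_batchNorm (θ := θ) hA k z
        rw [← hbdef] at this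
        linarith
      have h5 : (b / 2) ^ 4 ≤ batchNoise d k z ^ 4 := by gcongr
      have : (d * 2 ^ (k + 1) : ℝ) * (2 * b) = 64 * (d * 2 ^ k) / b ^ 3 * (b / 2) ^ 4 := by
        field_simp
        ring
      have h6 : 64 * (d * 2 ^ k) / b ^ 3 * (b / 2) ^ 4
          ≤ 64 * (d * 2 ^ k) / b ^ 3 * batchNoise d k z ^ 4 := by gcongr
      linarith
  -- The test on batch k controls the cost of batch k + 1, so the index is shifted and the first
  -- batch is set apart.
  have hlast : ∀ f : ℕ → ℝ, (∀ k, 0 ≤ f k) →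
      ∑ k ∈ Finset.range T, f k ≤ f 0 + ∑ k ∈ Finset.range T, f (k + 1) := fun f hf => by
    rw [add_comm, ← Finset.sum_range_succ']
    exact Finset.sum_le_sum_of_subset_of_nonneg (Finset.range_mono (Nat.le_succ T))
      fun k _ _ => hf k
  refine (hlast _ fun k => ?_).trans ?_
  · split_ifs <;> positivity
  rw [add_assoc]
  refine add_le_add ?_ ?_
  · split_ifs
    · simp only [pow_zero, mul_one]
      linarith
    · simp only [mul_zero]
      positivity
  · rw [Finset.mul_sum, ← Finset.sum_add_distrib]
    exact Finset.sum_le_sum fun k _ => hterm k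

open Classical in
-- With v = σ²d/2^k, the product of batch length and v is σ²d², so each term is a multiple of
-- σ²d²v/b³. The v below b² form a decreasing geometric series with sum at most 2b², and σd ≤ b√T
-- finishes.
lemma integral_warmup_bound_le (hσ : 0 < σ) (hν : IsSubgaussianNoise σ ν) {b : ℝ} (hT : 0 < T)
    (hb : σ * d / √T < b) :
    Integrable (fun z => ∑ k ∈ Finset.range T, if (σ : ℝ) ^ 2 * d / 2 ^ k ≤ b ^ 2 then
        64 * (d * 2 ^ k) / b ^ 3 * batchNoise d k z ^ 4 else 0) (Measure.infinitePi ν) ∧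
    ∫ z, (∑ k ∈ Finset.range T, if (σ : ℝ) ^ 2 * d / 2 ^ k ≤ b ^ 2 then
        64 * (d * 2 ^ k) / b ^ 3 * batchNoise d k z ^ 4 else 0) ∂(Measure.infinitePi ν)
      ≤ 8192 * (σ * d * √T) := by
  have hb0 : 0 < b := lt_of_le_of_lt (by positivity) hb
  have hT' : (0 : ℝ) < T := by exact_mod_cast hT
  have h := integral_sum_ite_le (Finset.range T) (fun k => (σ : ℝ) ^ 2 * d / 2 ^ k ≤ b ^ 2)
    (fun k => 64 * (d * 2 ^ k) / b ^ 3) (fun k => by positivity)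
    (fun k z => batchNoise d k z ^ 4) _ (batchNoise_fourth_moment hσ hν)
  refine ⟨h.1, h.2.trans ?_⟩
  have hg := sum_geometric_inv_le (ρ := 2) (by norm_num) (a := (σ : ℝ) ^ 2 * d) (M := b ^ 2)
    (by positivity) (by positivity) T
  rw [two_div_two_sub_one] at hg
  have e : ∀ k, (if (σ : ℝ) ^ 2 * d / 2 ^ k ≤ b ^ 2 then
      64 * (d * 2 ^ k) / b ^ 3 * (64 * ((σ : ℝ) ^ 2 * d / 2 ^ k) ^ 2) else 0)
      = 4096 * (σ ^ 2 * d ^ 2) / b ^ 3 *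
        (if (σ : ℝ) ^ 2 * d / 2 ^ k ≤ b ^ 2 then (σ : ℝ) ^ 2 * d / 2 ^ k else 0) := fun k => by
    split_ifs
    · field_simp
      ring
    · simp
  simp only [e]
  rw [← Finset.mul_sum]
  have hbT : σ * d ≤ b * √T := by
    rw [div_lt_iff₀ (by positivity)] at hb
    exact hb.le
  calc _ ≤ 4096 * (σ ^ 2 * d ^ 2) / b ^ 3 * (2 * b ^ 2) := by gcongr
    _ = 8192 * (σ * d) * (σ * d) / b := by field_simp; ring
    _ ≤ 8192 * (σ * d) * (b * √T) / b := by gcongr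
    _ = _ := by field_simp

end Expectation

/-! ### Expected cost of the second exploration phase and of the commit phase. -/

section Expectation

lemma integral_const_add {Ω : Type*} [MeasurableSpace Ω] {μ : Measure Ω} [IsProbabilityMeasure μ]
    {f : Ω → ℝ} (hf : Integrable f μ) (c : ℝ) :
    Integrable (fun ω => c + f ω) μ ∧ ∫ ω, (c + f ω) ∂μ = c + ∫ ω, f ω ∂μ :=
  ⟨(integrable_const c).add hf, by rw [integral_add (integrable_const c) hf]; simp⟩

variable {d : ℕ} [NeZero d] {A : Matrix (Fin d) (Fin d) ℝ} {σ : ℝ≥0} {T : ℕ} {θ : Fin d → ℝ}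
  {ν : ℕ → Measure ℝ} [∀ t, IsProbabilityMeasure (ν t)]

open Classical in
-- An estimate B ≥ b/2 gives at most the intended cost. For B < b/2 the noise is at least b/2, while
-- passing the test forces B > 3U ≥ 3s, with s the noise scale √(σ²d/2^k). This limits the damage of
-- a small B, and a second moment of the noise then suffices.
lemma exploration_cost_le (hA : A.PosDef) (hσ : 0 < σ) (hT : 0 < T)
    (hb : σ * d / √T < matNorm A θ) (z : ℕ → ℝ) :
    ∑ k ∈ Finset.range T, (d * repetitions A σ T θ k z : ℝ) *
        (if d * 2 ^ k ≤ T ∧ ExitsAt A σ T θ k z then 2 * matNorm A θ else 0) ≤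
      2 * d * matNorm A θ + 4 * (σ * d * √T) +
      ∑ k ∈ Finset.range T, if √(σ ^ 2 * d) / √2 ^ k ≤ matNorm A θ then
        8 * (σ * d * √T) / (3 * matNorm A θ * (√(σ ^ 2 * d) / √2 ^ k)) * batchNoise d k z ^ 2
        else 0 := by
  set b := matNorm A θ with hbdef
  have hb0 : 0 < b := lt_of_le_of_lt (by positivity) hb
  have hd : (1 : ℝ) ≤ d := by exact_mod_cast NeZero.pos d
  have hσ' : (0 : ℝ) < σ := hσ
  have hT' : (0 : ℝ) < T := by exact_mod_cast hT
  refine le_trans ?_ (add_le_add_left (sum_exitsAt_le (A := A) (σ := σ) (T := T) (θ := θ)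
    (Finset.range T) (by positivity : 0 ≤ 2 * d * b + 4 * (σ * d * √T)) z) _)
  rw [← Finset.sum_add_distrib]
  refine Finset.sum_le_sum fun k _ => ?_
  set s := √(σ ^ 2 * d : ℝ) / √2 ^ k with hs
  have hs0 : 0 < s := by positivity
  have hs2 : s ^ 2 = σ ^ 2 * d / 2 ^ k := by
    rw [hs, div_pow, Real.sq_sqrt (by positivity), ← pow_mul, mul_comm k 2, pow_mul,
      Real.sq_sqrt (by norm_num)]
  have h2 : 0 ≤ if s ≤ b then 8 * (σ * d * √T) / (3 * b * s) * batchNoise d k z ^ 2 else 0 := by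
    split_ifs <;> positivity
  by_cases hE : ExitsAt A σ T θ k z
  swap
  · rw [if_neg (fun h => hE h.2), if_neg hE, mul_zero, zero_add]
    exact h2
  rw [if_pos hE]
  set B := batchNorm A θ k z with hB
  have hU := batchThreshold_nonneg d σ T k
  have hB0 : 0 < B := lt_of_le_of_lt (by positivity) hE.2
  have hrep : (repetitions A σ T θ k z : ℝ) ≤ σ * √T / B + 1 :=
    (Nat.ceil_lt_add_one (by positivity)).le
  -- The summand 2db comes from rounding the number of repetitions up.
  have hle : (d * repetitions A σ T θ k z : ℝ) *
      (if d * 2 ^ k ≤ T ∧ ExitsAt A σ T θ k z then 2 * b else 0) ≤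
      2 * d * b + 2 * b * (σ * d * √T) / B := by
    calc _ ≤ (d * (σ * √T / B + 1) : ℝ) * (2 * b) := by
          gcongr
          split_ifs
          · exact le_rfl
          · positivity
      _ = _ := by ring
  refine hle.trans ?_
  rcases le_or_gt (b / 2) B with h | h
  · have : 2 * b * (σ * d * √T) / B ≤ 4 * (σ * d * √T) := by
      rw [div_le_iff₀ hB0]
      have : (0 : ℝ) ≤ σ * d * √T := by positivity
      nlinarith
    linarith
  · have hr : b / 2 ≤ batchNoise d k z := by
      have := le_batchNorm (θ := θ) hA k z
      rw [← hbdef] at this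
      linarith
    have hsU : s ≤ batchThreshold d σ T k := by
      refine abs_le_of_sq_le_sq' ?_ hU |>.2
      rw [hs2]
      exact variance_le_batchThreshold_sq (NeZero.pos d) hT σ k
    have hsb : s ≤ b := by
      have := hE.2
      linarith
    rw [if_pos hsb]
    have h3 : 3 * s ≤ B := by linarith [hE.2]
    have h4 : 2 * b * (σ * d * √T) / B ≤
        8 * (σ * d * √T) / (3 * b * s) * batchNoise d k z ^ 2 := by
      calc 2 * b * (σ * d * √T) / B ≤ 2 * b * (σ * d * √T) / (3 * s) := by gcongr
        _ = 8 * (σ * d * √T) / (3 * b * s) * (b / 2) ^ 2 := by field_simp; ring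
        _ ≤ _ := by gcongr
    have h5 : (0 : ℝ) ≤ 4 * (σ * d * √T) := by positivity
    linarith

open Classical in
-- The second moment is at most 8s², so each term is of order σd√T·s/b; the scales s ≤ b decrease
-- geometrically with ratio √2.
lemma integral_exploration_bound_le (hσ : 0 < σ) (hν : IsSubgaussianNoise σ ν) {b : ℝ}
    (hb : 0 < b) :
    Integrable (fun z => ∑ k ∈ Finset.range T, if √(σ ^ 2 * d) / √2 ^ k ≤ b then
        8 * (σ * d * √T) / (3 * b * (√(σ ^ 2 * d) / √2 ^ k)) * batchNoise d k z ^ 2 else 0)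
      (Measure.infinitePi ν) ∧
    ∫ z, (∑ k ∈ Finset.range T, if √(σ ^ 2 * d) / √2 ^ k ≤ b then
        8 * (σ * d * √T) / (3 * b * (√(σ ^ 2 * d) / √2 ^ k)) * batchNoise d k z ^ 2 else 0)
      ∂(Measure.infinitePi ν) ≤ 75 * (σ * d * √T) := by
  have hd : (1 : ℝ) ≤ d := by exact_mod_cast NeZero.pos d
  have hσ' : (0 : ℝ) < σ := hσ
  have hρ : (1 : ℝ) < √2 := by
    rw [Real.lt_sqrt (by norm_num)]
    norm_num
  have h := integral_sum_ite_le (Finset.range T) (fun k => √(σ ^ 2 * d : ℝ) / √2 ^ k ≤ b)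
    (fun k => 8 * (σ * d * √T) / (3 * b * (√(σ ^ 2 * d : ℝ) / √2 ^ k))) (fun k => by positivity)
    (fun k z => batchNoise d k z ^ 2) _ (batchNoise_second_moment hσ hν)
  refine ⟨h.1, h.2.trans ?_⟩
  have hg := sum_geometric_inv_le hρ (a := √(σ ^ 2 * d : ℝ)) (M := b)
    (by positivity) (by positivity) T
  have e : ∀ k, (if √(σ ^ 2 * d : ℝ) / √2 ^ k ≤ b then
      8 * (σ * d * √T) / (3 * b * (√(σ ^ 2 * d : ℝ) / √2 ^ k)) * (8 * ((σ : ℝ) ^ 2 * d / 2 ^ k))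
      else 0) = 64 * (σ * d * √T) / (3 * b) *
        (if √(σ ^ 2 * d : ℝ) / √2 ^ k ≤ b then √(σ ^ 2 * d : ℝ) / √2 ^ k else 0) := fun k => by
    have hs0 : 0 < √(σ ^ 2 * d : ℝ) / √2 ^ k := by positivity
    have hs2 : (√(σ ^ 2 * d : ℝ) / √2 ^ k) ^ 2 = σ ^ 2 * d / 2 ^ k := by
      rw [div_pow, Real.sq_sqrt (by positivity), ← pow_mul, mul_comm k 2, pow_mul,
        Real.sq_sqrt (by norm_num)]
    rw [← hs2]
    set s := √(σ ^ 2 * d : ℝ) / √2 ^ k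
    split_ifs
    · field_simp
      ring
    · simp
  simp only [e]
  rw [← Finset.mul_sum]
  calc _ ≤ 64 * (σ * d * √T) / (3 * b) * (7 / 2 * b) := by
        gcongr
        exact hg.trans (mul_le_mul_of_nonneg_right sqrt_two_div_le hb.le)
    _ = 224 / 3 * (σ * d * √T) := by field_simp; ring
    _ ≤ _ := by
      have : (0 : ℝ) ≤ σ * d * √T := by positivity
      linarith

open Classical in
/-- The estimate of the second phase is independent of the event that fixes its length. -/
lemma integral_commit_term (hσ : 0 < σ) (hν : IsSubgaussianNoise σ ν) {b : ℝ} (hb : 0 < b)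
    (k : ℕ) {m : ℕ} (hm : 0 < m) :
    Integrable (fun z => if d * 2 ^ k ≤ T ∧ ExitsAt A σ T θ k z ∧ repetitions A σ T θ k z = m then
        2 * euclNorm (blockMean d (2 ^ (k + 1) - 1) m z) ^ 2 / b else 0)
      (Measure.infinitePi ν) ∧
    ∫ z, (if d * 2 ^ k ≤ T ∧ ExitsAt A σ T θ k z ∧ repetitions A σ T θ k z = m then
        2 * euclNorm (blockMean d (2 ^ (k + 1) - 1) m z) ^ 2 / b else 0) ∂(Measure.infinitePi ν) ≤
    ∫ z, (if d * 2 ^ k ≤ T ∧ ExitsAt A σ T θ k z ∧ repetitions A σ T θ k z = m then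
        16 * (σ ^ 2 * d / m) / b else 0) ∂(Measure.infinitePi ν) := by
  set P : (ℕ → ℝ) → Prop := fun z =>
    d * 2 ^ k ≤ T ∧ ExitsAt A σ T θ k z ∧ repetitions A σ T θ k z = m with hP
  set I : (ℕ → ℝ) → ℝ := fun z => if P z then 1 else 0 with hI
  set R : (ℕ → ℝ) → ℝ := fun z => 2 * euclNorm (blockMean d (2 ^ (k + 1) - 1) m z) ^ 2 / b with hR
  have hmom := blockMean_second_moment hσ hν (NeZero.pos d) (2 ^ (k + 1) - 1) hm
  have hPm : MeasurableSet {z | P z} := by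
    refine (MeasurableSet.const _).inter ((measurableSet_exitsAt k).inter ?_)
    exact measurable_repetitions k (measurableSet_singleton m)
  have hIm : Measurable I := Measurable.ite hPm measurable_const measurable_const
  have hRm : Measurable R :=
    (((measurable_euclNorm.comp (measurable_blockMean d _ m)).pow_const 2).const_mul 2).div_const b
  have hRi : Integrable R (Measure.infinitePi ν) := (hmom.1.const_mul 2).div_const b
  have hRle : ∫ z, R z ∂(Measure.infinitePi ν) ≤ 16 * (σ ^ 2 * d / m) / b := by
    simp only [hR]
    rw [integral_div, integral_const_mul]
    refine div_le_div_of_nonneg_right ?_ hb.le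
    linarith [hmom.2]
  have hdepI : DependsOn I (Finset.range (d * (2 ^ (k + 1) - 1)) : Set ℕ) := by
    intro y z hyz
    have := exitsAt_and_repetitions_congr (A := A) (σ := σ) (T := T) (θ := θ) (k := k) (m := m)
      (y := y) (z := z) fun t ht => hyz t (by simpa using ht)
    simp only [hI, hP, this]
  have hdepR : DependsOn R (Finset.Ico (d * (2 ^ (k + 1) - 1)) (d * (2 ^ (k + 1) - 1 + m)) :
      Set ℕ) := by
    intro y z hyz
    simp only [hR]
    rw [blockMean_congr fun t h1 h2 => hyz t (by simpa using ⟨h1, h2⟩)]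
  have hdis : Disjoint (Finset.range (d * (2 ^ (k + 1) - 1)))
      (Finset.Ico (d * (2 ^ (k + 1) - 1)) (d * (2 ^ (k + 1) - 1 + m))) := by
    rw [Finset.disjoint_left]
    intro t h1 h2
    simp only [Finset.mem_range, Finset.mem_Ico] at h1 h2
    omega
  -- The event is decided by the rounds before the second phase, and the averaged block starts
  -- exactly there.
  have hind : IndepFun I R (Measure.infinitePi ν) :=
    indepFun_of_dependsOn hdis hdepI hdepR hIm hRm
  have hIi : Integrable I (Measure.infinitePi ν) :=
    Integrable.of_bound hIm.aestronglyMeasurable 1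
      (ae_of_all _ fun z => by simp only [hI]; split_ifs <;> simp)
  have e1 : (fun z => if P z then R z else 0) = fun z => I z * R z := by
    funext z
    simp only [hI]
    split_ifs <;> simp
  have e2 : (fun z => if P z then 16 * (σ ^ 2 * d / m : ℝ) / b else 0)
      = fun z => I z * (16 * (σ ^ 2 * d / m : ℝ) / b) := by
    funext z
    simp only [hI]
    split_ifs <;> simp
  change Integrable (fun z => if P z then R z else 0) _ ∧ ∫ z, (if P z then R z else 0) ∂_ ≤
    ∫ z, (if P z then 16 * (σ ^ 2 * d / m : ℝ) / b else 0) ∂_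
  rw [e1, e2]
  refine ⟨hind.integrable_mul hIi hRi, ?_⟩
  rw [hind.integral_fun_mul_eq_mul_integral hIm.aestronglyMeasurable hRm.aestronglyMeasurable,
    integral_mul_const]
  refine mul_le_mul_of_nonneg_left hRle (integral_nonneg fun z => ?_)
  simp only [hI, Pi.zero_apply]
  split_ifs <;> simp

open Classical in
-- Since m ≥ σ√T/B, the weight is at most (16σd/√T)·B/b, and B at the exit has to be compared with
-- b. If U ≤ b, then B ≤ b + r ≤ 2b + r²/b, with r the noise. If U > b, passing the test B > 3U
-- forces r > 2U, an event of small tail moment.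
lemma commit_weight_le (hA : A.PosDef) (hσ : 0 < σ) (hT : 0 < T)
    (hb : σ * d / √T < matNorm A θ) (z : ℕ → ℝ) :
    ∑ k ∈ Finset.range T, ∑ m ∈ Finset.Icc 1 T,
      (if d * 2 ^ k ≤ T ∧ ExitsAt A σ T θ k z ∧ repetitions A σ T θ k z = m then
        16 * ((σ : ℝ) ^ 2 * d / m) / matNorm A θ else 0) ≤
      16 * (σ * d / √T) / matNorm A θ * (2 * matNorm A θ +
        (∑ k ∈ Finset.range T, if (σ : ℝ) ^ 2 * d / 2 ^ k ≤ matNorm A θ ^ 2 then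
          1 / matNorm A θ * batchNoise d k z ^ 2 else 0) +
        ∑ k ∈ Finset.range T, if 2 * batchThreshold d σ T k ≤ batchNoise d k z
          then batchNoise d k z else 0) := by
  set b := matNorm A θ with hbdef
  have hb0 : 0 < b := lt_of_le_of_lt (by positivity) hb
  have hd : (1 : ℝ) ≤ d := by exact_mod_cast NeZero.pos d
  have hσ' : (0 : ℝ) < σ := hσ
  have hT' : (0 : ℝ) < T := by exact_mod_cast hT
  have hexit := sum_exitsAt_le (A := A) (σ := σ) (T := T) (θ := θ)
    (Finset.range T) (by positivity : 0 ≤ 2 * b) z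
  refine le_trans ?_ (mul_le_mul_of_nonneg_left (add_le_add_left (add_le_add_left hexit _) _)
    (by positivity))
  rw [← Finset.sum_add_distrib, ← Finset.sum_add_distrib, Finset.mul_sum]
  refine Finset.sum_le_sum fun k _ => ?_
  have hr := batchNoise_nonneg (d := d) k z
  have h2 : 0 ≤ if (σ : ℝ) ^ 2 * d / 2 ^ k ≤ b ^ 2 then 1 / b * batchNoise d k z ^ 2 else 0 := by
    split_ifs <;> positivity
  have h3 : 0 ≤ if 2 * batchThreshold d σ T k ≤ batchNoise d k z then batchNoise d k z else 0 := by
    split_ifs <;> positivity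
  by_cases hE : ExitsAt A σ T θ k z
  swap
  · rw [Finset.sum_eq_zero fun m _ => if_neg fun h => hE h.2.1, if_neg hE, zero_add]
    exact mul_nonneg (by positivity) (add_nonneg h2 h3)
  rw [if_pos hE]
  set B := batchNorm A θ k z with hB
  have hU := batchThreshold_nonneg d σ T k
  have hB0 : 0 < B := lt_of_le_of_lt (by positivity) hE.2
  have hm0 : 0 < repetitions A σ T θ k z := repetitions_pos hσ hT hE
  have hsum : ∑ m ∈ Finset.Icc 1 T,
      (if d * 2 ^ k ≤ T ∧ ExitsAt A σ T θ k z ∧ repetitions A σ T θ k z = m then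
        16 * ((σ : ℝ) ^ 2 * d / m) / b else 0) ≤
      16 * ((σ : ℝ) ^ 2 * d / repetitions A σ T θ k z) / b := by
    calc _ ≤ ∑ m ∈ Finset.Icc 1 T, (if repetitions A σ T θ k z = m then
          16 * ((σ : ℝ) ^ 2 * d / m) / b else 0) := by
          refine Finset.sum_le_sum fun m _ => ?_
          by_cases h : repetitions A σ T θ k z = m
          · rw [if_pos h]
            split_ifs
            · exact le_rfl
            · positivity
          · rw [if_neg h, if_neg fun h' => h h'.2.2]
      _ ≤ _ := by
          rw [Finset.sum_ite_eq]
          split_ifs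
          · exact le_rfl
          · positivity
  refine hsum.trans ?_
  have hrep : σ * √T / B ≤ (repetitions A σ T θ k z : ℝ) := Nat.le_ceil _
  calc 16 * ((σ : ℝ) ^ 2 * d / repetitions A σ T θ k z) / b
      ≤ 16 * ((σ : ℝ) ^ 2 * d / (σ * √T / B)) / b := by gcongr
    _ = 16 * (σ * d / √T) / b * B := by field_simp
    _ ≤ _ := by
      gcongr
      have hBle := batchNorm_le (θ := θ) hA k z
      rw [← hbdef, ← hB] at hBle
      have hv := variance_le_batchThreshold_sq (NeZero.pos d) hT σ k
      by_cases hUb : batchThreshold d σ T k ≤ b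
      · have : (σ : ℝ) ^ 2 * d / 2 ^ k ≤ b ^ 2 := hv.trans (by gcongr)
        rw [if_pos this]
        have h4 : batchNoise d k z ≤ b + 1 / b * batchNoise d k z ^ 2 := by
          have e : b + 1 / b * batchNoise d k z ^ 2 - batchNoise d k z
              = ((b - batchNoise d k z / 2) ^ 2 + 3 / 4 * batchNoise d k z ^ 2) / b := by
            field_simp
            ring
          have : 0 ≤ b + 1 / b * batchNoise d k z ^ 2 - batchNoise d k z := by
            rw [e]
            positivity
          linarith
        linarith
      · push Not at hUb
        have : 2 * batchThreshold d σ T k ≤ batchNoise d k z := by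
          have := hE.2
          linarith
        rw [if_pos this]
        linarith

open Classical in
-- The mean of the bound for B is at most 2b + 16b + 14b: the trivial part, the second moments over
-- variances below b², and the tails, whose sum 14σd/√T is at most 14b. Finally 16 · 32 = 512.
lemma integral_commit_cost_le (hA : A.PosDef) (hσ : 0 < σ) (hν : IsSubgaussianNoise σ ν)
    (hT : 0 < T) (hb : σ * d / √T < matNorm A θ) :
    Integrable (fun z => ∑ k ∈ Finset.range T, ∑ m ∈ Finset.Icc 1 T,
      if d * 2 ^ k ≤ T ∧ ExitsAt A σ T θ k z ∧ repetitions A σ T θ k z = m then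
        2 * euclNorm (blockMean d (2 ^ (k + 1) - 1) m z) ^ 2 / matNorm A θ else 0)
      (Measure.infinitePi ν) ∧
    ∫ z, (∑ k ∈ Finset.range T, ∑ m ∈ Finset.Icc 1 T,
      if d * 2 ^ k ≤ T ∧ ExitsAt A σ T θ k z ∧ repetitions A σ T θ k z = m then
        2 * euclNorm (blockMean d (2 ^ (k + 1) - 1) m z) ^ 2 / matNorm A θ else 0)
      ∂(Measure.infinitePi ν) ≤ 512 * (σ * d / √T) := by
  set b := matNorm A θ with hbdef
  have hb0 : 0 < b := lt_of_le_of_lt (by positivity) hb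
  have hd : (1 : ℝ) ≤ d := by exact_mod_cast NeZero.pos d
  have hσ' : (0 : ℝ) < σ := hσ
  have hT' : (0 : ℝ) < T := by exact_mod_cast hT
  have hterm := fun (k : ℕ) (m : ℕ) (hm : m ∈ Finset.Icc 1 T) =>
    integral_commit_term (A := A) (T := T) (θ := θ) hσ hν hb0 k (Finset.mem_Icc.1 hm).1
  have hi : ∀ k ∈ Finset.range T, Integrable (fun z => ∑ m ∈ Finset.Icc 1 T,
      if d * 2 ^ k ≤ T ∧ ExitsAt A σ T θ k z ∧ repetitions A σ T θ k z = m then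
        2 * euclNorm (blockMean d (2 ^ (k + 1) - 1) m z) ^ 2 / b else 0)
      (Measure.infinitePi ν) := fun k _ => integrable_finsetSum _ fun m hm => (hterm k m hm).1
  have hPm : ∀ k m, MeasurableSet {z | d * 2 ^ k ≤ T ∧ ExitsAt A σ T θ k z ∧
      repetitions A σ T θ k z = m} := fun k m => by
    refine (MeasurableSet.const _).inter ((measurableSet_exitsAt k).inter ?_)
    exact measurable_repetitions k (measurableSet_singleton m)
  have hj : ∀ k m, Integrable (fun z =>
      if d * 2 ^ k ≤ T ∧ ExitsAt A σ T θ k z ∧ repetitions A σ T θ k z = m then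
        16 * ((σ : ℝ) ^ 2 * d / m) / b else 0) (Measure.infinitePi ν) := fun k m => by
    refine Integrable.of_bound
      (Measurable.ite (hPm k m) measurable_const measurable_const).aestronglyMeasurable
      (16 * ((σ : ℝ) ^ 2 * d / m) / b) (ae_of_all _ fun z => ?_)
    have h0 : 0 ≤ 16 * ((σ : ℝ) ^ 2 * d / m) / b := by positivity
    split_ifs
    · rw [Real.norm_of_nonneg h0]
    · simpa using h0
  refine ⟨integrable_finsetSum _ hi, ?_⟩
  have hmom := integral_sum_ite_le (Finset.range T) (fun k => (σ : ℝ) ^ 2 * d / 2 ^ k ≤ b ^ 2)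
    (fun _ => 1 / b) (fun k => by positivity)
    (fun k z => batchNoise d k z ^ 2) _ (batchNoise_second_moment hσ hν)
  have htail := fun k => batchNoise_tail_moment (d := d) hσ hν hT k
  have htaili : Integrable (fun z => ∑ k ∈ Finset.range T,
      if 2 * batchThreshold d σ T k ≤ batchNoise d k z then batchNoise d k z else 0)
      (Measure.infinitePi ν) := integrable_finsetSum _ fun k _ => (htail k).1
  have hg := sum_geometric_inv_le (ρ := 2) (by norm_num) (a := (σ : ℝ) ^ 2 * d) (M := b ^ 2)
    (by positivity) (by positivity) T
  rw [two_div_two_sub_one] at hg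
  calc _ ≤ ∑ k ∈ Finset.range T, ∑ m ∈ Finset.Icc 1 T, ∫ z,
        (if d * 2 ^ k ≤ T ∧ ExitsAt A σ T θ k z ∧ repetitions A σ T θ k z = m then
          16 * ((σ : ℝ) ^ 2 * d / m) / b else 0) ∂(Measure.infinitePi ν) := by
        rw [integral_finsetSum _ hi]
        refine Finset.sum_le_sum fun k _ => ?_
        rw [integral_finsetSum _ fun m hm => (hterm k m hm).1]
        exact Finset.sum_le_sum fun m hm => (hterm k m hm).2
    _ = ∫ z, (∑ k ∈ Finset.range T, ∑ m ∈ Finset.Icc 1 T,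
        if d * 2 ^ k ≤ T ∧ ExitsAt A σ T θ k z ∧ repetitions A σ T θ k z = m then
          16 * ((σ : ℝ) ^ 2 * d / m) / b else 0) ∂(Measure.infinitePi ν) := by
        rw [integral_finsetSum _ fun k _ => integrable_finsetSum _ fun m _ => hj k m]
        refine Finset.sum_congr rfl fun k _ => ?_
        rw [integral_finsetSum _ fun m _ => hj k m]
    _ ≤ ∫ z, 16 * (σ * d / √T) / b * (2 * b +
        (∑ k ∈ Finset.range T, if (σ : ℝ) ^ 2 * d / 2 ^ k ≤ b ^ 2 then
          1 / b * batchNoise d k z ^ 2 else 0) +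
        ∑ k ∈ Finset.range T, if 2 * batchThreshold d σ T k ≤ batchNoise d k z
          then batchNoise d k z else 0) ∂(Measure.infinitePi ν) := by
        refine integral_mono
          (integrable_finsetSum _ fun k _ => integrable_finsetSum _ fun m _ => hj k m) ?_
          (commit_weight_le hA hσ hT hb)
        exact ((integral_const_add hmom.1 _).1.add htaili).const_mul _
    _ = 16 * (σ * d / √T) / b * (2 * b +
        (∫ z, (∑ k ∈ Finset.range T, if (σ : ℝ) ^ 2 * d / 2 ^ k ≤ b ^ 2 then
          1 / b * batchNoise d k z ^ 2 else 0) ∂(Measure.infinitePi ν)) +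
        ∑ k ∈ Finset.range T, ∫ z, (if 2 * batchThreshold d σ T k ≤ batchNoise d k z
          then batchNoise d k z else 0) ∂(Measure.infinitePi ν)) := by
        rw [integral_const_mul, integral_add (integral_const_add hmom.1 _).1 htaili,
          (integral_const_add hmom.1 _).2, integral_finsetSum _ fun k _ => (htail k).1]
    _ ≤ 16 * (σ * d / √T) / b * (2 * b + 16 * b + 14 * b) := by
        gcongr
        · refine hmom.2.trans ?_
          have e : ∀ k, (if (σ : ℝ) ^ 2 * d / 2 ^ k ≤ b ^ 2 then
              1 / b * (8 * ((σ : ℝ) ^ 2 * d / 2 ^ k)) else 0) = 8 / b *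
              (if (σ : ℝ) ^ 2 * d / 2 ^ k ≤ b ^ 2 then (σ : ℝ) ^ 2 * d / 2 ^ k else 0) :=
            fun k => by
              split_ifs
              · ring
              · simp
          simp only [e]
          rw [← Finset.mul_sum]
          calc _ ≤ 8 / b * (2 * b ^ 2) := by gcongr
            _ = 16 * b := by field_simp; norm_num
        · refine (Finset.sum_le_sum fun k _ => (htail k).2).trans ?_
          refine (sum_scale_mul_batchDelta_le (NeZero.pos d) hT hσ'.le T).trans ?_
          linarith
    _ = _ := by field_simp; norm_num

end Expectation

/-! ### The regret bound for E2TC -/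

section RegretBound

variable {d : ℕ} {A : Matrix (Fin d) (Fin d) ℝ} {σ : ℝ≥0} {T : ℕ} {θ : Fin d → ℝ}
  {ν : ℕ → Measure ℝ} [∀ t, IsProbabilityMeasure (ν t)]

lemma regret_le_two_mul (hA : A.PosDef)
    (𝒜 : Algorithm (ellipsoid A)) : regret 𝒜 θ ν T ≤ 2 * (T * matNorm A θ) := by
  have h : ∀ p : 𝒜.Seed × (ℕ → ℝ),
      ‖∑ t ∈ Finset.range T, (optimalAction A θ ⬝ᵥ θ - action 𝒜 θ p.1 p.2 t ⬝ᵥ θ)‖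
        ≤ 2 * (T * matNorm A θ) := by
    intro p
    refine (norm_sum_le _ _).trans ?_
    refine (Finset.sum_le_card_nsmul _ _ (2 * matNorm A θ) fun t _ => ?_).trans_eq ?_
    · have hx : action 𝒜 θ p.1 p.2 t ∈ ellipsoid A := 𝒜.act_mem _ _ _
      have h1 := dotProduct_le_matNorm hA hx θ
      have h2 := neg_matNorm_le_dotProduct hA hx θ
      rw [optimalAction_dotProduct_self hA, Real.norm_eq_abs, abs_le]
      constructor <;> linarith [matNorm_nonneg A θ]
    · simp
      ring
  have := norm_integral_le_of_norm_le_const (μ := 𝒜.law.prod (Measure.infinitePi ν))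
    (ae_of_all _ h)
  rw [probReal_univ, mul_one] at this
  exact (le_abs_self _).trans this

variable [NeZero d]

lemma regret_e2tc_eq (hA : A.PosDef) (α : ℝ) :
    regret (e2tc hA σ α T) θ ν T = ∫ z, ∑ t ∈ Finset.range T,
      (matNorm A θ - e2tcAction A σ α T t (exploreReward A θ z) ⬝ᵥ θ) ∂(Measure.infinitePi ν) := by
  have hm : Measurable (exploreReward A θ) := by
    refine measurable_pi_iff.2 fun t => ?_
    exact (measurable_pi_apply t).const_add _
  have hf : Measurable fun z : ℕ → ℝ => ∑ t ∈ Finset.range T,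
      (matNorm A θ - e2tcAction A σ α T t (exploreReward A θ z) ⬝ᵥ θ) := by
    refine Finset.measurable_fun_sum _ fun t _ => Measurable.const_sub ?_ _
    have h1 : Measurable fun z => e2tcAction A σ α T t (exploreReward A θ z) :=
      (measurable_e2tcAction A σ α T t).comp hm
    simp only [dotProduct]
    exact Finset.measurable_fun_sum _ fun i _ => ((measurable_pi_apply i).comp h1).mul_const _
  unfold regret
  simp only [action_e2tc hA, optimalAction_dotProduct_self hA]
  have hsnd : ((e2tc hA σ α T).law.prod (Measure.infinitePi ν)).map Prod.snd
      = Measure.infinitePi ν := by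
    rw [Measure.map_snd_prod, measure_univ, one_smul]
  conv_rhs => rw [← hsnd]
  rw [integral_map measurable_snd.aemeasurable hf.aestronglyMeasurable]

lemma regret_e2tc_le_of_lt (hA : A.PosDef) (hσ : 0 < σ) (hν : IsSubgaussianNoise σ ν)
    (hT : 0 < T) (hb : σ * d / √T < matNorm A θ) :
    regret (e2tc hA σ 3 T) θ ν T ≤ 9000 * (σ * d * √T + d * matNorm A θ) := by
  classical
  set b := matNorm A θ with hbdef
  have hb0 : 0 < b := lt_of_le_of_lt (by positivity) hb
  have hd : (1 : ℝ) ≤ d := by exact_mod_cast NeZero.pos d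
  have hσ' : (0 : ℝ) < σ := hσ
  have hT' : (0 : ℝ) < T := by exact_mod_cast hT
  rw [regret_e2tc_eq hA]
  have h1 := integral_warmup_bound_le (d := d) hσ hν hT hb
  have h2 := integral_exploration_bound_le (d := d) (T := T) hσ hν hb0
  have h3 := integral_commit_cost_le hA hσ hν hT hb
  rw [← hbdef] at h3
  set c0 : ℝ := 4 * b * ∑ k ∈ Finset.range T,
    (if (d : ℝ) * 2 ^ k ≤ 14 * σ * d * √T / b then (d : ℝ) * 2 ^ k else 0) with hc0
  have hc0le : c0 ≤ 112 * (σ * d * √T) := by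
    have hg := sum_geometric_le (ρ := 2) (by norm_num) (a := d) (M := 14 * σ * d * √T / b)
      (by positivity) (by positivity) T
    rw [two_div_two_sub_one] at hg
    calc c0 ≤ 4 * b * (2 * (14 * σ * d * √T / b)) := by
          rw [hc0]
          gcongr
      _ = _ := by field_simp; norm_num
  have hmono := integral_mono_of_nonneg (μ := Measure.infinitePi ν)
    (f := fun z => ∑ t ∈ Finset.range T,
      (b - e2tcAction A σ 3 T t (exploreReward A θ z) ⬝ᵥ θ))
    (ae_of_all _ fun z => Finset.sum_nonneg fun t _ => sub_nonneg.2
      (dotProduct_le_matNorm hA (e2tcAction_mem hA σ 3 T t (exploreReward A θ z)) θ))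
    (((integral_const_add h1.1 (2 * d * b + c0)).1.add
      (integral_const_add h2.1 (2 * d * b + 4 * (σ * d * √T))).1).add (h3.1.const_mul (T : ℝ)))
    (ae_of_all _ fun z => ?_)
  · refine hmono.trans ?_
    rw [integral_add' ((integral_const_add h1.1 _).1.add (integral_const_add h2.1 _).1)
      (h3.1.const_mul _), integral_add' (integral_const_add h1.1 _).1
      (integral_const_add h2.1 _).1, (integral_const_add h1.1 _).2,
      (integral_const_add h2.1 _).2, integral_const_mul]
    have h4 : (T : ℝ) * (512 * (σ * d / √T)) = 512 * (σ * d * √T) := by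
      have : (T : ℝ) = √T * √T := (Real.mul_self_sqrt hT'.le).symm
      rw [this]
      simp only [Real.sqrt_mul_self (Real.sqrt_nonneg _)]
      field_simp
    have h5 := mul_le_mul_of_nonneg_left h3.2 hT'.le
    rw [h4] at h5
    have h6 : (0 : ℝ) ≤ σ * d * √T := by positivity
    have h7 : (0 : ℝ) ≤ d * b := by positivity
    -- The coefficients of σd√T add up to 112 + 8192 + 4 + 75 + 512 = 8895, those of db to 4.
    linarith [h1.2, h2.2]
  · simp only [Pi.add_apply]
    refine (sum_regret_le hA hσ' hb0 z).trans ?_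
    have e1 := warmup_cost_le hA hσ hT hb z
    have e2 := exploration_cost_le hA hσ hT hb z
    rw [← hbdef] at e1 e2
    exact add_le_add (add_le_add e1 e2) le_rfl

theorem regret_e2tc_le (hA : A.PosDef) (hσ : 0 < σ) (hν : IsSubgaussianNoise σ ν)
    (θ : Fin d → ℝ) (T : ℕ) :
    regret (e2tc hA σ 3 T) θ ν T ≤
      9000 * min (σ * d * √T + d * matNorm A θ) (T * matNorm A θ) := by
  have hb := matNorm_nonneg A θ
  have htriv := regret_le_two_mul (T := T) (θ := θ) (ν := ν) hA (e2tc hA σ 3 T)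
  have h0 : 0 ≤ T * matNorm A θ := by positivity
  rw [mul_min_of_nonneg _ _ (by norm_num), le_min_iff]
  refine ⟨?_, htriv.trans (by linarith)⟩
  rcases Nat.eq_zero_or_pos T with rfl | hT
  · simp only [Nat.cast_zero, zero_mul, mul_zero] at htriv
    exact htriv.trans (by positivity)
  · rcases lt_or_ge (σ * d / √T) (matNorm A θ) with h | h
    · exact regret_e2tc_le_of_lt hA hσ hν hT h
    -- For a short θ, doing nothing useful is already good enough: Tb ≤ σd√T.
    · have hT' : (0 : ℝ) < T := by exact_mod_cast hT
      have h1 : T * matNorm A θ ≤ σ * d * √T := by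
        calc (T : ℝ) * matNorm A θ ≤ T * (σ * d / √T) := by gcongr
          _ = (√T * √T) * (σ * d / √T) := by rw [Real.mul_self_sqrt hT'.le]
          _ = _ := by field_simp
      have h2 : 0 ≤ d * matNorm A θ := by positivity
      have h3 : (0 : ℝ) ≤ σ * d * √T := by positivity
      linarith

end RegretBound

/-! ### Change of the mean-reward vector -/

section Trajectory

variable {d : ℕ} {X : Set (Fin d → ℝ)} (𝒜 : Algorithm X) (θ θ' : Fin d → ℝ)

/-- The rewards of the rounds before `t`. -/
def history (u : 𝒜.Seed) (z : ℕ → ℝ) (t : ℕ) : Fin t → ℝ := fun s => reward 𝒜 θ u z s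

lemma action_eq_act (u : 𝒜.Seed) (z : ℕ → ℝ) (t : ℕ) :
    action 𝒜 θ u z t = 𝒜.act t u (history 𝒜 θ u z t) := rfl

lemma history_succ (u : 𝒜.Seed) (z : ℕ → ℝ) (t : ℕ) :
    history 𝒜 θ u z (t + 1) = Fin.snoc (α := fun _ => ℝ) (history 𝒜 θ u z t)
      (𝒜.act t u (history 𝒜 θ u z t) ⬝ᵥ θ + z t) := by
  funext s
  refine Fin.lastCases ?_ (fun s => ?_) s
  · rw [Fin.snoc_last, ← action_eq_act, ← reward_eq]
    simp [history]
  · rw [Fin.snoc_castSucc]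
    simp [history]

lemma measurable_dotProduct_left {α : Type*} [MeasurableSpace α] {f : α → Fin d → ℝ}
    (hf : Measurable f) (v : Fin d → ℝ) : Measurable fun a => f a ⬝ᵥ v := by
  simp only [dotProduct]
  exact Finset.measurable_fun_sum _ fun i _ => ((measurable_pi_apply i).comp hf).mul_const _

lemma measurable_action_and_reward (t : ℕ) :
    (Measurable fun p : 𝒜.Seed × (ℕ → ℝ) => action 𝒜 θ p.1 p.2 t) ∧
      Measurable fun p : 𝒜.Seed × (ℕ → ℝ) => reward 𝒜 θ p.1 p.2 t := by
  induction t using Nat.strong_induction_on with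
  | _ t ih =>
    have ha : Measurable fun p : 𝒜.Seed × (ℕ → ℝ) => action 𝒜 θ p.1 p.2 t := by
      have hh : Measurable fun p : 𝒜.Seed × (ℕ → ℝ) => (p.1, history 𝒜 θ p.1 p.2 t) :=
        measurable_fst.prodMk (measurable_pi_iff.2 fun s => (ih s s.2).2)
      exact (𝒜.measurable_act t).comp hh
    refine ⟨ha, ?_⟩
    simp only [reward_eq]
    exact (measurable_dotProduct_left ha θ).add ((measurable_pi_apply t).comp measurable_snd)

lemma measurable_action (t : ℕ) :
    Measurable fun p : 𝒜.Seed × (ℕ → ℝ) => action 𝒜 θ p.1 p.2 t :=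
  (measurable_action_and_reward 𝒜 θ t).1

lemma measurable_action_seed (u : 𝒜.Seed) (t : ℕ) :
    Measurable fun z : ℕ → ℝ => action 𝒜 θ u z t :=
  (measurable_action 𝒜 θ t).comp measurable_prodMk_left

lemma measurable_history (u : 𝒜.Seed) (t : ℕ) : Measurable fun z => history 𝒜 θ u z t :=
  measurable_pi_iff.2 fun s =>
    (measurable_action_and_reward 𝒜 θ s).2.comp measurable_prodMk_left

lemma measurable_act_seed (u : 𝒜.Seed) (t : ℕ) : Measurable fun h => 𝒜.act t u h :=
  (𝒜.measurable_act t).comp measurable_prodMk_left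

lemma history_congr {u : 𝒜.Seed} {y z : ℕ → ℝ} {t : ℕ} (h : ∀ s < t, y s = z s) :
    history 𝒜 θ u y t = history 𝒜 θ u z t := by
  induction t with
  | zero => exact funext fun s => s.elim0
  | succ t ih =>
    rw [history_succ, history_succ, ih fun s hs => h s (by omega), h t (by omega)]

/-- The difference between the mean rewards of round `t` under `θ'` and `θ`. -/
def meanShift (u : 𝒜.Seed) (z : ℕ → ℝ) (t : ℕ) : ℝ := action 𝒜 θ u z t ⬝ᵥ (θ' - θ)

/-- The log-likelihood ratio between `θ'` and `θ` after `T` rounds with `N(0, v)` noise. -/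
def logLikelihood (v : ℝ) (u : 𝒜.Seed) (T : ℕ) (z : ℕ → ℝ) : ℝ :=
  ∑ t ∈ Finset.range T,
    (2 * z t * meanShift 𝒜 θ θ' u z t - meanShift 𝒜 θ θ' u z t ^ 2) / (2 * v)

lemma measurable_meanShift (u : 𝒜.Seed) (t : ℕ) : Measurable fun z => meanShift 𝒜 θ θ' u z t :=
  measurable_dotProduct_left (measurable_action_seed 𝒜 θ u t) _

lemma measurable_logLikelihood (v : ℝ) (u : 𝒜.Seed) (T : ℕ) :
    Measurable (logLikelihood 𝒜 θ θ' v u T) := by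
  refine Finset.measurable_fun_sum _ fun t _ => ?_
  have := measurable_meanShift 𝒜 θ θ' u t
  fun_prop

lemma meanShift_congr {u : 𝒜.Seed} {y z : ℕ → ℝ} {t : ℕ} (h : ∀ s < t, y s = z s) :
    meanShift 𝒜 θ θ' u y t = meanShift 𝒜 θ θ' u z t := by
  rw [meanShift, meanShift, action_eq_act, action_eq_act, history_congr 𝒜 θ h]

lemma logLikelihood_congr {v : ℝ} {u : 𝒜.Seed} {y z : ℕ → ℝ} {T : ℕ} (h : ∀ s < T, y s = z s) :
    logLikelihood 𝒜 θ θ' v u T y = logLikelihood 𝒜 θ θ' v u T z := by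
  refine Finset.sum_congr rfl fun t ht => ?_
  have ht : t < T := Finset.mem_range.1 ht
  rw [h t ht, meanShift_congr 𝒜 θ θ' fun s hs => h s (hs.trans ht)]

end Trajectory

/-! ### Likelihood ratio for an adaptive learner under Gaussian noise. -/

section Girsanov

variable {d : ℕ} {X : Set (Fin d → ℝ)} (𝒜 : Algorithm X) (θ θ' : Fin d → ℝ)

/-- The noise of a round is independent of the earlier noise. -/
lemma indepFun_eval_of_forall_lt {β : Type*} [MeasurableSpace β] {ν : ℕ → Measure ℝ}
    [∀ t, IsProbabilityMeasure (ν t)] {g : (ℕ → ℝ) → β} (hg : Measurable g) {T : ℕ}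
    (hdep : ∀ y z : ℕ → ℝ, (∀ s < T, y s = z s) → g y = g z) :
    IndepFun g (fun z => z T) (Measure.infinitePi ν) := by
  refine indepFun_of_dependsOn (S := Finset.range T) (R := {T}) (by simp) ?_ ?_ hg
    (measurable_pi_apply T)
  · exact fun y z h => hdep y z fun s hs => h s (by simpa using hs)
  · exact fun y z h => h T (by simp)

lemma lintegral_comp_eval {β : Type*} [MeasurableSpace β] {ν : ℕ → Measure ℝ}
    [∀ t, IsProbabilityMeasure (ν t)] {g : (ℕ → ℝ) → β} (hg : Measurable g) {T : ℕ}
    (hdep : ∀ y z : ℕ → ℝ, (∀ s < T, y s = z s) → g y = g z) {Φ : β × ℝ → ENNReal}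
    (hΦ : Measurable Φ) :
    ∫⁻ z, Φ (g z, z T) ∂(Measure.infinitePi ν) =
      ∫⁻ z, ∫⁻ ζ, Φ (g z, ζ) ∂(ν T) ∂(Measure.infinitePi ν) := by
  have hT : Measurable fun z : ℕ → ℝ => z T := measurable_pi_apply T
  have h := (indepFun_iff_map_prod_eq_prod_map_map hg.aemeasurable hT.aemeasurable).1
    (indepFun_eval_of_forall_lt (ν := ν) hg hdep)
  have hprob : IsProbabilityMeasure ((Measure.infinitePi ν).map g) :=
    Measure.isProbabilityMeasure_map hg.aemeasurable
  calc ∫⁻ z, Φ (g z, z T) ∂(Measure.infinitePi ν)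
      = ∫⁻ p, Φ p ∂((Measure.infinitePi ν).map fun z => (g z, z T)) :=
        (lintegral_map hΦ (hg.prodMk hT)).symm
    _ = ∫⁻ x, ∫⁻ ζ, Φ (x, ζ) ∂(ν T) ∂((Measure.infinitePi ν).map g) := by
        rw [h, Measure.infinitePi_map_eval ν T, lintegral_prod _ hΦ.aemeasurable]
    _ = _ := lintegral_map hΦ.lintegral_prod_right' hg

lemma lintegral_gaussianReal_shift {v : ℝ≥0} (hv : v ≠ 0) (δ : ℝ) {f : ℝ → ENNReal}
    (hf : Measurable f) :
    ∫⁻ ζ, f (δ + ζ) ∂(gaussianReal 0 v) =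
      ∫⁻ ζ, ENNReal.ofReal (Real.exp ((2 * ζ * δ - δ ^ 2) / (2 * v))) * f ζ
        ∂(gaussianReal 0 v) := by
  have h1 : ∫⁻ ζ, f (δ + ζ) ∂(gaussianReal 0 v) = ∫⁻ ζ, f ζ ∂(gaussianReal δ v) := by
    have := gaussianReal_map_const_add (μ := 0) (v := v) δ
    rw [zero_add] at this
    rw [← this, lintegral_map hf (measurable_const_add δ)]
  rw [h1, gaussianReal_of_var_ne_zero _ hv, gaussianReal_of_var_ne_zero _ hv,
    lintegral_withDensity_eq_lintegral_mul _ (measurable_gaussianPDF _ _) hf,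
    lintegral_withDensity_eq_lintegral_mul _ (measurable_gaussianPDF _ _) (by fun_prop)]
  refine lintegral_congr fun ζ => ?_
  simp only [Pi.mul_apply, ← mul_assoc]
  congr 1
  rw [gaussianPDF, gaussianPDF, ← ENNReal.ofReal_mul (gaussianPDFReal_nonneg _ _ _)]
  congr 1
  rw [gaussianPDFReal, gaussianPDFReal, mul_assoc (√(2 * Real.pi * v))⁻¹, ← Real.exp_add]
  congr 2
  have : (v : ℝ) ≠ 0 := by exact_mod_cast hv
  field_simp
  ring

lemma measurable_snoc {α : Type*} [MeasurableSpace α] {T : ℕ} {f : α → Fin T → ℝ} {g : α → ℝ}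
    (hf : Measurable f) (hg : Measurable g) :
    Measurable fun a => (Fin.snoc (α := fun _ => ℝ) (f a) (g a) : Fin (T + 1) → ℝ) := by
  refine measurable_pi_iff.2 fun s => ?_
  refine Fin.lastCases ?_ (fun s => ?_) s
  · simpa using hg
  · simpa [Function.comp_def] using (measurable_pi_apply s).comp hf

/-- The law of the rewards under `θ'` has density `exp (logLikelihood)` with respect to their law
under `θ`. -/
theorem lintegral_history_eq {v : ℝ≥0} (hv : v ≠ 0) (u : 𝒜.Seed) (T : ℕ)
    {F : (Fin T → ℝ) → ENNReal} (hF : Measurable F) :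
    ∫⁻ z, F (history 𝒜 θ' u z T) ∂(Measure.infinitePi fun _ => gaussianReal 0 v) =
      ∫⁻ z, ENNReal.ofReal (Real.exp (logLikelihood 𝒜 θ θ' v u T z)) *
        F (history 𝒜 θ u z T) ∂(Measure.infinitePi fun _ => gaussianReal 0 v) := by
  induction T with
  | zero =>
    have : ∀ z, history 𝒜 θ' u z 0 = history 𝒜 θ u z 0 := fun z => funext fun s => s.elim0
    simp [this, logLikelihood]
  | succ T ih =>
    have hact := measurable_act_seed 𝒜 u T
    have hθ := measurable_dotProduct_left hact θ
    have hθ' := measurable_dotProduct_left hact θ'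
    have hδ := measurable_dotProduct_left hact (θ' - θ)
    simp only [history_succ]
    have hΦ' : Measurable fun p : (Fin T → ℝ) × ℝ =>
        F (Fin.snoc (α := fun _ => ℝ) p.1 (𝒜.act T u p.1 ⬝ᵥ θ' + p.2)) :=
      hF.comp (measurable_snoc measurable_fst ((hθ'.comp measurable_fst).add measurable_snd))
    -- The last noise variable is integrated out; the induction hypothesis changes θ' into θ in the
    -- past, and a Gaussian shift by the mean difference then does so in the last reward.
    rw [lintegral_comp_eval (ν := fun _ => gaussianReal 0 v) (measurable_history 𝒜 θ' u T)
      (fun y z h => history_congr 𝒜 θ' h) hΦ']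
    have hG : Measurable fun h : Fin T → ℝ => ∫⁻ ζ,
        F (Fin.snoc (α := fun _ => ℝ) h (𝒜.act T u h ⬝ᵥ θ' + ζ)) ∂(gaussianReal 0 v) :=
      hΦ'.lintegral_prod_right'
    refine (ih hG).trans ?_
    set g : (ℕ → ℝ) → ℝ × (Fin T → ℝ) := fun z =>
      (logLikelihood 𝒜 θ θ' v u T z, history 𝒜 θ u z T) with hg
    have hgm : Measurable g :=
      (measurable_logLikelihood 𝒜 θ θ' v u T).prodMk (measurable_history 𝒜 θ u T)
    set Φ : (ℝ × (Fin T → ℝ)) × ℝ → ENNReal := fun p =>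
      ENNReal.ofReal (Real.exp (p.1.1 + (2 * p.2 * (𝒜.act T u p.1.2 ⬝ᵥ (θ' - θ))
        - (𝒜.act T u p.1.2 ⬝ᵥ (θ' - θ)) ^ 2) / (2 * v))) *
      F (Fin.snoc (α := fun _ => ℝ) p.1.2 (𝒜.act T u p.1.2 ⬝ᵥ θ + p.2)) with hΦdef
    have hp : Measurable fun p : (ℝ × (Fin T → ℝ)) × ℝ => p.1.2 :=
      measurable_snd.comp measurable_fst
    have hδp : Measurable fun p : (ℝ × (Fin T → ℝ)) × ℝ => 𝒜.act T u p.1.2 ⬝ᵥ (θ' - θ) :=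
      hδ.comp hp
    have hΦ : Measurable Φ := by
      refine Measurable.mul ?_
        (hF.comp (measurable_snoc hp ((hθ.comp hp).add measurable_snd)))
      fun_prop
    have hrhs : ∀ z : ℕ → ℝ, ENNReal.ofReal (Real.exp (logLikelihood 𝒜 θ θ' v u (T + 1) z)) *
        F (Fin.snoc (α := fun _ => ℝ) (history 𝒜 θ u z T)
          (𝒜.act T u (history 𝒜 θ u z T) ⬝ᵥ θ + z T)) = Φ (g z, z T) := by
      intro z
      simp only [hΦdef, hg, logLikelihood, Finset.sum_range_succ, meanShift, action_eq_act]
    simp only [hrhs]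
    rw [lintegral_comp_eval (ν := fun _ => gaussianReal 0 v) hgm
      (fun y z h => by simp only [hg, history_congr 𝒜 θ h, logLikelihood_congr 𝒜 θ θ' h]) hΦ]
    refine lintegral_congr fun z => ?_
    simp only [hΦdef, hg]
    set h := history 𝒜 θ u z T
    have hf : Measurable fun ζ : ℝ => F (Fin.snoc (α := fun _ => ℝ) h (𝒜.act T u h ⬝ᵥ θ + ζ)) :=
      hF.comp (measurable_snoc measurable_const (measurable_const.add measurable_id))
    have hshift := lintegral_gaussianReal_shift hv (𝒜.act T u h ⬝ᵥ (θ' - θ)) hf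
    have e : ∀ ζ, 𝒜.act T u h ⬝ᵥ θ + (𝒜.act T u h ⬝ᵥ (θ' - θ) + ζ) = 𝒜.act T u h ⬝ᵥ θ' + ζ := by
      intro ζ
      rw [dotProduct_sub]
      ring
    simp only [e] at hshift
    rw [hshift, ← lintegral_const_mul' _ _ ENNReal.ofReal_ne_top]
    refine lintegral_congr fun ζ => ?_
    rw [Real.exp_add, ENNReal.ofReal_mul (Real.exp_pos _).le]
    exact (mul_assoc _ _ _).symm

end Girsanov

/-! ### Two-point testing bound. -/

section TwoPoint

variable {d : ℕ} {A : Matrix (Fin d) (Fin d) ℝ} (𝒜 : Algorithm (ellipsoid A))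
  (θ θ' : Fin d → ℝ)

/-- The affine overlap of two measures is the mean of min(1, e^x), x being the log-likelihood ratio.
The lower bound involves only x and e^x, both with explicit means. It follows from x ≤ 2(s - 1) with
s = e^{x/2}, and from the squares (s - 2)² and (2s - 1)². -/
lemma one_add_log_le_min_exp (x : ℝ) :
    1 + 2 / 3 * x - 1 / 3 * Real.exp x ≤ min 1 (Real.exp x) := by
  have h := Real.add_one_le_exp (x / 2)
  have e : Real.exp x = Real.exp (x / 2) ^ 2 := by
    rw [← Real.exp_nat_mul]
    congr 1
    push_cast
    ring
  rw [e]
  set s := Real.exp (x / 2)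
  refine le_min ?_ ?_
  · nlinarith [sq_nonneg (s - 2)]
  · nlinarith [sq_nonneg (2 * s - 1)]

lemma abs_meanShift_le (hA : A.PosDef) (u : 𝒜.Seed) (z : ℕ → ℝ) (t : ℕ) :
    |meanShift 𝒜 θ θ' u z t| ≤ matNorm A (θ' - θ) := by
  have hx : action 𝒜 θ u z t ∈ ellipsoid A := 𝒜.act_mem _ _ _
  exact abs_le.2 ⟨neg_matNorm_le_dotProduct hA hx _, dotProduct_le_matNorm hA hx _⟩

variable {σ : ℝ≥0}

lemma integrable_meanShift_sq (hA : A.PosDef) (u : 𝒜.Seed) (t : ℕ) :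
    Integrable (fun z => meanShift 𝒜 θ θ' u z t ^ 2)
      (Measure.infinitePi fun _ : ℕ => gaussianReal 0 (σ ^ 2)) := by
  refine Integrable.of_bound ((measurable_meanShift 𝒜 θ θ' u t).pow_const 2).aestronglyMeasurable
    (matNorm A (θ' - θ) ^ 2) (ae_of_all _ fun z => ?_)
  rw [Real.norm_eq_abs, abs_pow]
  exact pow_le_pow_left₀ (abs_nonneg _) (abs_meanShift_le 𝒜 θ θ' hA u z t) 2

lemma integrable_eval_gaussian (t : ℕ) : Integrable (fun z : ℕ → ℝ => z t)
    (Measure.infinitePi fun _ : ℕ => gaussianReal 0 (σ ^ 2)) := by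
  have h := (measurePreserving_eval_infinitePi
    (fun _ : ℕ => gaussianReal 0 (σ ^ 2)) t).integrable_comp_of_integrable (g := fun x => x)
    (by
      have : MemLp id 1 (gaussianReal 0 (σ ^ 2)) := by
        simpa using memLp_id_gaussianReal (μ := 0) (v := σ ^ 2) 1
      exact memLp_one_iff_integrable.1 this)
  exact h

lemma integral_eval_gaussian (t : ℕ) :
    ∫ z, z t ∂(Measure.infinitePi fun _ : ℕ => gaussianReal 0 (σ ^ 2)) = 0 := by
  have h := integral_map (μ := Measure.infinitePi fun _ : ℕ => gaussianReal 0 (σ ^ 2))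
    (φ := fun z : ℕ → ℝ => z t) (f := fun x : ℝ => x) (measurable_pi_apply t).aemeasurable
    (by fun_prop)
  rw [← h, Measure.infinitePi_map_eval (fun _ : ℕ => gaussianReal 0 (σ ^ 2)) t,
    integral_id_gaussianReal]

/-- The mean shift of a round depends on the past only, so it is independent of the centered noise
of that round and the cross terms vanish. -/
lemma integral_logLikelihood (hA : A.PosDef) (u : 𝒜.Seed) (T : ℕ) :
    Integrable (logLikelihood 𝒜 θ θ' (σ ^ 2) u T)
      (Measure.infinitePi fun _ : ℕ => gaussianReal 0 (σ ^ 2)) ∧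
    ∫ z, logLikelihood 𝒜 θ θ' (σ ^ 2) u T z
        ∂(Measure.infinitePi fun _ : ℕ => gaussianReal 0 (σ ^ 2)) =
      -(∫ z, (∑ t ∈ Finset.range T, meanShift 𝒜 θ θ' u z t ^ 2)
        ∂(Measure.infinitePi fun _ : ℕ => gaussianReal 0 (σ ^ 2))) / (2 * σ ^ 2) := by
  have hind : ∀ t, IndepFun (fun z => meanShift 𝒜 θ θ' u z t) (fun z : ℕ → ℝ => z t)
      (Measure.infinitePi fun _ : ℕ => gaussianReal 0 (σ ^ 2)) := fun t =>
    indepFun_eval_of_forall_lt (measurable_meanShift 𝒜 θ θ' u t)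
      fun y z h => meanShift_congr 𝒜 θ θ' h
  have hint : ∀ t, Integrable (fun z => meanShift 𝒜 θ θ' u z t)
      (Measure.infinitePi fun _ : ℕ => gaussianReal 0 (σ ^ 2)) := fun t =>
    Integrable.of_bound (measurable_meanShift 𝒜 θ θ' u t).aestronglyMeasurable
      (matNorm A (θ' - θ)) (ae_of_all _ fun z => abs_meanShift_le 𝒜 θ θ' hA u z t)
  have hmul : ∀ t, Integrable (fun z : ℕ → ℝ => meanShift 𝒜 θ θ' u z t * z t)
      (Measure.infinitePi fun _ : ℕ => gaussianReal 0 (σ ^ 2)) := fun t =>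
    (hind t).integrable_mul (hint t) (integrable_eval_gaussian t)
  have hzero : ∀ t, ∫ z : ℕ → ℝ, meanShift 𝒜 θ θ' u z t * z t
      ∂(Measure.infinitePi fun _ : ℕ => gaussianReal 0 (σ ^ 2)) = 0 := fun t => by
    rw [(hind t).integral_fun_mul_eq_mul_integral (hint t).aestronglyMeasurable
      (integrable_eval_gaussian t).aestronglyMeasurable, integral_eval_gaussian, mul_zero]
  have hsq := fun t => integrable_meanShift_sq (σ := σ) 𝒜 θ θ' hA u t
  have e : ∀ z, logLikelihood 𝒜 θ θ' (σ ^ 2) u T z = ∑ t ∈ Finset.range T,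
      (1 / (σ : ℝ) ^ 2 * (meanShift 𝒜 θ θ' u z t * z t)
        - 1 / (2 * (σ : ℝ) ^ 2) * meanShift 𝒜 θ θ' u z t ^ 2) := fun z =>
    Finset.sum_congr rfl fun t _ => by ring
  have hterm : ∀ t ∈ Finset.range T, Integrable (fun z : ℕ → ℝ =>
      1 / (σ : ℝ) ^ 2 * (meanShift 𝒜 θ θ' u z t * z t)
        - 1 / (2 * (σ : ℝ) ^ 2) * meanShift 𝒜 θ θ' u z t ^ 2)
      (Measure.infinitePi fun _ : ℕ => gaussianReal 0 (σ ^ 2)) := fun t _ =>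
    ((hmul t).const_mul _).sub ((hsq t).const_mul _)
  refine ⟨(integrable_finsetSum _ hterm).congr (ae_of_all _ fun z => (e z).symm), ?_⟩
  simp only [e]
  rw [integral_finsetSum _ hterm, integral_finsetSum _ fun t _ => hsq t, neg_div,
    Finset.sum_div, ← Finset.sum_neg_distrib]
  refine Finset.sum_congr rfl fun t _ => ?_
  rw [integral_sub ((hmul t).const_mul _) ((hsq t).const_mul _), integral_const_mul,
    integral_const_mul, hzero]
  ring

/-- Two mean-reward vectors cannot be told apart by a learner whose actions carry little
information about their difference. -/
theorem two_point_lower_bound (hA : A.PosDef) (hσ : 0 < σ) (u : 𝒜.Seed) (T : ℕ)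
    {g : (Fin T → ℝ) → ℝ} (hg : Measurable g) {c : ℝ} (hg0 : ∀ h, 0 ≤ g h) (hgc : ∀ h, g h ≤ c) :
    c * (2 / 3 - 1 / (3 * σ ^ 2) * ∫ z, (∑ t ∈ Finset.range T, meanShift 𝒜 θ θ' u z t ^ 2)
        ∂(Measure.infinitePi fun _ : ℕ => gaussianReal 0 (σ ^ 2))) ≤
      ∫ z, g (history 𝒜 θ u z T) ∂(Measure.infinitePi fun _ : ℕ => gaussianReal 0 (σ ^ 2)) +
      ∫ z, (c - g (history 𝒜 θ' u z T))
        ∂(Measure.infinitePi fun _ : ℕ => gaussianReal 0 (σ ^ 2)) := by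
  set μ := Measure.infinitePi fun _ : ℕ => gaussianReal 0 (σ ^ 2) with hμ
  have hv : σ ^ 2 ≠ 0 := (pow_pos hσ 2).ne'
  have hc : 0 ≤ c := (hg0 0).trans (hgc 0)
  set ℓ := logLikelihood 𝒜 θ θ' (σ ^ 2) u T with hℓ
  have hℓm : Measurable ℓ := measurable_logLikelihood 𝒜 θ θ' _ u T
  have hgm : Measurable fun z => g (history 𝒜 θ u z T) := hg.comp (measurable_history 𝒜 θ u T)
  have hgm' : Measurable fun z => g (history 𝒜 θ' u z T) := hg.comp (measurable_history 𝒜 θ' u T)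
  have hone : ∫⁻ z, ENNReal.ofReal (Real.exp (ℓ z)) ∂μ = 1 := by
    have h := lintegral_history_eq 𝒜 θ θ' hv u T (F := fun _ => 1) measurable_const
    simp only [NNReal.coe_pow, mul_one, lintegral_const, measure_univ] at h
    exact h.symm
  have hexpi : Integrable (fun z => Real.exp (ℓ z)) μ :=
    ⟨hℓm.exp.aestronglyMeasurable, by
      rw [hasFiniteIntegral_iff_ofReal (ae_of_all _ fun _ => (Real.exp_pos _).le), hone]
      exact ENNReal.one_lt_top⟩
  have hexp1 : ∫ z, Real.exp (ℓ z) ∂μ = 1 := by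
    rw [integral_eq_lintegral_of_nonneg_ae (ae_of_all _ fun _ => (Real.exp_pos _).le)
      hℓm.exp.aestronglyMeasurable, hone]
    simp
  have hchange : ∫ z, (c - g (history 𝒜 θ' u z T)) ∂μ
      = ∫ z, Real.exp (ℓ z) * (c - g (history 𝒜 θ u z T)) ∂μ := by
    rw [integral_eq_lintegral_of_nonneg_ae (ae_of_all _ fun z => sub_nonneg.2 (hgc _))
        (hgm'.const_sub c).aestronglyMeasurable,
      integral_eq_lintegral_of_nonneg_ae
        (ae_of_all _ fun z => mul_nonneg (Real.exp_pos _).le (sub_nonneg.2 (hgc _)))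
        (hℓm.exp.mul (hgm.const_sub c)).aestronglyMeasurable]
    have h := lintegral_history_eq 𝒜 θ θ' hv u T (F := fun h => ENNReal.ofReal (c - g h))
      (hg.const_sub c).ennreal_ofReal
    rw [h]
    simp only [NNReal.coe_pow, ← ENNReal.ofReal_mul (Real.exp_pos _).le]
    rfl
  have hgi : Integrable (fun z => g (history 𝒜 θ u z T)) μ :=
    Integrable.of_bound hgm.aestronglyMeasurable c (ae_of_all _ fun z => by
      rw [Real.norm_of_nonneg (hg0 _)]
      exact hgc _)
  have hprodi : Integrable (fun z => Real.exp (ℓ z) * (c - g (history 𝒜 θ u z T))) μ := by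
    refine (hexpi.mul_const c).mono' (hℓm.exp.mul (hgm.const_sub c)).aestronglyMeasurable
      (ae_of_all _ fun z => ?_)
    rw [Real.norm_of_nonneg (mul_nonneg (Real.exp_pos _).le (sub_nonneg.2 (hgc _)))]
    exact mul_le_mul_of_nonneg_left (by linarith [hg0 (history 𝒜 θ u z T)]) (Real.exp_pos _).le
  have hℓi := integral_logLikelihood (σ := σ) 𝒜 θ θ' hA u T
  -- A combination g·1 + (c - g)·e^ℓ with nonnegative weights of sum c is at least c·min(1, e^ℓ). In
  -- the mean, e^ℓ contributes exactly 1, which leaves 1 - 1/3 = 2/3.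
  have hlow : ∀ z, c * (1 + 2 / 3 * ℓ z - 1 / 3 * Real.exp (ℓ z)) ≤
      g (history 𝒜 θ u z T) + Real.exp (ℓ z) * (c - g (history 𝒜 θ u z T)) := fun z => by
    have h := one_add_log_le_min_exp (ℓ z)
    have h1 := h.trans (min_le_left _ _)
    have h2 := h.trans (min_le_right _ _)
    have h3 := mul_le_mul_of_nonneg_left h1 (hg0 (history 𝒜 θ u z T))
    have h4 := mul_le_mul_of_nonneg_right h2 (sub_nonneg.2 (hgc (history 𝒜 θ u z T)))
    linarith
  have hi1 : Integrable (fun z => 1 + 2 / 3 * ℓ z) μ :=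
    (integral_const_add (hℓi.1.const_mul (2 / 3)) 1).1
  rw [hchange, ← integral_add hgi hprodi]
  refine le_trans (le_of_eq ?_) (integral_mono ((hi1.sub (hexpi.const_mul (1 / 3))).const_mul c)
    (hgi.add hprodi) hlow)
  rw [integral_const_mul, integral_sub' hi1 (hexpi.const_mul (1 / 3)),
    (integral_const_add (hℓi.1.const_mul (2 / 3)) 1).2, integral_const_mul, integral_const_mul,
    hℓi.2, hexp1]
  ring

end TwoPoint

/-! ### A lower bound over a hypercube of mean-reward vectors -/

lemma exists_orthonormal_orthogonal {d : ℕ} {φ : Fin d → ℝ} (hφ : φ ≠ 0) :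
    ∃ n, n + 1 = d ∧ ∃ e : Fin n → Fin d → ℝ,
      (∀ i j, e i ⬝ᵥ e j = if i = j then 1 else 0) ∧ ∀ i, φ ⬝ᵥ e i = 0 := by
  obtain ⟨m, rfl⟩ : ∃ m, d = m + 1 := by
    rcases d with _ | m
    · exact absurd (Subsingleton.elim φ 0) hφ
    · exact ⟨m, rfl⟩
  set x : EuclideanSpace ℝ (Fin (m + 1)) := WithLp.toLp 2 φ with hx
  have hx0 : x ≠ 0 := fun h => hφ (by simpa [hx] using h)
  have : Fact (Module.finrank ℝ (EuclideanSpace ℝ (Fin (m + 1))) = m + 1) := ⟨by simp⟩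
  have hfr : Module.finrank ℝ (ℝ ∙ x)ᗮ = m := Submodule.finrank_orthogonal_span_singleton hx0
  set B := (stdOrthonormalBasis ℝ (ℝ ∙ x)ᗮ).reindex (finCongr hfr) with hB
  refine ⟨m, rfl, fun i => WithLp.ofLp (B i : EuclideanSpace ℝ (Fin (m + 1))), fun i j => ?_,
    fun i => ?_⟩
  · have h := orthonormal_iff_ite.1 B.orthonormal j i
    rw [Submodule.coe_inner, EuclideanSpace.inner_eq_star_dotProduct] at h
    simpa [eq_comm] using h
  · have h := Submodule.mem_orthogonal_singleton_iff_inner_right.1 (B i).2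
    rw [EuclideanSpace.inner_eq_star_dotProduct] at h
    rw [dotProduct_comm]
    simpa [hx] using h

/-- Bessel's inequality. -/
lemma sum_dotProduct_sq_le {d : ℕ} {ι : Type*} [Fintype ι] [DecidableEq ι] {e : ι → Fin d → ℝ}
    (he : ∀ i j, e i ⬝ᵥ e j = if i = j then 1 else 0) (y : Fin d → ℝ) :
    ∑ j, (y ⬝ᵥ e j) ^ 2 ≤ y ⬝ᵥ y := by
  set p := ∑ j, (y ⬝ᵥ e j) • e j with hp
  have h1 : y ⬝ᵥ p = ∑ j, (y ⬝ᵥ e j) ^ 2 := by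
    rw [hp, dotProduct_sum]
    simp [dotProduct_smul, pow_two]
  have h2 : p ⬝ᵥ p = ∑ j, (y ⬝ᵥ e j) ^ 2 := by
    have : ∀ j, p ⬝ᵥ e j = y ⬝ᵥ e j := fun j => by
      rw [hp, sum_dotProduct]
      simp [smul_dotProduct, he]
    conv_lhs => rw [hp]
    rw [dotProduct_sum, ← hp]
    simp [dotProduct_smul, this, pow_two]
  have h := dotProduct_self_nonneg' (y - p)
  rw [sub_dotProduct, dotProduct_sub, dotProduct_sub, dotProduct_comm p y, h1, h2] at h
  linarith

/-- Averaging over the hypercube: if the two values of each summand along each edge add up to at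
least `a`, then at some vertex the sum is at least half of `a` per summand. -/
lemma exists_vertex_le_sum {ι : Type*} [Fintype ι] [DecidableEq ι] {F : ι → (ι → Bool) → ℝ} {a : ℝ}
    (h : ∀ j ε, a ≤ F j (Function.update ε j false) + F j (Function.update ε j true)) :
    ∃ ε, Fintype.card ι * (a / 2) ≤ ∑ j, F j ε := by
  have hflip : ∀ j ε, a ≤ F j ε + F j (Function.update ε j (!ε j)) := fun j ε => by
    have := h j ε
    rcases hε : ε j with _ | _
    · rw [← hε, Function.update_eq_self] at this
      simpa using this
    · rw [add_comm, ← hε, Function.update_eq_self] at this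
      simpa using this
  have hsum : ∀ j, ∑ ε, F j (Function.update ε j (!ε j)) = ∑ ε, F j ε := fun j => by
    have hinv : Function.Involutive fun ε : ι → Bool => Function.update ε j (!ε j) := fun ε => by
      simp
    exact Equiv.sum_comp hinv.toPerm (F j)
  -- Flipping coordinate j permutes the vertices, so summing the edge inequality over all vertices
  -- counts the sum of F j twice.
  have hj : ∀ j, ∑ _ε : ι → Bool, a / 2 ≤ ∑ ε, F j ε := fun j => by
    have h1 := Finset.sum_le_sum fun ε (_ : ε ∈ Finset.univ) => hflip j ε
    rw [Finset.sum_add_distrib, hsum] at h1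
    rw [← Finset.sum_div]
    linarith
  have htot : ∑ _ε : ι → Bool, Fintype.card ι * (a / 2) ≤ ∑ ε, ∑ j, F j ε := by
    rw [Finset.sum_comm]
    calc ∑ _ε : ι → Bool, Fintype.card ι * (a / 2) = ∑ _j : ι, ∑ _ε : ι → Bool, a / 2 := by
          simp
          ring
      _ ≤ _ := Finset.sum_le_sum fun j _ => hj j
  obtain ⟨ε, -, hε⟩ := Finset.exists_le_of_sum_le Finset.univ_nonempty htot
  exact ⟨ε, hε⟩

/-! ### Regret as a squared distance to the optimal action. -/

section Lower

variable {d : ℕ} {A : Matrix (Fin d) (Fin d) ℝ} (𝒜 : Algorithm (ellipsoid A))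

lemma abs_action_dotProduct_le (hA : A.PosDef) (θ : Fin d → ℝ) (u : 𝒜.Seed) (z : ℕ → ℝ) (t : ℕ)
    (v : Fin d → ℝ) : |action 𝒜 θ u z t ⬝ᵥ v| ≤ matNorm A v :=
  abs_le.2 ⟨neg_matNorm_le_dotProduct hA (𝒜.act_mem _ _ _) v,
    dotProduct_le_matNorm hA (𝒜.act_mem _ _ _) v⟩

lemma integrable_comp_action_dotProduct (hA : A.PosDef) (θ v : Fin d → ℝ) (T : ℕ)
    (ν : ℕ → Measure ℝ) [∀ t, IsProbabilityMeasure (ν t)] {f : ℝ → ℝ} (hf : Measurable f) {c : ℝ}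
    (hc : ∀ x, |x| ≤ matNorm A v → |f x| ≤ c) :
    Integrable (fun p : 𝒜.Seed × (ℕ → ℝ) =>
      ∑ t ∈ Finset.range T, f (action 𝒜 θ p.1 p.2 t ⬝ᵥ v))
      (𝒜.law.prod (Measure.infinitePi ν)) :=
  integrable_finsetSum _ fun t _ => Integrable.of_bound
    (hf.comp (measurable_dotProduct_left (measurable_action 𝒜 θ t) v)).aestronglyMeasurable c
    (ae_of_all _ fun p => hc _ (abs_action_dotProduct_le 𝒜 hA θ p.1 p.2 t v))

lemma integrable_sum_sub_sq (hA : A.PosDef) (θ v : Fin d → ℝ) (T : ℕ)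
    (ν : ℕ → Measure ℝ) [∀ t, IsProbabilityMeasure (ν t)] (a : ℝ) :
    Integrable (fun p : 𝒜.Seed × (ℕ → ℝ) =>
      ∑ t ∈ Finset.range T, (action 𝒜 θ p.1 p.2 t ⬝ᵥ v - a) ^ 2)
      (𝒜.law.prod (Measure.infinitePi ν)) :=
  integrable_comp_action_dotProduct 𝒜 hA θ v T ν (f := fun x => (x - a) ^ 2) (by fun_prop)
    (c := (matNorm A v + |a|) ^ 2) fun x hx => by
      rw [abs_pow]
      exact pow_le_pow_left₀ (abs_nonneg _) ((abs_sub _ _).trans (by linarith)) 2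

/-- The regret of an action dominates its squared distance to the optimal action. -/
lemma sum_sq_le_matNorm_sub (hA : A.PosDef) {θ x : Fin d → ℝ} (hθ : 0 < matNorm A θ)
    (hx : x ∈ ellipsoid A) {ι : Type*} [Fintype ι] [DecidableEq ι] {v : ι → Fin d → ℝ}
    (hv : ∀ i j, (CFC.sqrt A *ᵥ v i) ⬝ᵥ (CFC.sqrt A *ᵥ v j) = if i = j then 1 else 0) :
    matNorm A θ / 2 * ∑ j, (x ⬝ᵥ v j
      - (CFC.sqrt A *ᵥ θ) ⬝ᵥ (CFC.sqrt A *ᵥ v j) / matNorm A θ) ^ 2 ≤ matNorm A θ - x ⬝ᵥ θ := by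
  set S := CFC.sqrt A with hS
  set r := matNorm A θ with hr
  set w := S⁻¹ *ᵥ x with hw
  have hSw : S *ᵥ w = x := sqrt_mulVec_inv_mulVec hA x
  have hx1 : w ⬝ᵥ w ≤ 1 := by
    rw [← euclNorm_sq]
    exact pow_le_one₀ (euclNorm_nonneg _) (euclNorm_inv_mulVec_le hA hx)
  have hr2 : (S *ᵥ θ) ⬝ᵥ (S *ᵥ θ) = r ^ 2 := by
    rw [hr, matNorm_eq_euclNorm hA, euclNorm_sq]
  have hxw : ∀ y, w ⬝ᵥ (S *ᵥ y) = x ⬝ᵥ y := fun y => by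
    rw [← sqrt_mulVec_dotProduct, ← hS, hSw]
  -- In the unit ball |w - φ/r|² ≤ 2 - 2⟨w, φ⟩/r with r = |φ|, which is 2/r times the regret of the
  -- action.
  have hB := sum_dotProduct_sq_le hv (w - r⁻¹ • (S *ᵥ θ))
  have e1 : ∀ j, (w - r⁻¹ • (S *ᵥ θ)) ⬝ᵥ (S *ᵥ v j)
      = x ⬝ᵥ v j - (S *ᵥ θ) ⬝ᵥ (S *ᵥ v j) / r := fun j => by
    rw [sub_dotProduct, smul_dotProduct, hxw, smul_eq_mul, inv_mul_eq_div]
  have e2 : (w - r⁻¹ • (S *ᵥ θ)) ⬝ᵥ (w - r⁻¹ • (S *ᵥ θ)) = w ⬝ᵥ w - 2 * (x ⬝ᵥ θ) / r + 1 := by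
    rw [sub_dotProduct, dotProduct_sub, dotProduct_sub, smul_dotProduct, smul_dotProduct,
      dotProduct_smul, dotProduct_smul, dotProduct_comm (S *ᵥ θ) w, hxw, hr2]
    simp only [smul_eq_mul]
    field_simp
    ring
  simp only [e1, e2] at hB
  calc _ ≤ r / 2 * (w ⬝ᵥ w - 2 * (x ⬝ᵥ θ) / r + 1) := by gcongr
    _ ≤ r / 2 * (1 - 2 * (x ⬝ᵥ θ) / r + 1) := by gcongr
    _ = _ := by field_simp; ring

lemma sum_integral_sq_le_regret (hA : A.PosDef) {θ : Fin d → ℝ} (hθ : 0 < matNorm A θ)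
    (ν : ℕ → Measure ℝ) [∀ t, IsProbabilityMeasure (ν t)] (T : ℕ)
    {ι : Type*} [Fintype ι] [DecidableEq ι] {v : ι → Fin d → ℝ}
    (hv : ∀ i j, (CFC.sqrt A *ᵥ v i) ⬝ᵥ (CFC.sqrt A *ᵥ v j) = if i = j then 1 else 0) :
    matNorm A θ / 2 * ∑ j, ∫ p : 𝒜.Seed × (ℕ → ℝ), (∑ t ∈ Finset.range T,
      (action 𝒜 θ p.1 p.2 t ⬝ᵥ v j
        - (CFC.sqrt A *ᵥ θ) ⬝ᵥ (CFC.sqrt A *ᵥ v j) / matNorm A θ) ^ 2)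
      ∂(𝒜.law.prod (Measure.infinitePi ν)) ≤ regret 𝒜 θ ν T := by
  have hi := fun j => integrable_sum_sub_sq 𝒜 hA θ (v j) T ν
    ((CFC.sqrt A *ᵥ θ) ⬝ᵥ (CFC.sqrt A *ᵥ v j) / matNorm A θ)
  rw [← integral_finsetSum _ fun j _ => hi j, ← integral_const_mul]
  refine integral_mono ((integrable_finsetSum _ fun j _ => hi j).const_mul _)
    (integrable_comp_action_dotProduct 𝒜 hA θ θ T ν
      (f := fun x => optimalAction A θ ⬝ᵥ θ - x) (by fun_prop)
      (c := |optimalAction A θ ⬝ᵥ θ| + matNorm A θ) fun x hx => ?_) fun p => ?_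
  · exact (abs_sub _ _).trans (by linarith)
  · simp only
    rw [Finset.sum_comm, Finset.mul_sum]
    refine Finset.sum_le_sum fun t _ => ?_
    rw [optimalAction_dotProduct_self hA]
    exact sum_sq_le_matNorm_sub hA hθ (𝒜.act_mem _ _ _) hv

end Lower

section Pair

variable {d : ℕ} {A : Matrix (Fin d) (Fin d) ℝ} (𝒜 : Algorithm (ellipsoid A)) {σ : ℝ≥0}

/-- If `θ' - θ` is a small multiple of `v`, then the rewards of a learner whose expected reward in
direction `v` has to be close to `-η` under `θ` and close to `η` under `θ'` do not tell it which of
the two is the case. -/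
lemma le_integral_add_integral_of_sub_eq_smul (hA : A.PosDef) (hσ : 0 < σ) {θ θ' v : Fin d → ℝ}
    {Δ η : ℝ} (hη : 0 ≤ η) (hsub : θ' - θ = (2 * Δ) • v) (T : ℕ)
    (hΔ : 32 * T * Δ ^ 2 * η ^ 2 ≤ σ ^ 2) :
    T * η ^ 2 / 2 ≤
      ∫ p : 𝒜.Seed × (ℕ → ℝ), (∑ t ∈ Finset.range T, (action 𝒜 θ p.1 p.2 t ⬝ᵥ v - -η) ^ 2)
        ∂(𝒜.law.prod (Measure.infinitePi fun _ => gaussianReal 0 (σ ^ 2))) +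
      ∫ p : 𝒜.Seed × (ℕ → ℝ), (∑ t ∈ Finset.range T, (action 𝒜 θ' p.1 p.2 t ⬝ᵥ v - η) ^ 2)
        ∂(𝒜.law.prod (Measure.infinitePi fun _ => gaussianReal 0 (σ ^ 2))) := by
  set ν : ℕ → Measure ℝ := fun _ => gaussianReal 0 (σ ^ 2) with hν
  have hσ' : (0 : ℝ) < σ := hσ
  have hi1 := integrable_sum_sub_sq 𝒜 hA θ v T ν (-η)
  have hi2 := integrable_sum_sub_sq 𝒜 hA θ' v T ν η
  have hi0 := integrable_sum_sub_sq 𝒜 hA θ v T ν 0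
  simp only [sub_zero] at hi0
  have hTη : 0 ≤ T * η ^ 2 := by positivity
  -- The integral measures the information gathered about the sign of the shift. If it is large, the
  -- actions are already far from -η, because (y + η)² ≥ y²/2 - η². If it is small, the two-point
  -- bound applies to the number of rounds with nonnegative component along v: such a round costs η²
  -- under θ, any other round costs η² under θ'.
  rcases le_or_gt (4 * (T * η ^ 2)) (∫ p : 𝒜.Seed × (ℕ → ℝ),
      (∑ t ∈ Finset.range T, (action 𝒜 θ p.1 p.2 t ⬝ᵥ v) ^ 2)
      ∂(𝒜.law.prod (Measure.infinitePi ν))) with hS | hS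
  · have h2 : 0 ≤ ∫ p : 𝒜.Seed × (ℕ → ℝ),
        (∑ t ∈ Finset.range T, (action 𝒜 θ' p.1 p.2 t ⬝ᵥ v - η) ^ 2)
        ∂(𝒜.law.prod (Measure.infinitePi ν)) :=
      integral_nonneg fun p => Finset.sum_nonneg fun t _ => sq_nonneg _
    have h1 := integral_mono ((hi0.const_mul (1 / 2)).sub (integrable_const (T * η ^ 2))) hi1
      fun p => by
        simp only [Pi.sub_apply]
        calc 1 / 2 * ∑ t ∈ Finset.range T, (action 𝒜 θ p.1 p.2 t ⬝ᵥ v) ^ 2 - T * η ^ 2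
            = ∑ t ∈ Finset.range T, (1 / 2 * (action 𝒜 θ p.1 p.2 t ⬝ᵥ v) ^ 2 - η ^ 2) := by
              rw [Finset.sum_sub_distrib, Finset.mul_sum]
              simp
          _ ≤ _ := Finset.sum_le_sum fun t _ => by
              nlinarith [sq_nonneg (action 𝒜 θ p.1 p.2 t ⬝ᵥ v + 2 * η)]
    rw [integral_sub' (hi0.const_mul _) (integrable_const _), integral_const_mul,
      integral_const] at h1
    simp only [probReal_univ, one_smul] at h1
    linarith
  · set f : ℝ → ℝ := fun x => if 0 ≤ x then 1 else 0 with hf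
    have hfm : Measurable f := Measurable.ite measurableSet_Ici measurable_const measurable_const
    have hf0 : ∀ x, 0 ≤ f x := fun x => by simp only [hf]; split_ifs <;> simp
    have hf1 : ∀ x, f x ≤ 1 := fun x => by simp only [hf]; split_ifs <;> simp
    have hfabs : ∀ x, |x| ≤ matNorm A v → |f x| ≤ 1 := fun x _ => by
      rw [abs_of_nonneg (hf0 x)]
      exact hf1 x
    have hc1 := integrable_comp_action_dotProduct 𝒜 hA θ v T ν hfm hfabs
    have hc2 := integrable_comp_action_dotProduct 𝒜 hA θ' v T ν hfm hfabs
    have hc3 := (integrable_const (T : ℝ)).sub hc2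
    have h1 := integral_mono (hc1.const_mul (η ^ 2)) hi1 fun p => by
      simp only
      rw [Finset.mul_sum]
      refine Finset.sum_le_sum fun t _ => ?_
      simp only [hf]
      split_ifs with h
      · nlinarith
      · rw [mul_zero]
        positivity
    have h2 := integral_mono (hc3.const_mul (η ^ 2)) hi2 fun p => by
      simp only [Pi.sub_apply]
      have : (T : ℝ) = ∑ t ∈ Finset.range T, 1 := by simp
      rw [this, ← Finset.sum_sub_distrib, Finset.mul_sum]
      refine Finset.sum_le_sum fun t _ => ?_
      simp only [hf]
      split_ifs with h
      · rw [sub_self, mul_zero]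
        positivity
      · nlinarith
    rw [integral_const_mul] at h1 h2
    -- The change of measure is carried out for each fixed seed, then averaged over the seed by
    -- Fubini.
    have hseed : ∀ u : 𝒜.Seed, T * (2 / 3 - 1 / (3 * σ ^ 2) * ((4 * Δ ^ 2) *
        ∫ z, (∑ t ∈ Finset.range T, (action 𝒜 θ u z t ⬝ᵥ v) ^ 2) ∂(Measure.infinitePi ν))) ≤
        ∫ z, (∑ t ∈ Finset.range T, f (action 𝒜 θ u z t ⬝ᵥ v)) ∂(Measure.infinitePi ν) +
        ∫ z, (T - ∑ t ∈ Finset.range T, f (action 𝒜 θ' u z t ⬝ᵥ v))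
          ∂(Measure.infinitePi ν) := fun u => by
      set g : (Fin T → ℝ) → ℝ := fun h => ∑ t : Fin T,
        f (𝒜.act t u (fun i => h (Fin.castLE t.2.le i)) ⬝ᵥ v) with hg
      have hgm : Measurable g := Finset.measurable_fun_sum _ fun t _ => hfm.comp
        (measurable_dotProduct_left ((measurable_act_seed 𝒜 u t).comp
          (measurable_pi_iff.2 fun i => measurable_pi_apply _)) v)
      have hgT : ∀ h, g h ≤ T := fun h =>
        (Finset.sum_le_sum fun t _ => hf1 _).trans (by simp)
      have hgh : ∀ θ z, g (history 𝒜 θ u z T) =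
          ∑ t ∈ Finset.range T, f (action 𝒜 θ u z t ⬝ᵥ v) := fun θ z =>
        Fin.sum_univ_eq_sum_range (fun t => f (action 𝒜 θ u z t ⬝ᵥ v)) T
      have h := two_point_lower_bound 𝒜 θ θ' hA hσ u T hgm
        (fun h => Finset.sum_nonneg fun t _ => hf0 _) hgT
      have hms : ∀ z t, meanShift 𝒜 θ θ' u z t ^ 2
          = 4 * Δ ^ 2 * (action 𝒜 θ u z t ⬝ᵥ v) ^ 2 := fun z t => by
        rw [meanShift, hsub, dotProduct_smul, smul_eq_mul]
        ring
      simp only [hgh, hms, ← Finset.mul_sum] at h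
      rw [integral_const_mul] at h
      exact h
    have hseed' := integral_mono
      (((integrable_const (2 / 3 : ℝ)).sub
        ((hi0.integral_prod_left.const_mul (4 * Δ ^ 2)).const_mul (1 / (3 * (σ : ℝ) ^ 2)))).const_mul
          (T : ℝ))
      (hc1.integral_prod_left.add hc3.integral_prod_left) hseed
    rw [integral_const_mul, integral_sub' (integrable_const _)
        ((hi0.integral_prod_left.const_mul (4 * Δ ^ 2)).const_mul _), integral_const_mul,
      integral_const_mul, integral_add' hc1.integral_prod_left hc3.integral_prod_left,
      ← integral_prod _ hi0, ← integral_prod _ hc1, ← integral_prod _ hc3, integral_const] at hseed'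
    simp only [probReal_univ, one_smul] at hseed'
    have hsmall : 1 / (3 * (σ : ℝ) ^ 2) * (4 * Δ ^ 2 * ∫ p : 𝒜.Seed × (ℕ → ℝ),
        (∑ t ∈ Finset.range T, (action 𝒜 θ p.1 p.2 t ⬝ᵥ v) ^ 2)
        ∂(𝒜.law.prod (Measure.infinitePi ν))) ≤ 1 / 6 := by
      calc _ ≤ 1 / (3 * (σ : ℝ) ^ 2) * (4 * Δ ^ 2 * (4 * (T * η ^ 2))) := by gcongr
        _ = (32 * T * Δ ^ 2 * η ^ 2) / (6 * σ ^ 2) := by ring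
        _ ≤ σ ^ 2 / (6 * σ ^ 2) := by gcongr
        _ = 1 / 6 := by field_simp
    have hT0 : (0 : ℝ) ≤ T := by positivity
    have h3 := mul_le_mul_of_nonneg_left hseed' (sq_nonneg η)
    have h4 := mul_le_mul_of_nonneg_left hsmall hTη
    nlinarith [h1, h2, h3, h4]

end Pair

/-! ### Local asymptotic minimax optimality -/

section Optimality

variable {d : ℕ} {A : Matrix (Fin d) (Fin d) ℝ} {σ : ℝ≥0}

/-- The sign attached to a truth value. -/
def boolSign (b : Bool) : ℝ := if b then 1 else -1

lemma boolSign_mul_self (b : Bool) : boolSign b * boolSign b = 1 := by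
  cases b <;> simp [boolSign]

lemma abs_boolSign (b : Bool) : |boolSign b| = 1 := by
  cases b <;> simp [boolSign]

/-- The vertex `ε` of the hypercube with centre `θ` and edges of length `2 * Δ` in the directions
`v j`. -/
def cubeVertex {n : ℕ} (θ : Fin d → ℝ) (v : Fin n → Fin d → ℝ) (Δ : ℝ) (ε : Fin n → Bool) :
    Fin d → ℝ :=
  θ + Δ • ∑ j, boolSign (ε j) • v j

lemma cubeVertex_update_sub {n : ℕ} (θ : Fin d → ℝ) (v : Fin n → Fin d → ℝ) (Δ : ℝ)
    (ε : Fin n → Bool) (j : Fin n) :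
    cubeVertex θ v Δ (Function.update ε j true) - cubeVertex θ v Δ (Function.update ε j false)
      = (2 * Δ) • v j := by
  rw [cubeVertex, cubeVertex, add_sub_add_left_eq_sub, ← smul_sub, ← Finset.sum_sub_distrib,
    Finset.sum_eq_single j, mul_comm, mul_smul]
  · congr 1
    simp only [Function.update_self, boolSign]
    rw [← sub_smul]
    norm_num
  · intro i _ hij
    simp [Function.update_of_ne hij]
  · simp

lemma norm_cubeVertex_sub_le {n : ℕ} (θ : Fin d → ℝ) (v : Fin n → Fin d → ℝ) {Δ : ℝ}
    (hΔ : 0 ≤ Δ) (ε : Fin n → Bool) :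
    ‖cubeVertex θ v Δ ε - θ‖ ≤ (∑ j, ‖v j‖) * Δ := by
  rw [cubeVertex, add_sub_cancel_left, norm_smul, Real.norm_of_nonneg hΔ, mul_comm]
  refine mul_le_mul_of_nonneg_right ((norm_sum_le _ _).trans (le_of_eq ?_)) hΔ
  refine Finset.sum_congr rfl fun j _ => ?_
  rw [norm_smul, Real.norm_eq_abs, abs_boolSign, one_mul]

variable {n : ℕ} {θ : Fin d → ℝ} {v : Fin n → Fin d → ℝ}

lemma sqrt_mulVec_cubeVertex_dotProduct
    (hv : ∀ i j, (CFC.sqrt A *ᵥ v i) ⬝ᵥ (CFC.sqrt A *ᵥ v j) = if i = j then 1 else 0)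
    (hθv : ∀ i, (CFC.sqrt A *ᵥ θ) ⬝ᵥ (CFC.sqrt A *ᵥ v i) = 0) (Δ : ℝ) (ε : Fin n → Bool)
    (j : Fin n) :
    (CFC.sqrt A *ᵥ cubeVertex θ v Δ ε) ⬝ᵥ (CFC.sqrt A *ᵥ v j) = Δ * boolSign (ε j) := by
  rw [cubeVertex, Matrix.mulVec_add, add_dotProduct, hθv, Matrix.mulVec_smul, Matrix.mulVec_sum,
    smul_dotProduct, sum_dotProduct]
  simp [Matrix.mulVec_smul, smul_dotProduct, hv]

/-- The edges are orthogonal to θ and to each other in the A-inner product. As all vertices have the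
same norm r, the component of the optimal action along v_j is ±Δ/r, its sign depending on coordinate
j of the vertex alone. -/
lemma matNorm_cubeVertex (hA : A.PosDef)
    (hv : ∀ i j, (CFC.sqrt A *ᵥ v i) ⬝ᵥ (CFC.sqrt A *ᵥ v j) = if i = j then 1 else 0)
    (hθv : ∀ i, (CFC.sqrt A *ᵥ θ) ⬝ᵥ (CFC.sqrt A *ᵥ v i) = 0) (Δ : ℝ) (ε : Fin n → Bool) :
    matNorm A (cubeVertex θ v Δ ε) = √(matNorm A θ ^ 2 + n * Δ ^ 2) := by
  have h1 : (CFC.sqrt A *ᵥ cubeVertex θ v Δ ε) ⬝ᵥ (CFC.sqrt A *ᵥ θ) = matNorm A θ ^ 2 := by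
    rw [cubeVertex, Matrix.mulVec_add, add_dotProduct, ← euclNorm_sq, ← matNorm_eq_euclNorm hA,
      Matrix.mulVec_smul, Matrix.mulVec_sum, smul_dotProduct, sum_dotProduct]
    have : ∀ i, (CFC.sqrt A *ᵥ v i) ⬝ᵥ (CFC.sqrt A *ᵥ θ) = 0 := fun i => by
      rw [dotProduct_comm, hθv]
    simp [Matrix.mulVec_smul, smul_dotProduct, this]
  rw [matNorm_eq_euclNorm hA, euclNorm]
  congr 1
  conv_lhs =>
    enter [2]
    rw [cubeVertex]
  rw [Matrix.mulVec_add, dotProduct_add, h1, Matrix.mulVec_smul, Matrix.mulVec_sum,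
    dotProduct_smul, dotProduct_sum]
  simp only [Matrix.mulVec_smul, dotProduct_smul, sqrt_mulVec_cubeVertex_dotProduct hv hθv,
    smul_eq_mul]
  have : ∀ j, boolSign (ε j) * (Δ * boolSign (ε j)) = Δ := fun j => by
    rw [mul_left_comm, boolSign_mul_self, mul_one]
  simp only [this, Finset.sum_const, Finset.card_univ, Fintype.card_fin, nsmul_eq_mul]
  ring

/-- Close to `θ` there is a mean-reward vector at which a given algorithm has regret of order
`σ * d * √T`. -/
lemma exists_cubeVertex_le_regret (hA : A.PosDef) (hσ : 0 < σ) (hnd : n + 1 = d) (hd : 2 ≤ d)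
    (hv : ∀ i j, (CFC.sqrt A *ᵥ v i) ⬝ᵥ (CFC.sqrt A *ᵥ v j) = if i = j then 1 else 0)
    (hθv : ∀ i, (CFC.sqrt A *ᵥ θ) ⬝ᵥ (CFC.sqrt A *ᵥ v i) = 0)
    (hθ : 0 < matNorm A θ) {T : ℕ} (hT : 0 < T) (hTd : σ * d ≤ matNorm A θ * √T)
    (𝒜 : Algorithm (ellipsoid A)) :
    ∃ ε, σ * d * √T / 256 ≤
      regret 𝒜 (cubeVertex θ v √(σ * matNorm A θ / (8 * √T)) ε)
        (fun _ => gaussianReal 0 (σ ^ 2)) T := by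
  set b := matNorm A θ with hb
  set Δ := √(σ * b / (8 * √T)) with hΔ
  have hσ' : (0 : ℝ) < σ := hσ
  have hT' : (0 : ℝ) < √T := Real.sqrt_pos.2 (by exact_mod_cast hT)
  have hTT : (T : ℝ) = √T * √T := (Real.mul_self_sqrt (by positivity)).symm
  have hΔ2 : Δ ^ 2 = σ * b / (8 * √T) := Real.sq_sqrt (by positivity)
  have hn1 : (1 : ℝ) ≤ n := by exact_mod_cast (by omega : 1 ≤ n)
  have hndR : (n : ℝ) + 1 = d := by exact_mod_cast hnd
  set r := √(b ^ 2 + n * Δ ^ 2) with hr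
  have hr2 : r ^ 2 = b ^ 2 + n * Δ ^ 2 := Real.sq_sqrt (by positivity)
  have hr0 : 0 ≤ r := Real.sqrt_nonneg _
  have hbr : b ≤ r := Real.le_sqrt_of_sq_le (by nlinarith [sq_nonneg Δ])
  have hrpos : 0 < r := hθ.trans_le hbr
  -- The cube is no larger than b, so r is comparable to b. This is where T has to be large.
  have hnΔ : n * Δ ^ 2 ≤ b ^ 2 := by
    rw [hΔ2, ← mul_div_assoc, div_le_iff₀ (by positivity)]
    have h1 : σ * n ≤ b * √T := le_trans (by gcongr; linarith) hTd
    nlinarith [mul_le_mul_of_nonneg_left h1 hθ.le, mul_pos (mul_pos hθ hθ) hT']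
  have hr2b : r ≤ 2 * b := by nlinarith
  set η := Δ / r with hη
  have hη0 : 0 ≤ η := div_nonneg (Real.sqrt_nonneg _) hr0
  have hη2 : η ^ 2 = Δ ^ 2 / r ^ 2 := by rw [hη, div_pow]
  -- Since η ≤ Δ/b, the left side is at most 32TΔ⁴/b², which the choice Δ² = σb/(8√T) makes equal to
  -- σ²/2.
  have hsmall : 32 * T * Δ ^ 2 * η ^ 2 ≤ (σ : ℝ) ^ 2 := by
    calc 32 * T * Δ ^ 2 * η ^ 2 ≤ 32 * T * Δ ^ 2 * (Δ ^ 2 / b ^ 2) := by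
          rw [hη2]
          gcongr
      _ = (σ : ℝ) ^ 2 / 2 := by
          rw [hΔ2, hTT]
          simp only [Real.sqrt_mul_self hT'.le]
          field_simp
          norm_num
      _ ≤ (σ : ℝ) ^ 2 := by nlinarith [sq_nonneg (σ : ℝ)]
  obtain ⟨ε, hε⟩ := exists_vertex_le_sum (ι := Fin n) (a := T * η ^ 2 / 2)
    (F := fun j ε => ∫ p : 𝒜.Seed × (ℕ → ℝ), (∑ t ∈ Finset.range T,
      (action 𝒜 (cubeVertex θ v Δ ε) p.1 p.2 t ⬝ᵥ v j - boolSign (ε j) * η) ^ 2)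
      ∂(𝒜.law.prod (Measure.infinitePi fun _ => gaussianReal 0 (σ ^ 2)))) fun j ε => by
        have h := le_integral_add_integral_of_sub_eq_smul 𝒜 hA hσ hη0
          (cubeVertex_update_sub θ v Δ ε j) T hsmall
        simpa [boolSign] using h
  refine ⟨ε, ?_⟩
  have hrε := matNorm_cubeVertex hA hv hθv Δ ε
  rw [← hb, ← hr] at hrε
  have h := sum_integral_sq_le_regret 𝒜 hA (θ := cubeVertex θ v Δ ε) (by rwa [hrε])
    (fun _ => gaussianReal 0 (σ ^ 2)) T hv
  simp only [hrε, sqrt_mulVec_cubeVertex_dotProduct hv hθv] at h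
  have e : ∀ j, Δ * boolSign (ε j) / r = boolSign (ε j) * η := fun j => by rw [hη]; ring
  simp only [e] at h
  refine le_trans ?_ h
  rw [Fintype.card_fin] at hε
  -- d = n + 1 ≤ 2n because d ≥ 2; in dimension one there is no direction orthogonal to θ.
  calc σ * d * √T / 256 ≤ σ * (2 * n) * √T / 256 := by
        gcongr
        linarith
    _ = n * T * Δ ^ 2 / (8 * (2 * b)) := by
        rw [hΔ2, hTT]
        simp only [Real.sqrt_mul_self hT'.le]
        field_simp
        norm_num
    _ ≤ n * T * Δ ^ 2 / (8 * r) := by gcongr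
    _ = r / 2 * (n * (T * η ^ 2 / 2 / 2)) := by
        rw [hη2]
        field_simp
        norm_num
    _ ≤ _ := by gcongr

lemma regret_nonneg (hA : A.PosDef) (𝒜 : Algorithm (ellipsoid A)) (θ : Fin d → ℝ)
    (ν : ℕ → Measure ℝ) [∀ t, IsProbabilityMeasure (ν t)] (T : ℕ) : 0 ≤ regret 𝒜 θ ν T :=
  integral_nonneg fun _ => Finset.sum_nonneg fun _ _ =>
    sub_nonneg.2 (isMaxOn_optimalAction hA θ (𝒜.act_mem _ _ _))

lemma matNorm_smul (hA : A.PosDef) (a : ℝ) (θ : Fin d → ℝ) :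
    matNorm A (a • θ) = |a| * matNorm A θ := by
  rw [← abs_of_nonneg (matNorm_nonneg A (a • θ)), ← abs_of_nonneg (matNorm_nonneg A θ), ← abs_mul,
    ← sq_eq_sq_iff_abs_eq_abs, mul_pow, matNorm_sq hA, matNorm_sq hA, Matrix.mulVec_smul,
    smul_dotProduct, dotProduct_smul, smul_eq_mul, smul_eq_mul]
  ring

/-- The first action is chosen without information, so the regret is unbounded. -/
lemma exists_le_regret (hA : A.PosDef) (𝒜 : Algorithm (ellipsoid A)) (θ : Fin d → ℝ)
    (ν : ℕ → Measure ℝ) [∀ t, IsProbabilityMeasure (ν t)] {T : ℕ} (hT : 0 < T) (k : ℝ) :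
    ∃ θ', k * matNorm A θ ≤ regret 𝒜 θ' ν T := by
  set m := ∫ p : 𝒜.Seed × (ℕ → ℝ), action 𝒜 0 p.1 p.2 0 ⬝ᵥ θ
    ∂(𝒜.law.prod (Measure.infinitePi ν)) with hm
  have key : ∀ a : ℝ, |a| * matNorm A θ - a * m ≤ regret 𝒜 (a • θ) ν T := fun a => by
    have hi : Integrable (fun p : 𝒜.Seed × (ℕ → ℝ) => action 𝒜 0 p.1 p.2 0 ⬝ᵥ θ)
        (𝒜.law.prod (Measure.infinitePi ν)) := by
      simpa using integrable_comp_action_dotProduct 𝒜 hA 0 θ 1 ν measurable_id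
        (c := matNorm A θ) fun x hx => hx
    have hmono := integral_mono ((integrable_const (|a| * matNorm A θ)).sub (hi.const_mul a))
      (integrable_comp_action_dotProduct 𝒜 hA (a • θ) (a • θ) T ν
        (f := fun x => optimalAction A (a • θ) ⬝ᵥ (a • θ) - x) (by fun_prop)
        (c := |optimalAction A (a • θ) ⬝ᵥ (a • θ)| + matNorm A (a • θ))
        fun x hx => (abs_sub _ _).trans (by linarith)) fun p => by
          have hact : action 𝒜 0 p.1 p.2 0 = action 𝒜 (a • θ) p.1 p.2 0 := by
            rw [action_eq_act, action_eq_act]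
            congr 1
            exact funext fun s => s.elim0
          simp only [Pi.sub_apply]
          rw [hact, ← smul_eq_mul (a := a), ← dotProduct_smul, ← matNorm_smul hA,
            ← optimalAction_dotProduct_self hA]
          exact Finset.single_le_sum
            (f := fun t => optimalAction A (a • θ) ⬝ᵥ (a • θ)
              - action 𝒜 (a • θ) p.1 p.2 t ⬝ᵥ (a • θ))
            (fun t _ => sub_nonneg.2 (isMaxOn_optimalAction hA _ (𝒜.act_mem _ _ _)))
            (Finset.mem_range.2 hT)
    rw [integral_sub' (integrable_const _) (hi.const_mul a), integral_const, integral_const_mul]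
      at hmono
    simp only [probReal_univ, one_smul] at hmono
    exact hmono
  have hkb := mul_le_mul_of_nonneg_right (le_abs_self k) (matNorm_nonneg A θ)
  -- The direction ±θ is chosen against the mean of the first action, so that -a·m ≥ 0 and this
  -- action alone costs at least |k|·b.
  rcases le_total m 0 with h | h
  · refine ⟨|k| • θ, le_trans ?_ (key |k|)⟩
    rw [abs_abs]
    nlinarith [mul_nonneg (abs_nonneg k) (neg_nonneg.2 h)]
  · refine ⟨(-|k|) • θ, le_trans ?_ (key (-|k|))⟩
    rw [abs_neg, abs_abs]
    nlinarith [mul_nonneg (abs_nonneg k) h]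

theorem locallyAsymptoticallyMinimaxOptimal_e2tc [NeZero d] (hd : 2 ≤ d) (hA : A.PosDef)
    (hσ : 0 < σ) :
    LocallyAsymptoticallyMinimaxOptimal (1 / 4608000) σ fun T => e2tc hA σ 3 T := by
  intro θ ℬ
  have hσ' : (0 : ℝ) < σ := hσ
  set b := matNorm A θ with hb
  have hb0 : 0 ≤ b := matNorm_nonneg A θ
  rcases hb0.eq_or_lt with h0 | hbpos
  -- At θ = 0 all actions are optimal and E2TC has no regret.
  · refine ⟨fun _ => θ, tendsto_const_nhds, fun T ν _ hν => le_trans ?_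
      (regret_nonneg hA (ℬ T) θ _ T)⟩
    have h := (regret_e2tc_le hA hσ hν θ T).trans
      (mul_le_mul_of_nonneg_left (min_le_right _ _) (by norm_num))
    rw [← hb, ← h0] at h
    linarith
  have hφ : CFC.sqrt A *ᵥ θ ≠ 0 := fun h => hbpos.ne' (by
    rw [hb, matNorm_eq_euclNorm hA, h]
    simp [euclNorm])
  obtain ⟨n, hnd, e, he, hφe⟩ := exists_orthonormal_orthogonal hφ
  set v : Fin n → Fin d → ℝ := fun j => (CFC.sqrt A)⁻¹ *ᵥ e j with hvdef
  have hSv : ∀ j, CFC.sqrt A *ᵥ v j = e j := fun j => sqrt_mulVec_inv_mulVec hA (e j)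
  have hv : ∀ i j, (CFC.sqrt A *ᵥ v i) ⬝ᵥ (CFC.sqrt A *ᵥ v j) = if i = j then 1 else 0 :=
    fun i j => by rw [hSv, hSv, he]
  have hθv : ∀ i, (CFC.sqrt A *ᵥ θ) ⬝ᵥ (CFC.sqrt A *ᵥ v i) = 0 := fun i => by rw [hSv, hφe]
  have hex : ∀ T : ℕ, ∃ θ' : Fin d → ℝ,
      ((0 < T ∧ σ * d ≤ b * √T ∧ b ≤ σ * √T) →
        ‖θ' - θ‖ ≤ (∑ j, ‖v j‖) * √(σ * b / (8 * √T))) ∧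
      ∀ (ν : ℕ → Measure ℝ) [∀ t, IsProbabilityMeasure (ν t)], IsSubgaussianNoise σ ν →
        1 / 4608000 * regret (e2tc hA σ 3 T) θ ν T ≤
          regret (ℬ T) θ' (fun _ => gaussianReal 0 (σ ^ 2)) T := fun T => by
    rcases Nat.eq_zero_or_pos T with rfl | hT
    · exact ⟨θ, fun h => absurd h.1 (lt_irrefl 0), fun ν _ _ => by simp [regret]⟩
    -- Both conditions hold for all large T. The first is the one for the hypercube; the second
    -- gives db ≤ σd√T, so the regret of E2TC is at most 18000σd√T, and 18000 · 256 = 4608000.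
    by_cases hbig : σ * d ≤ b * √T ∧ b ≤ σ * √T
    · obtain ⟨ε, hε⟩ := exists_cubeVertex_le_regret hA hσ hnd hd hv hθv hbpos hT hbig.1 (ℬ T)
      refine ⟨_, fun _ => norm_cubeVertex_sub_le θ v (Real.sqrt_nonneg _) ε,
        fun ν _ hν => le_trans ?_ hε⟩
      have h := (regret_e2tc_le hA hσ hν θ T).trans
        (mul_le_mul_of_nonneg_left (min_le_left _ _) (by norm_num))
      have h2 : d * b ≤ σ * d * √T := by
        have := mul_le_mul_of_nonneg_left hbig.2 (Nat.cast_nonneg (α := ℝ) d)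
        linarith
      rw [← hb] at h
      linarith
    -- Such T are bounded, so θ' need not be close to θ.
    · obtain ⟨θ', hθ'⟩ := exists_le_regret hA (ℬ T) θ (fun _ => gaussianReal 0 (σ ^ 2)) hT T
      refine ⟨θ', fun h => absurd h.2 hbig, fun ν _ hν => le_trans ?_ hθ'⟩
      have h := (regret_e2tc_le hA hσ hν θ T).trans
        (mul_le_mul_of_nonneg_left (min_le_right _ _) (by norm_num))
      have h2 : 0 ≤ T * matNorm A θ := mul_nonneg (Nat.cast_nonneg _) hb0
      linarith
  choose θ' hclose hregret using hex
  refine ⟨θ', ?_, fun T ν _ hν => hregret T ν hν⟩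
  have hsqrt : Tendsto (fun T : ℕ => √(T : ℝ)) atTop atTop :=
    Real.tendsto_sqrt_atTop.comp tendsto_natCast_atTop_atTop
  have hlim : Tendsto (fun T : ℕ => (∑ j, ‖v j‖) * √(σ * b / (8 * √T))) atTop (𝓝 0) := by
    have h1 : Tendsto (fun T : ℕ => σ * b / (8 * √(T : ℝ))) atTop (𝓝 0) :=
      tendsto_const_nhds.div_atTop (hsqrt.const_mul_atTop (by norm_num))
    have h2 := (h1.sqrt).const_mul (∑ j, ‖v j‖)
    simpa using h2
  refine tendsto_iff_norm_sub_tendsto_zero.2 (squeeze_zero' (Eventually.of_forall fun _ =>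
    norm_nonneg _) ?_ hlim)
  filter_upwards [eventually_gt_atTop 0, (hsqrt.const_mul_atTop hbpos).eventually_ge_atTop (σ * d),
    (hsqrt.const_mul_atTop hσ').eventually_ge_atTop b] with T h1 h2 h3
  exact hclose T ⟨h1, h2, h3⟩

end Optimality

end EllipsoidBandit

end

theorem corollary4 :
    (∃ C : ℝ, 0 < C ∧
      ∀ (d : ℕ) [NeZero d] (A : Matrix (Fin d) (Fin d) ℝ) (hA : A.PosDef) (σ : ℝ≥0), 0 < σ →
        ∀ (ν : ℕ → Measure ℝ) [∀ t, IsProbabilityMeasure (ν t)],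
          EllipsoidBandit.IsSubgaussianNoise σ ν →
        ∀ (θ : Fin d → ℝ) (T : ℕ),
          EllipsoidBandit.regret (EllipsoidBandit.e2tc hA σ 3 T) θ ν T ≤
            C * min ((σ : ℝ) * d * Real.sqrt T + d * EllipsoidBandit.matNorm A θ)
              (T * EllipsoidBandit.matNorm A θ)) ∧
    (∃ c : ℝ, 0 < c ∧
      ∀ (d : ℕ) [NeZero d], 2 ≤ d →
        ∀ (A : Matrix (Fin d) (Fin d) ℝ) (hA : A.PosDef) (σ : ℝ≥0), 0 < σ →
          EllipsoidBandit.LocallyAsymptoticallyMinimaxOptimal c σ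
            (fun T => EllipsoidBandit.e2tc hA σ 3 T)) :=
  ⟨⟨9000, by norm_num, fun _ _ _ hA _ hσ _ _ hν θ T =>
      EllipsoidBandit.regret_e2tc_le hA hσ hν θ T⟩,
    ⟨1 / 4608000, by norm_num, fun _ _ hd _ hA _ hσ =>
      EllipsoidBandit.locallyAsymptoticallyMinimaxOptimal_e2tc hd hA hσ⟩⟩
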